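/- **Setting.** Let $k$ be a field, $n\in\mathbb N$, $I=\{1,\dots,n\}$, and let $\alpha_1,\dots,\alpha_n$ be the standard basis of $\mathbb Z^n$. Let $\chi:\mathbb Z^n\times\mathbb Z^n\to k^\times$ be a bicharacter such that the numbers $q_{ij}=\chi(\alpha_i,\alpha_j)$ satisfy $q_{ij}=q_{ji}$. Let $T$ be the free algebra on $E_1,\dots,E_n$, $\mathbb Z^n$-graded by $\deg E_i=\alpha_i$, regarded as a braided bialgebra: its coproduct is the algebra homomorphism $T\to T\otimes T$ with $E_i\mapsto E_i\otimes 1+1\otimes E_i$, where $T\otimes T$ has the product $(a\otimes b)(a'\otimes b')=\chi(\deg b,\deg a')\,aa'\otimes bb'$ for homogeneous $b,a'$. Let $\tau:I\to I$ be a bijection with $\tau^2=\mathrm{id}$ and $q_{\tau(i)\tau(j)}=q_{ij}$ for all $i,j$, and let $\mathcal I\subseteq\bigoplus_{m\ge 2}T_m$ be a $\mathbb Z^n$-graded biideal of $T$ that is stable under $E_i\mapsto E_{\tau(i)}$, that is, $\tau(\mathcal I)=\mathcal I$. The pre-Nichols algebra is $U^+=T/\mathcal I$. The algebra $U(\chi)$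 is generated by $E_i,F_i,K_i^{\pm1}$ ($i\in I$), where the $K_i^{\pm 1}$ commute with each other and $K_iK_i^{-1}=K_i^{-1}K_i=1$, with relations $$K_iE_j=q_{ij}E_jK_i,\qquad K_iF_j=q_{ij}^{-1}F_jK_i,\qquad E_iF_j-F_jE_i=\delta_{ij}(K_i-K_i^{-1}),$$ and $p(E_1,\dots,E_n)=0=p(F_1,\dots,F_n)$ for all noncommutative polynomials $p\in\mathcal I$. Let $U^-$ and $H_\theta$ be the subalgebras of $U(\chi)$ generated by the $F_i$ and by the $K_iK_{\tau(i)}^{-1}$, respectively, and let $H_\theta\ltimes U^-$ be the subalgebra generated by $H_\theta$ and $U^-$; it is graded by $\deg F_i=1$ and $\deg h=0$ for $h\in H_\theta$. For $\mathbf c=(c_1,\dots,c_n)\in k^n$ let $B_{\mathbf c}\subseteq U(\chi)$ be the subalgebra generated by $H_\theta$ and the elements $B_i=F_i+c_iE_{\tau(i)}K_i^{-1}$, $i\in I$. Let $U(\chi)^{\mathrm{poly}}\subseteq U(\chi)$ be the subalgebra generated by $F_i$, $E_iK_i^{-1}$, $K_i^{-1}$, $K_iK_{\tau(i)}^{-1}$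 ($i\in I$); it contains $B_{\mathbf c}$. The Heisenberg double $\mathrm{Heis}(\chi)$ is the quotient of $U(\chi)^{\mathrm{poly}}$ by the two-sided ideal generated by $K_1^{-1},\dots,K_n^{-1}$, and $\kappa:U(\chi)^{\mathrm{poly}}\to\mathrm{Heis}(\chi)$ is the projection. Put $\overline B_{\mathbf c}=\kappa(B_{\mathbf c})$, $\overline B_i=\kappa(B_i)$, and let $\overline G^+$ be the subalgebra of $\mathrm{Heis}(\chi)$ generated by the elements $\kappa(E_iK_i^{-1})$. Filter $\overline B_{\mathbf c}$ by the degree function $\deg\overline B_i=1$, $\deg\kappa(h)=0$ for $h\in H_\theta$ (the $m$-th piece is spanned by the products of these generators of total degree at most $m$), and let $\mathrm{gr}(\overline B_{\mathbf c})$ be the associated graded algebra. **Theorem.** For all such data (thus for every pre-Nichols algebra $U^+$ of diagonal type as above) and every $\mathbf c\in k^n$, there is a unique algebra homomorphism $$\overline\varphi:\mathrm{gr}(\overline B_{\mathbf c})\to H_\theta\ltimes U^-$$ such that $\overline\varphi$ sends the class of $\overline B_i$ in degree $1$ to $F_i$ for all $i\in I$ and the class of $\kappa(h)$ in degree $0$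 to $h$ for all $h\in H_\theta$, and $\overline\varphi$ is an isomorphism of graded algebras: it is bijective and maps the degree $m$ part of $\mathrm{gr}(\overline B_{\mathbf c})$ onto $H_\theta\cdot\mathrm{span}_k\{F_{j_1}\cdots F_{j_m}\mid j_1,\dots,j_m\in I\}$ for every $m\in\mathbb N$. Moreover, the pair $(\mathrm{Heis}(\chi),\overline B_{\mathbf c})$ has an Iwasawa decomposition: the multiplication map $\overline G^+\otimes_k\overline B_{\mathbf c}\to\mathrm{Heis}(\chi)$ is a linear isomorphism. -/

import Mathlib

open scoped TensorProduct DirectSum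

noncomputable section

/-! ### The associated graded algebra of a filtered algebra -/

namespace AssocGraded

variable {k A : Type*} [CommRing k] [Ring A] [Algebra k A]

/-- `F_{<m}`, the sum of all `F_i` with `i < m`; it is `0` for `m = 0`, and it is `F_{m-1}` for
`m ≥ 1` if `F` is increasing. -/
def lower (F : ℕ → Submodule k A) (m : ℕ) : Submodule k A := ⨆ i : ℕ, ⨆ _ : i < m, F i

/-- The component `F_m / F_{<m}` of the associated graded algebra. -/
def Component (F : ℕ → Submodule k A) (m : ℕ) : Type _ :=
  ↥(F m) ⧸ (lower F m).submoduleOf (F m)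

instance (F : ℕ → Submodule k A) (m : ℕ) : AddCommGroup (Component F m) :=
  inferInstanceAs (AddCommGroup (↥(F m) ⧸ (lower F m).submoduleOf (F m)))

instance (F : ℕ → Submodule k A) (m : ℕ) : Module k (Component F m) :=
  inferInstanceAs (Module k (↥(F m) ⧸ (lower F m).submoduleOf (F m)))

/-- The class in `F_m / F_{<m}` of an element of `F_m`. -/
def mk (F : ℕ → Submodule k A) (m : ℕ) : F m →ₗ[k] Component F m :=
  Submodule.mkQ _

theorem mk_eq_zero (F : ℕ → Submodule k A) (m : ℕ) (x : F m) (hx : (x : A) ∈ lower F m) :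
    mk F m x = 0 :=
  (Submodule.Quotient.mk_eq_zero _).2 hx

theorem sigma_mk_eq (F : ℕ → Submodule k A) {i j : ℕ} (h : i = j) (a : F i) (b : F j) (hab : (a : A) = b) :
    (GradedMonoid.mk i (mk F i a) : GradedMonoid (Component F)) = GradedMonoid.mk j (mk F j b) := by
  subst h
  rw [Subtype.ext hab]

variable (F : ℕ → Submodule k A) [SetLike.GradedMonoid F]

theorem lower_mul {i j : ℕ} {a b : A} (ha : a ∈ lower F i) (hb : b ∈ F j) :
    a * b ∈ lower F (i + j) := by
  have h : lower F i ≤ (lower F (i + j)).comap (LinearMap.mulRight k b) := by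
    refine iSup₂_le fun i' hi' x hx => ?_
    have : F (i' + j) ≤ lower F (i + j) := le_iSup₂_of_le (i' + j) (by omega) le_rfl
    exact this (SetLike.mul_mem_graded hx hb)
  exact h ha

theorem mul_lower {i j : ℕ} {a b : A} (ha : a ∈ F i) (hb : b ∈ lower F j) :
    a * b ∈ lower F (i + j) := by
  have h : lower F j ≤ (lower F (i + j)).comap (LinearMap.mulLeft k a) := by
    refine iSup₂_le fun j' hj' x hx => ?_
    have : F (i + j') ≤ lower F (i + j) := le_iSup₂_of_le (i + j') (by omega) le_rfl
    exact this (SetLike.mul_mem_graded ha hx)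
  exact h hb

/-- Multiplication `F_i × F_j → F_{i+j} / F_{<i+j}`. -/
def preMul (i j : ℕ) : F i →ₗ[k] F j →ₗ[k] Component F (i + j) :=
  LinearMap.mk₂ k (fun a b => mk F (i + j) ⟨a * b, SetLike.mul_mem_graded a.2 b.2⟩)
    (fun a a' b => by rw [← map_add]; congr 1; ext; simp [add_mul])
    (fun r a b => by rw [← map_smul]; congr 1; ext; simp)
    (fun a b b' => by rw [← map_add]; congr 1; ext; simp [mul_add])
    (fun r a b => by rw [← map_smul]; congr 1; ext; simp)

/-- The product `[a] [b] = [a b]` of homogeneous elements of the associated graded algebra. -/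
def mul (i j : ℕ) : Component F i →ₗ[k] Component F j →ₗ[k] Component F (i + j) :=
  Submodule.liftQ _
    (LinearMap.flip (Submodule.liftQ _ (LinearMap.flip (preMul F i j)) (by
      intro b hb
      exact LinearMap.ext fun a => mk_eq_zero F _ _ (mul_lower F a.2 hb)))) (by
    intro a ha
    refine LinearMap.ext fun b => ?_
    induction b using Submodule.Quotient.induction_on with | _ b => ?_
    exact mk_eq_zero F _ _ (lower_mul F ha b.2))

theorem mul_mk (i j : ℕ) (a : F i) (b : F j) :
    mul F i j (mk F i a) (mk F j b) = mk F (i + j) ⟨a * b, SetLike.mul_mem_graded a.2 b.2⟩ :=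
  rfl

instance : GradedMonoid.GMul (Component F) where
  mul a b := mul F _ _ a b

instance : GradedMonoid.GOne (Component F) where
  one := mk F 0 ⟨1, SetLike.one_mem_graded F⟩

instance : DirectSum.GRing (Component F) where
  mul_zero a := map_zero (mul F _ _ a)
  zero_mul b := by
    change mul F _ _ 0 b = 0
    simp
  mul_add a b c := map_add (mul F _ _ a) b c
  add_mul a b c := by
    change mul F _ _ (a + b) c = mul F _ _ a c + mul F _ _ b c
    simp
  one_mul := by
    rintro ⟨i, a⟩
    induction a using Submodule.Quotient.induction_on with | _ a => ?_
    exact sigma_mk_eq F (zero_add i) ⟨1 * a, _⟩ a (one_mul _)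
  mul_one := by
    rintro ⟨i, a⟩
    induction a using Submodule.Quotient.induction_on with | _ a => ?_
    exact sigma_mk_eq F (add_zero i) ⟨a * 1, _⟩ a (mul_one _)
  mul_assoc := by
    rintro ⟨i, a⟩ ⟨j, b⟩ ⟨l, c⟩
    induction a using Submodule.Quotient.induction_on with | _ a => ?_
    induction b using Submodule.Quotient.induction_on with | _ b => ?_
    induction c using Submodule.Quotient.induction_on with | _ c => ?_
    exact sigma_mk_eq F (add_assoc i j l) ⟨a * b * c, _⟩ ⟨a * (b * c), _⟩ (mul_assoc _ _ _)
  natCast m := mk F 0 ⟨m, SetLike.natCast_mem_graded F m⟩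
  natCast_zero := mk_eq_zero F _ _ (by simp)
  natCast_succ m := by
    change mk F 0 _ = mk F 0 _ + mk F 0 _
    rw [← map_add]
    congr 1; ext; simp
  intCast m := mk F 0 ⟨m, SetLike.intCast_mem_graded F m⟩
  intCast_ofNat m := by
    change mk F 0 _ = mk F 0 _
    congr 1; ext; simp
  intCast_negSucc_ofNat m := by
    change mk F 0 _ = - mk F 0 _
    rw [← map_neg]
    congr 1; ext; simp

theorem algebraMap_mem_zero (r : k) : algebraMap k A r ∈ F 0 := by
  rw [Algebra.algebraMap_eq_smul_one]
  exact Submodule.smul_mem _ _ (SetLike.one_mem_graded F)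

instance : DirectSum.GAlgebra k (Component F) where
  toFun :=
    { toFun := fun r => mk F 0 ⟨algebraMap k A r, algebraMap_mem_zero F r⟩
      map_zero' := mk_eq_zero F _ _ (by simp)
      map_add' := fun r s => by
        rw [← map_add]
        congr 1; ext; simp }
  map_one := by
    change mk F 0 _ = mk F 0 _
    congr 1; ext; simp
  map_mul r s := sigma_mk_eq F (zero_add 0).symm ⟨algebraMap k A (r * s), _⟩
    ⟨algebraMap k A r * algebraMap k A s, SetLike.mul_mem_graded (algebraMap_mem_zero F r)
      (algebraMap_mem_zero F s)⟩ (map_mul _ r s)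
  commutes r := by
    rintro ⟨i, a⟩
    induction a using Submodule.Quotient.induction_on with | _ a => ?_
    exact sigma_mk_eq F (by omega) ⟨algebraMap k A r * a, _⟩ ⟨a * algebraMap k A r, _⟩
      (Algebra.commutes r _)
  smul_def r := by
    rintro ⟨i, a⟩
    induction a using Submodule.Quotient.induction_on with | _ a => ?_
    exact sigma_mk_eq F (zero_add i).symm (r • a) ⟨algebraMap k A r * a, _⟩
      (Algebra.smul_def r (a : A))

end AssocGraded

/-- The associated graded algebra `gr(A) = ⨁ F_m / F_{<m}` of an `ℕ`-filtration `F` of `A`. -/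
abbrev AssocGraded {k A : Type*} [CommRing k] [Ring A] [Algebra k A]
    (F : ℕ → Submodule k A) : Type _ :=
  ⨁ m : ℕ, AssocGraded.Component F m

/-- The class of `x ∈ F_m` in degree `m` of the associated graded algebra. -/
def AssocGraded.symbol {k A : Type*} [CommRing k] [Ring A] [Algebra k A]
    (F : ℕ → Submodule k A) (m : ℕ) (x : A) (hx : x ∈ F m) : AssocGraded F :=
  DirectSum.of (AssocGraded.Component F) m (AssocGraded.mk F m ⟨x, hx⟩)

/-- The degree `m` part of the associated graded algebra. -/
def AssocGraded.homogeneous {k A : Type*} [CommRing k] [Ring A] [Algebra k A]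
    (F : ℕ → Submodule k A) (m : ℕ) : Submodule k (AssocGraded F) :=
  LinearMap.range (DirectSum.lof k ℕ (AssocGraded.Component F) m)

/-- The filtration defined by a degree function on a family of generators `g`: the `m`-th
piece is spanned by the products of generators of total degree at most `m`. -/
def degreeFiltration (k : Type*) {A ι : Type*} [CommRing k] [Ring A] [Algebra k A]
    (g : ι → A) (deg : ι → ℕ) (m : ℕ) : Submodule k A :=
  Submodule.span k {x | ∃ w : List ι, (w.map deg).sum ≤ m ∧ (w.map g).prod = x}

instance {k A ι : Type*} [CommRing k] [Ring A] [Algebra k A] (g : ι → A) (deg : ι → ℕ) :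
    SetLike.GradedMonoid (degreeFiltration k g deg) where
  one_mem := Submodule.subset_span ⟨[], by simp, by simp⟩
  mul_mem i j a b ha hb := by
    have h := Submodule.mul_mem_mul ha hb
    rw [degreeFiltration, degreeFiltration, Submodule.span_mul_span] at h
    refine Submodule.span_mono ?_ h
    rintro _ ⟨_, ⟨w, hw, rfl⟩, _, ⟨w', hw', rfl⟩, rfl⟩
    exact ⟨w ++ w', by simp; omega, by simp⟩

theorem mem_degreeFiltration {k A ι : Type*} [CommRing k] [Ring A] [Algebra k A] (g : ι → A)
    (deg : ι → ℕ) (i : ι) : g i ∈ degreeFiltration k g deg (deg i) :=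
  Submodule.subset_span ⟨[i], by simp, by simp⟩

/-! ### The braided bialgebra `T(V⁺(χ))` -/

namespace PreNichols

/-- The standard basis vector `α_i` of `ℤⁿ`. -/
def α {n : ℕ} (i : Fin n) : Fin n → ℤ := Pi.single i 1

/-- The tensor algebra `T(V⁺(χ))`, where `V⁺(χ)` has basis `E_1, …, E_n`; its elements are the
noncommutative polynomials in `n` variables. -/
abbrev T (k : Type*) [Field k] (n : ℕ) : Type _ := FreeAlgebra k (Fin n)

section

variable {k : Type*} [Field k] {n : ℕ}

/-- The noncommutative monomial with letters `w`. -/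
def monomial (w : List (Fin n)) : T k n := (w.map (FreeAlgebra.ι k)).prod

/-- The component of degree `μ ∈ ℤⁿ` of `T(V⁺(χ))`, where `E_i` has degree `α_i`. -/
def weightSpace (k : Type*) [Field k] {n : ℕ} (μ : Fin n → ℤ) : Submodule k (T k n) :=
  Submodule.span k {x | ∃ w : List (Fin n), (w.map α).sum = μ ∧ monomial w = x}

/-- `⨁_{m ≥ 2} T(V⁺(χ))_m`. -/
def degreeGETwo (k : Type*) [Field k] (n : ℕ) : Submodule k (T k n) :=
  Submodule.span k {x | ∃ w : List (Fin n), 2 ≤ w.length ∧ monomial w = x}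

/-- The action of `K_i` on `T(V⁺(χ))` by the algebra automorphism `E_j ↦ q_{ij} E_j`. -/
def action (q : Fin n → Fin n → kˣ) (i : Fin n) : T k n →ₐ[k] T k n :=
  FreeAlgebra.lift k fun j => (q i j : k) • FreeAlgebra.ι k j

/-- Left multiplication by `E_i ⊗ 1 + 1 ⊗ E_i` in the braided tensor product
`T(V⁺(χ)) ⊗ T(V⁺(χ))`. By the braiding `E_i ⊗ a ↦ (K_i · a) ⊗ E_i`, it sends `a ⊗ b` to
`E_i a ⊗ b + (K_i · a) ⊗ E_i b`. -/
def primitiveMul (q : Fin n → Fin n → kˣ) (i : Fin n) :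
    Module.End k (T k n ⊗[k] T k n) :=
  TensorProduct.map (LinearMap.mulLeft k (FreeAlgebra.ι k i)) LinearMap.id +
    TensorProduct.map (action q i).toLinearMap (LinearMap.mulLeft k (FreeAlgebra.ι k i))

/-- The braided coproduct of `T(V⁺(χ))`: the algebra homomorphism into the braided tensor
product with `E_i ↦ E_i ⊗ 1 + 1 ⊗ E_i`, evaluated through left multiplication operators on the
unit `1 ⊗ 1`. -/
def braidedCoproduct (q : Fin n → Fin n → kˣ) : T k n →ₗ[k] T k n ⊗[k] T k n :=
  (LinearMap.applyₗ (R := k) (1 ⊗ₜ[k] 1 : T k n ⊗[k] T k n)) ∘ₗ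
    (FreeAlgebra.lift k (primitiveMul q)).toLinearMap

/-- `I ⊗ T + T ⊗ I`. -/
def coidealSum (I : TwoSidedIdeal (T k n)) : Submodule k (T k n ⊗[k] T k n) :=
  Submodule.span k {t | ∃ a b : T k n, (a ∈ I ∨ b ∈ I) ∧ a ⊗ₜ[k] b = t}

/-- The underlying subspace of a two-sided ideal. -/
def idealSubmodule (I : TwoSidedIdeal (T k n)) : Submodule k (T k n) :=
  (TwoSidedIdeal.asIdeal I).restrictScalars k

end

/-- The data on which the construction depends: a symmetric bicharacter `χ` of `ℤⁿ`, an involution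
`τ` of the index set which preserves `χ`, and a `τ`-stable `ℤⁿ`-graded biideal `I` of
`T(V⁺(χ))` in degrees at least two. The pre-Nichols algebra is `U⁺ = T(V⁺(χ)) / I`. -/
structure Datum (k : Type*) [Field k] (n : ℕ) where
  χ : (Fin n → ℤ) → (Fin n → ℤ) → kˣ
  χ_add_left : ∀ a b c, χ (a + b) c = χ a c * χ b c
  χ_add_right : ∀ a b c, χ a (b + c) = χ a b * χ a c
  χ_symm : ∀ i j, χ (α i) (α j) = χ (α j) (α i)
  τ : Equiv.Perm (Fin n)
  τ_invol : ∀ i, τ (τ i) = i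
  χ_τ : ∀ i j, χ (α (τ i)) (α (τ j)) = χ (α i) (α j)
  I : TwoSidedIdeal (T k n)
  I_le : idealSubmodule I ≤ degreeGETwo k n
  /-- `I` is `ℤⁿ`-graded: it is the sum of its intersections with the weight spaces. -/
  I_graded : idealSubmodule I ≤ ⨆ μ : Fin n → ℤ, idealSubmodule I ⊓ weightSpace k μ
  /-- `I` is a coideal (the counit vanishes on `I` as `I` lies in degrees at least two). -/
  I_coideal : ∀ x ∈ I, braidedCoproduct (fun i j => χ (α i) (α j)) x ∈ coidealSum I
  /-- `τ(I) = I` for the automorphism `E_i ↦ E_{τ(i)}` of `T(V⁺(χ))`. -/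
  I_τ : ∀ x, FreeAlgebra.lift k (fun i => FreeAlgebra.ι k (τ i)) x ∈ I ↔ x ∈ I

/-- The symbols `E_i, F_i, K_i, K_i⁻¹`. -/
inductive Gen (n : ℕ) where
  | E (i : Fin n)
  | F (i : Fin n)
  | K (i : Fin n)
  | Kinv (i : Fin n)

namespace Datum

variable {k : Type*} [Field k] {n : ℕ} (D : Datum k n)

/-- `q_{ij} = χ(α_i, α_j)`. -/
def q (i j : Fin n) : kˣ := D.χ (α i) (α j)

/-! ### The Drinfeld double `U(χ)` -/

/-- A generator as an element of the free algebra. -/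
def gen (k : Type*) [Field k] {n : ℕ} (g : Gen n) : FreeAlgebra k (Gen n) := FreeAlgebra.ι k g

/-- The defining relations of `Ũ(χ)`. The elements `K_i^{±1}` generate the group algebra `H` of
`ℤⁿ`, so they commute with each other. -/
inductive DoubleRel : FreeAlgebra k (Gen n) → FreeAlgebra k (Gen n) → Prop
  | K_Kinv (i) : DoubleRel (gen k (.K i) * gen k (.Kinv i)) 1
  | Kinv_K (i) : DoubleRel (gen k (.Kinv i) * gen k (.K i)) 1
  | K_comm (i j) : DoubleRel (gen k (.K i) * gen k (.K j)) (gen k (.K j) * gen k (.K i))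
  | K_E (i j) : DoubleRel (gen k (.K i) * gen k (.E j))
      ((D.q i j : k) • (gen k (.E j) * gen k (.K i)))
  | K_F (i j) : DoubleRel (gen k (.K i) * gen k (.F j))
      (((D.q i j)⁻¹ : kˣ) • (gen k (.F j) * gen k (.K i)))
  | E_F (i j) : DoubleRel (gen k (.E i) * gen k (.F j) - gen k (.F j) * gen k (.E i))
      (if i = j then gen k (.K i) - gen k (.Kinv i) else 0)

/-- The algebra `Ũ(χ)`. -/
def Util : Type _ := RingQuot D.DoubleRel

instance : Ring D.Util := inferInstanceAs (Ring (RingQuot D.DoubleRel))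

instance : Algebra k D.Util := inferInstanceAs (Algebra k (RingQuot D.DoubleRel))

/-- The quotient map onto `Ũ(χ)`. -/
def mkUtil : FreeAlgebra k (Gen n) →ₐ[k] D.Util := RingQuot.mkAlgHom k D.DoubleRel

/-- The image of a generator in `Ũ(χ)`. -/
def genUtil (g : Gen n) : D.Util := D.mkUtil (gen k g)

/-- The relations that put `I ⊆ T(V⁺(χ))` and `ω(I) ⊆ T(V⁻(χ))` to zero, where `ω(E_i) = F_i`. -/
inductive IdealRel : D.Util → D.Util → Prop
  | E (p : T k n) (hp : p ∈ D.I) :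
      IdealRel (FreeAlgebra.lift k (fun i => D.genUtil (.E i)) p) 0
  | F (p : T k n) (hp : p ∈ D.I) :
      IdealRel (FreeAlgebra.lift k (fun i => D.genUtil (.F i)) p) 0

/-- `U(χ) = Ũ(χ) / (I, ω(I))`, the Drinfeld double of the pre-Nichols algebra `U⁺`. -/
def U : Type _ := RingQuot D.IdealRel

instance : Ring D.U := inferInstanceAs (Ring (RingQuot D.IdealRel))

instance : Algebra k D.U := inferInstanceAs (Algebra k (RingQuot D.IdealRel))

/-- The quotient map `Ũ(χ) → U(χ)`. -/
def mkU : D.Util →ₐ[k] D.U := RingQuot.mkAlgHom k D.IdealRel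

/-- The image of a generator in `U(χ)`. -/
def genU (g : Gen n) : D.U := D.mkU (D.genUtil g)

/-- `E_i ∈ U(χ)`. -/
def E (i : Fin n) : D.U := D.genU (.E i)

/-- `F_i ∈ U(χ)`. -/
def F (i : Fin n) : D.U := D.genU (.F i)

/-- `K_i ∈ U(χ)`. -/
def K (i : Fin n) : D.U := D.genU (.K i)

/-- `K_i⁻¹ ∈ U(χ)`. -/
def Kinv (i : Fin n) : D.U := D.genU (.Kinv i)

theorem K_mul_Kinv (i : Fin n) : D.K i * D.Kinv i = 1 := by
  have h : D.mkUtil (gen k (.K i) * gen k (.Kinv i)) = D.mkUtil 1 :=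
    RingQuot.mkAlgHom_rel k (DoubleRel.K_Kinv i)
  rw [K, Kinv, genU, genU, ← map_mul, genUtil, genUtil, ← map_mul, h, map_one, map_one]

theorem Kinv_mul_K (i : Fin n) : D.Kinv i * D.K i = 1 := by
  have h : D.mkUtil (gen k (.Kinv i) * gen k (.K i)) = D.mkUtil 1 :=
    RingQuot.mkAlgHom_rel k (DoubleRel.Kinv_K i)
  rw [K, Kinv, genU, genU, ← map_mul, genUtil, genUtil, ← map_mul, h, map_one, map_one]

/-! ### The partial bosonization `H_θ ⋉ U⁻` and the coideal subalgebra `B_c` -/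

/-- `H_θ`, generated by the elements `K_i K_{τ(i)}⁻¹`. -/
def Htheta : Subalgebra k D.U := Algebra.adjoin k (Set.range fun i => D.K i * D.Kinv (D.τ i))

/-- `U⁻` as a subalgebra of `U(χ)`. -/
def Uminus : Subalgebra k D.U := Algebra.adjoin k (Set.range D.F)

/-- The partial bosonization `H_θ ⋉ U⁻`, the subalgebra of `U(χ)` generated by `H_θ` and `U⁻`. -/
def partialBosonization : Subalgebra k D.U := D.Htheta ⊔ D.Uminus

theorem Htheta_le : D.Htheta ≤ D.partialBosonization := le_sup_left

theorem F_mem (i : Fin n) : D.F i ∈ D.partialBosonization :=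
  (le_sup_right : D.Uminus ≤ D.partialBosonization) (Algebra.subset_adjoin ⟨i, rfl⟩)

/-- The component `H_θ U⁻_m` of degree `m` of `H_θ ⋉ U⁻`, spanned by the elements
`h F_{j_1} ⋯ F_{j_m}` with `h ∈ H_θ`. -/
def bosonizationComponent (m : ℕ) : Submodule k D.partialBosonization :=
  Submodule.span k {x | ∃ h ∈ D.Htheta, ∃ J : List (Fin n), J.length = m ∧
    (x : D.U) = h * (J.map D.F).prod}

/-- `B_i = F_i + c_i E_{τ(i)} K_i⁻¹`. -/
def B (c : Fin n → k) (i : Fin n) : D.U := D.F i + c i • (D.E (D.τ i) * D.Kinv i)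

/-- `B_c`, the subalgebra of `U(χ)` generated by `H_θ` and the elements `B_i`. -/
def Bc (c : Fin n → k) : Subalgebra k D.U := D.Htheta ⊔ Algebra.adjoin k (Set.range (D.B c))

/-! ### The Heisenberg double -/

/-- `U(χ)^poly`, the subalgebra of `U(χ)` generated by the elements `F_i`, `E_i K_i⁻¹`, `K_i⁻¹`
and `K_i K_{τ(i)}⁻¹`. -/
def Upoly : Subalgebra k D.U :=
  Algebra.adjoin k (Set.range D.F ∪ Set.range (fun i => D.E i * D.Kinv i) ∪ Set.range D.Kinv ∪
    Set.range fun i => D.K i * D.Kinv (D.τ i))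

theorem F_mem_Upoly (i : Fin n) : D.F i ∈ D.Upoly :=
  Algebra.subset_adjoin (Or.inl (Or.inl (Or.inl ⟨i, rfl⟩)))

theorem Etilde_mem_Upoly (i : Fin n) : D.E i * D.Kinv i ∈ D.Upoly :=
  Algebra.subset_adjoin (Or.inl (Or.inl (Or.inr ⟨i, rfl⟩)))

theorem Kinv_mem_Upoly (i : Fin n) : D.Kinv i ∈ D.Upoly :=
  Algebra.subset_adjoin (Or.inl (Or.inr ⟨i, rfl⟩))

theorem Htheta_le_Upoly : D.Htheta ≤ D.Upoly :=
  Algebra.adjoin_mono Set.subset_union_right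

theorem B_mem_Upoly (c : Fin n → k) (i : Fin n) : D.B c i ∈ D.Upoly := by
  have h1 : D.K (D.τ i) * D.Kinv i ∈ D.Upoly :=
    Algebra.subset_adjoin (Or.inr ⟨D.τ i, by simp [D.τ_invol]⟩)
  have h2 : D.E (D.τ i) * D.Kinv i =
      D.E (D.τ i) * D.Kinv (D.τ i) * (D.K (D.τ i) * D.Kinv i) := by
    rw [mul_assoc, ← mul_assoc (D.Kinv (D.τ i)), D.Kinv_mul_K, one_mul]
  rw [B, h2]
  exact add_mem (D.F_mem_Upoly i)
    (Subalgebra.smul_mem _ (mul_mem (D.Etilde_mem_Upoly _) h1) _)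

/-- The relations `K_i⁻¹ = 0` in `U(χ)^poly`. -/
inductive HeisRel : D.Upoly → D.Upoly → Prop
  | Kinv (i) : HeisRel ⟨D.Kinv i, D.Kinv_mem_Upoly i⟩ 0

/-- The Heisenberg double `Heis(χ)`, the quotient of `U(χ)^poly` by the two-sided ideal generated
by the elements `K_i⁻¹`. -/
def Heis : Type _ := RingQuot D.HeisRel

instance : Ring D.Heis := inferInstanceAs (Ring (RingQuot D.HeisRel))

instance : Algebra k D.Heis := inferInstanceAs (Algebra k (RingQuot D.HeisRel))

/-- The projection `κ : U(χ)^poly → Heis(χ)`. -/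
def κ : D.Upoly →ₐ[k] D.Heis := RingQuot.mkAlgHom k D.HeisRel

/-- `B̄_c = κ(B_c)`; note that `B_c` is contained in `U(χ)^poly`. -/
def Bbar (c : Fin n → k) : Subalgebra k D.Heis := ((D.Bc c).comap D.Upoly.val).map D.κ

theorem Bc_le_Upoly (c : Fin n → k) : D.Bc c ≤ D.Upoly :=
  sup_le D.Htheta_le_Upoly (Algebra.adjoin_le (by rintro _ ⟨i, rfl⟩; exact D.B_mem_Upoly c i))

/-- `Ḡ⁺`, the subalgebra of `Heis(χ)` generated by the elements `κ(E_i K_i⁻¹)`. -/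
def Gplus : Subalgebra k D.Heis :=
  Algebra.adjoin k (Set.range fun i => D.κ ⟨D.E i * D.Kinv i, D.Etilde_mem_Upoly i⟩)

/-- The generators `B̄_i` and `h̄`, for `h ∈ H_θ`, of `B̄_c`. -/
def BbarGen (c : Fin n → k) : Fin n ⊕ D.Htheta → D.Bbar c
  | .inl i => ⟨D.κ ⟨D.B c i, D.B_mem_Upoly c i⟩, ⟨_,
      (le_sup_right : _ ≤ D.Bc c) (Algebra.subset_adjoin ⟨i, rfl⟩), rfl⟩⟩
  | .inr h => ⟨D.κ ⟨h, D.Htheta_le_Upoly h.2⟩, ⟨_,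
      (le_sup_left : D.Htheta ≤ D.Bc c) h.2, rfl⟩⟩

/-- The degree function `deg(B̄_i) = 1` and `deg(h) = 0` for `h ∈ H_θ`. -/
def genDegree : Fin n ⊕ D.Htheta → ℕ
  | .inl _ => 1
  | .inr _ => 0

/-- The filtration of `B̄_c` defined by the degree function. -/
abbrev filtration (c : Fin n → k) : ℕ → Submodule k (D.Bbar c) :=
  degreeFiltration k (D.BbarGen c) D.genDegree

/-- The class of `B̄_i` in degree one of `gr(B̄_c)`. -/
def grB (c : Fin n → k) (i : Fin n) : AssocGraded (D.filtration c) :=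
  AssocGraded.symbol (D.filtration c) 1 (D.BbarGen c (.inl i))
    (mem_degreeFiltration (D.BbarGen c) D.genDegree (.inl i))

/-- The class of `h ∈ H_θ` in degree zero of `gr(B̄_c)`. -/
def grH (c : Fin n → k) (h : D.Htheta) : AssocGraded (D.filtration c) :=
  AssocGraded.symbol (D.filtration c) 0 (D.BbarGen c (.inr h))
    (mem_degreeFiltration (D.BbarGen c) D.genDegree (.inr h))

/-- The property that characterizes the canonical map `φ̄ : gr(B̄_c) → H_θ ⋉ U⁻`. -/
def IsCanonicalMap (c : Fin n → k)
    (φ : AssocGraded (D.filtration c) →ₐ[k] D.partialBosonization) : Prop :=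
  (∀ i, φ (D.grB c i) = ⟨D.F i, D.F_mem i⟩) ∧
    ∀ h : D.Htheta, φ (D.grH c h) = ⟨h, D.Htheta_le h.2⟩

/-- The pair `(Heis(χ), B̄_c)` has an Iwasawa decomposition: multiplication is a linear
isomorphism `Ḡ⁺ ⊗ B̄_c → Heis(χ)`. -/
def HasIwasawaDecomposition (c : Fin n → k) : Prop :=
  Function.Bijective
    (Submodule.mulMap (Subalgebra.toSubmodule D.Gplus) (Subalgebra.toSubmodule (D.Bbar c)))

end Datum

end PreNichols

end

open scoped TensorProduct DirectSum

noncomputable section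

namespace PreNichols

variable {k : Type*} [Field k] {n : ℕ}

/-! ### The free algebra -/

/-! Passing to leading terms should turn words in the B̄_i into words in the F_i. Two things need
proof: the leading term is well defined, and every relation p ∈ I among the F_i lifts to a relation
among the B̄_i modulo lower degree.

The first point comes from a representation. U(χ) acts on `Tri`, whose vector `vec l a u` stands for
a(Ẽ) K^l u(F) with Ẽ_i = E_i K_i⁻¹; the action exists because the biideal I is stable under the left
and the right skew derivation. `Upoly` never raises the height of l and K_i⁻¹ lowers it, so the
height-zero part of x · 1 depends on κ(x) only (`heisVec`). The second summand of B_i does not raise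
the degree of u, so the top degree of a word in the B̄_i is the same word in the F_i (`leadTerm`).

For the second point write B̄_i = F_i + Y_i. In Heis(χ), Y_i F_j = q_{ij} F_j Y_i plus, for j =
τ(i), a multiple of K_{τ(i)} K_i⁻¹; the other half of the commutator carries K_i⁻¹ K_j⁻¹ and dies.
The main term is the braiding of T ⊗ T, and the correction is a single skew derivation on the left
leg, which commutes with Δ. Hence `quantize`, the coproduct followed by a ⊗ b ↦ a(F) b(Y), obeys the
recursion `heisB_mul_quantize` and agrees with p ↦ p(B̄) modulo lower degree. It vanishes on I
because I is a coideal whose elements vanish on the F_i and, by τ(I) = I, on the Y_i. So all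
relations lift, without any condition on c; this is `mem_filtLT_of_leadTerm_eq_zero`.

For the Iwasawa decomposition, a(Ẽ) K^l quantize(u) has leading vector `vec l a u`, and this
triangularity gives injectivity. Surjectivity holds because Ḡ⁺ B̄_c contains 1 and is a left ideal.
-/

theorem T_induction (S : Submodule k (T k n)) (h1 : (1 : T k n) ∈ S)
    (hmul : ∀ i, ∀ x ∈ S, FreeAlgebra.ι k i * x ∈ S) (x : T k n) : x ∈ S := by
  suffices h : ∀ y ∈ S, x * y ∈ S by simpa using h 1 h1
  induction x using FreeAlgebra.induction with
  | grade0 r =>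
    intro y hy
    rw [← Algebra.smul_def]
    exact S.smul_mem r hy
  | grade1 i => exact hmul i
  | mul a b ha hb =>
    intro y hy
    rw [mul_assoc]
    exact ha _ (hb _ hy)
  | add a b ha hb =>
    intro y hy
    rw [add_mul]
    exact S.add_mem (ha _ hy) (hb _ hy)

theorem T_linearMap_ext {M : Type*} [AddCommGroup M] [Module k M] {f g : T k n →ₗ[k] M}
    (h1 : f 1 = g 1)
    (hmul : ∀ i x, f x = g x → f (FreeAlgebra.ι k i * x) = g (FreeAlgebra.ι k i * x)) : f = g :=
  LinearMap.ext fun x => T_induction (LinearMap.eqLocus f g) h1 hmul x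

@[simp] theorem monomial_nil : (monomial [] : T k n) = 1 := rfl

@[simp] theorem monomial_cons (i : Fin n) (w : List (Fin n)) :
    (monomial (i :: w) : T k n) = FreeAlgebra.ι k i * monomial w := by
  simp [monomial]

theorem lift_monomial {A : Type*} [Ring A] [Algebra k A] (Z : Fin n → A) (w : List (Fin n)) :
    FreeAlgebra.lift k Z (monomial w) = (w.map Z).prod := by
  simp [monomial, map_list_prod, Function.comp_def]

/-- The subspace of noncommutative polynomials of degree less than `m`. -/
def degreeLT (k : Type*) [Field k] (n m : ℕ) : Submodule k (T k n) :=
  Submodule.span k {x | ∃ w : List (Fin n), w.length < m ∧ monomial w = x}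

theorem monomial_mem_degreeLT {w : List (Fin n)} {m : ℕ} (h : w.length < m) :
    (monomial w : T k n) ∈ degreeLT k n m :=
  Submodule.subset_span ⟨w, h, rfl⟩

theorem degreeLT_mono {m m' : ℕ} (h : m ≤ m') : degreeLT k n m ≤ degreeLT k n m' :=
  Submodule.span_mono fun _ ⟨w, hw, hx⟩ => ⟨w, by omega, hx⟩

theorem degreeLT_zero : degreeLT k n 0 = ⊥ := by
  simp [degreeLT]

theorem ι_mul_mem_degreeLT (i : Fin n) {m : ℕ} {x : T k n} (hx : x ∈ degreeLT k n m) :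
    FreeAlgebra.ι k i * x ∈ degreeLT k n (m + 1) := by
  have : degreeLT k n m ≤
      (degreeLT k n (m + 1)).comap (LinearMap.mulLeft k (FreeAlgebra.ι k i)) := by
    refine Submodule.span_le.2 ?_
    rintro _ ⟨w, hw, rfl⟩
    exact Submodule.subset_span ⟨i :: w, by simpa using hw, by simp⟩
  exact this hx

theorem exists_mem_degreeLT (x : T k n) : ∃ m, x ∈ degreeLT k n m := by
  let S : Submodule k (T k n) := ⨆ m, degreeLT k n m
  have hdir : Directed (· ≤ ·) (degreeLT k n) :=
    (show Monotone (degreeLT k n) from fun _ _ h => degreeLT_mono h).directed_le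
  have hx : x ∈ S := by
    refine T_induction S ?_ ?_ x
    · exact Submodule.mem_iSup_of_mem 1 (monomial_mem_degreeLT (w := []) (by simp))
    · intro i x hx
      obtain ⟨m, hm⟩ := (Submodule.mem_iSup_of_directed _ hdir).1 hx
      exact Submodule.mem_iSup_of_mem (m + 1) (ι_mul_mem_degreeLT i hm)
  exact (Submodule.mem_iSup_of_directed _ hdir).1 hx

/-- The projection onto the noncommutative polynomials of degree `m`. -/
def degreeProj (k : Type*) [Field k] (n m : ℕ) : T k n →ₗ[k] T k n :=
  (Polynomial.lcoeff (T k n) m).restrictScalars k ∘ₗ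
    (FreeAlgebra.lift k fun i => (Polynomial.C (FreeAlgebra.ι k i) * Polynomial.X :
      Polynomial (T k n))).toLinearMap

theorem degreeProj_monomial (m : ℕ) (w : List (Fin n)) :
    degreeProj k n m (monomial w) = if w.length = m then monomial w else 0 := by
  -- The substitution E_i ↦ E_i X records the length of a word in the exponent of X, so the
  -- coefficient of X^m is the part of degree m.
  have h : ∀ w : List (Fin n), (w.map fun i => (Polynomial.C (FreeAlgebra.ι k i) * Polynomial.X :
      Polynomial (T k n))).prod = Polynomial.C (monomial w) * Polynomial.X ^ w.length := by
    intro w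
    induction w with
    | nil => simp
    | cons i w ih =>
      simp only [List.map_cons, List.prod_cons, ih, monomial_cons, List.length_cons,
        Polynomial.C_mul, pow_succ']
      rw [mul_assoc, ← mul_assoc Polynomial.X, Polynomial.X_mul_C]
      simp only [mul_assoc]
  simp only [degreeProj, LinearMap.coe_comp, Function.comp_apply, AlgHom.toLinearMap_apply,
    lift_monomial, h, LinearMap.coe_restrictScalars, Polynomial.lcoeff_apply,
    Polynomial.coeff_C_mul, Polynomial.coeff_X_pow, eq_comm (a := m)]
  simp

theorem sub_degreeProj_mem {m : ℕ} {x : T k n} (hx : x ∈ degreeLT k n (m + 1)) :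
    x - degreeProj k n m x ∈ degreeLT k n m := by
  have : degreeLT k n (m + 1) ≤
      (degreeLT k n m).comap (LinearMap.id - degreeProj k n m) := by
    refine Submodule.span_le.2 ?_
    rintro _ ⟨w, hw, rfl⟩
    simp only [SetLike.mem_coe, Submodule.mem_comap, LinearMap.sub_apply, LinearMap.id_apply,
      degreeProj_monomial]
    split_ifs with h
    · simp
    · rw [sub_zero]
      exact monomial_mem_degreeLT (by omega)
  exact this hx

theorem degreeProj_eq_zero {m : ℕ} {x : T k n} (hx : x ∈ degreeLT k n m) :
    degreeProj k n m x = 0 := by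
  have : degreeLT k n m ≤ LinearMap.ker (degreeProj k n m) := by
    refine Submodule.span_le.2 ?_
    rintro _ ⟨w, hw, rfl⟩
    simp only [SetLike.mem_coe, LinearMap.mem_ker, degreeProj_monomial]
    rw [if_neg (by omega)]
  exact this hx

/-! ### The action of the torus -/

/-- The algebra automorphism `E_j ↦ s_j E_j` of the free algebra. -/
def torus (s : Fin n → kˣ) : T k n →ₐ[k] T k n :=
  FreeAlgebra.lift k fun j => (s j : k) • FreeAlgebra.ι k j

@[simp] theorem torus_ι (s : Fin n → kˣ) (j : Fin n) :
    torus s (FreeAlgebra.ι k j) = (s j : k) • FreeAlgebra.ι k j := by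
  simp [torus]

theorem action_eq_torus (q : Fin n → Fin n → kˣ) (i : Fin n) : action q i = torus (q i) := rfl

theorem torus_torus (s t : Fin n → kˣ) (x : T k n) : torus s (torus t x) = torus (s * t) x := by
  have : (torus s).comp (torus t) = torus (s * t) := by
    ext j
    simp [smul_smul, mul_comm]
  exact DFunLike.congr_fun this x

@[simp] theorem torus_one : torus (1 : Fin n → kˣ) = AlgHom.id k (T k n) := by
  ext j
  simp

@[simp] theorem torus_torus_inv (s : Fin n → kˣ) (x : T k n) : torus s (torus s⁻¹ x) = x := by
  simp [torus_torus]

@[simp] theorem torus_inv_torus (s : Fin n → kˣ) (x : T k n) : torus s⁻¹ (torus s x) = x := by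
  simp [torus_torus]

theorem torus_comm (s t : Fin n → kˣ) (x : T k n) :
    torus s (torus t x) = torus t (torus s x) := by
  simp [torus_torus, mul_comm]

theorem exists_torus_monomial (s : Fin n → kˣ) (w : List (Fin n)) :
    torus s (monomial w : T k n) = (w.map fun i => (s i : k)).prod • monomial w := by
  induction w with
  | nil => simp
  | cons i w ih => simp [ih, smul_smul, mul_comm]

/-! ### Words of equal weight -/

theorem weight_apply (w : List (Fin n)) (i : Fin n) : (w.map α).sum i = w.count i := by
  induction w with
  | nil => simp
  | cons j w ih =>
    simp only [List.map_cons, List.sum_cons, Pi.add_apply, ih, α, List.count_cons,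
      Pi.single_apply]
    by_cases h : i = j
    · subst h
      simp [add_comm]
    · simp [h, Ne.symm h]

/-- The weight counts letters. Consequently every quantity that is invariant under permuting the
letters is constant on a weight space, which is how the grading of I is exploited. -/
theorem perm_of_weight_eq {w w' : List (Fin n)} (h : (w.map α).sum = (w'.map α).sum) :
    w.Perm w' := by
  rw [List.perm_iff_count]
  intro i
  have := congrFun h i
  rw [weight_apply, weight_apply] at this
  exact_mod_cast this

theorem weight_sum (w : List (Fin n)) : ∑ i, (w.map α).sum i = w.length := by
  induction w with
  | nil => simp
  | cons j w ih => simp [Finset.sum_add_distrib, ih, α, add_comm]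

/-! ### Skew derivations from the braided coproduct -/

/-- The counit. -/
abbrev counit (k : Type*) [Field k] (n : ℕ) : T k n →ₐ[k] k := FreeAlgebra.algebraMapInv

@[simp] theorem counit_ι (i : Fin n) : counit k n (FreeAlgebra.ι k i) = 0 := by
  simp [counit, FreeAlgebra.algebraMapInv]

/-- The coefficient of `E_i`. -/
def linearCoeff (k : Type*) [Field k] {n : ℕ} (i : Fin n) : T k n →ₗ[k] k :=
  TrivSqZeroExt.sndHom k k ∘ₗ
    (FreeAlgebra.lift k fun j => if i = j then (DualNumber.eps : DualNumber k) else 0).toLinearMap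

theorem fst_lift_eps (i : Fin n) (x : T k n) :
    (FreeAlgebra.lift k (fun j => if i = j then (DualNumber.eps : DualNumber k) else 0) x).fst =
      counit k n x := by
  have : (TrivSqZeroExt.fstHom k k k).comp
      (FreeAlgebra.lift k fun j => if i = j then (DualNumber.eps : DualNumber k) else 0) =
      counit k n := by
    ext j
    by_cases h : i = j <;> simp [h]
  exact DFunLike.congr_fun this x

@[simp] theorem linearCoeff_one (i : Fin n) : linearCoeff k i 1 = 0 := by
  simp [linearCoeff]

-- In the dual numbers ε · y sees only the first component of y, and that component is the counit.
@[simp] theorem linearCoeff_ι_mul (i j : Fin n) (x : T k n) :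
    linearCoeff k i (FreeAlgebra.ι k j * x) = if i = j then counit k n x else 0 := by
  by_cases h : i = j <;>
    simp [linearCoeff, h, fst_lift_eps]

theorem linearCoeff_torus (s : Fin n → kˣ) (i : Fin n) (x : T k n) :
    linearCoeff k i (torus s x) = (s i : k) * linearCoeff k i x := by
  have h1 : ∀ x : T k n, counit k n (torus s x) = counit k n x := by
    intro x
    have : (counit k n).comp (torus s) = counit k n := by
      ext j
      simp
    exact DFunLike.congr_fun this x
  have : linearCoeff k i ∘ₗ (torus s).toLinearMap = (s i : k) • linearCoeff k i := by
    refine T_linearMap_ext (by simp) fun j x _ => ?_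
    by_cases h : i = j <;> simp [h, h1]
  exact DFunLike.congr_fun this x

section

variable (q : Fin n → Fin n → kˣ)

@[simp] theorem braidedCoproduct_one :
    braidedCoproduct q (1 : T k n) = 1 ⊗ₜ 1 := by
  simp [braidedCoproduct]

theorem braidedCoproduct_ι_mul (i : Fin n) (x : T k n) :
    braidedCoproduct q (FreeAlgebra.ι k i * x) = primitiveMul q i (braidedCoproduct q x) := by
  simp [braidedCoproduct]

theorem primitiveMul_tmul (i : Fin n) (a b : T k n) :
    primitiveMul q i (a ⊗ₜ b) =
      (FreeAlgebra.ι k i * a) ⊗ₜ b + torus (q i) a ⊗ₜ (FreeAlgebra.ι k i * b) := by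
  simp [primitiveMul, action_eq_torus]

/-- Under ε ⊗ id the summand E_i a ⊗ b of `primitiveMul` dies and, ε being torus invariant, the
other summand becomes left multiplication by E_i. -/
theorem counit_braidedCoproduct (x : T k n) :
    TensorProduct.lid k (T k n) ((counit k n).toLinearMap.rTensor (T k n)
      (braidedCoproduct q x)) = x := by
  have h1 : ∀ i, ∀ x : T k n, counit k n (torus (q i) x) = counit k n x := by
    intro i x
    have : (counit k n).comp (torus (q i)) = counit k n := by
      ext j
      simp
    exact DFunLike.congr_fun this x
  have h2 : ∀ i t, TensorProduct.lid k (T k n) ((counit k n).toLinearMap.rTensor (T k n)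
      (primitiveMul q i t)) = FreeAlgebra.ι k i * TensorProduct.lid k (T k n)
        ((counit k n).toLinearMap.rTensor (T k n) t) := by
    intro i t
    induction t with
    | zero => simp
    | add s t hs ht => simp only [map_add, hs, ht, mul_add]
    | tmul a b => simp [primitiveMul_tmul, h1]
  have : (TensorProduct.lid k (T k n)).toLinearMap ∘ₗ (counit k n).toLinearMap.rTensor (T k n) ∘ₗ
      braidedCoproduct q = LinearMap.id := by
    refine T_linearMap_ext (by simp) fun i x hx => ?_
    simp only [LinearMap.coe_comp, LinearEquiv.coe_coe, Function.comp_apply,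
      LinearMap.id_apply] at hx ⊢
    rw [braidedCoproduct_ι_mul, h2, hx]
  exact DFunLike.congr_fun this x

theorem braidedCoproduct_counit (x : T k n) :
    TensorProduct.rid k (T k n) ((counit k n).toLinearMap.lTensor (T k n)
      (braidedCoproduct q x)) = x := by
  have h2 : ∀ i t, TensorProduct.rid k (T k n) ((counit k n).toLinearMap.lTensor (T k n)
      (primitiveMul q i t)) = FreeAlgebra.ι k i * TensorProduct.rid k (T k n)
        ((counit k n).toLinearMap.lTensor (T k n) t) := by
    intro i t
    induction t with
    | zero => simp
    | add s t hs ht => simp only [map_add, hs, ht, mul_add]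
    | tmul a b => simp [primitiveMul_tmul]
  have : (TensorProduct.rid k (T k n)).toLinearMap ∘ₗ (counit k n).toLinearMap.lTensor (T k n) ∘ₗ
      braidedCoproduct q = LinearMap.id := by
    refine T_linearMap_ext (by simp) fun i x hx => ?_
    simp only [LinearMap.coe_comp, LinearEquiv.coe_coe, Function.comp_apply,
      LinearMap.id_apply] at hx ⊢
    rw [braidedCoproduct_ι_mul, h2, hx]
  exact DFunLike.congr_fun this x

/-- The skew derivation with `Δ(x) = E_i ⊗ leftDer i x + ⋯`. -/
def leftDer (i : Fin n) : T k n →ₗ[k] T k n :=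
  (TensorProduct.lid k (T k n)).toLinearMap ∘ₗ (linearCoeff k i).rTensor (T k n) ∘ₗ
    braidedCoproduct q

/-- The skew derivation with `Δ(x) = rightDer i x ⊗ E_i + ⋯`. -/
def rightDer (i : Fin n) : T k n →ₗ[k] T k n :=
  (TensorProduct.rid k (T k n)).toLinearMap ∘ₗ (linearCoeff k i).lTensor (T k n) ∘ₗ
    braidedCoproduct q

@[simp] theorem leftDer_one (i : Fin n) : leftDer q i (1 : T k n) = 0 := by
  simp [leftDer]

@[simp] theorem rightDer_one (i : Fin n) : rightDer q i (1 : T k n) = 0 := by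
  simp [rightDer]

/-- Skew Leibniz rule. The summand E_j a ⊗ b contributes through the counit of a; in the summand
(K_j · a) ⊗ E_j b the torus scales the E_i-coefficient by q_{ji}. -/
theorem leftDer_ι_mul (i j : Fin n) (x : T k n) :
    leftDer q i (FreeAlgebra.ι k j * x) =
      (if i = j then x else 0) + (q j i : k) • (FreeAlgebra.ι k j * leftDer q i x) := by
  have h : ∀ t, TensorProduct.lid k (T k n) ((linearCoeff k i).rTensor (T k n)
      (primitiveMul q j t)) = (if i = j then TensorProduct.lid k (T k n)
        ((counit k n).toLinearMap.rTensor (T k n) t) else 0) +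
      (q j i : k) • (FreeAlgebra.ι k j * TensorProduct.lid k (T k n)
        ((linearCoeff k i).rTensor (T k n) t)) := by
    intro t
    induction t with
    | zero => simp
    | add s t hs ht =>
      simp only [map_add, hs, ht, mul_add, smul_add]
      split_ifs <;> abel
    | tmul a b =>
      by_cases hij : i = j <;>
        simp [primitiveMul_tmul, linearCoeff_torus, hij, smul_smul]
  simp only [leftDer, LinearMap.coe_comp, LinearEquiv.coe_coe, Function.comp_apply,
    braidedCoproduct_ι_mul, h, counit_braidedCoproduct]

/-- Here the roles of the legs are exchanged: the linear coefficient is taken on the right, so the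
torus twist stays on the left leg and appears in the inhomogeneous term. -/
theorem rightDer_ι_mul (i j : Fin n) (x : T k n) :
    rightDer q i (FreeAlgebra.ι k j * x) =
      FreeAlgebra.ι k j * rightDer q i x + (if i = j then torus (q j) x else 0) := by
  have h : ∀ t, TensorProduct.rid k (T k n) ((linearCoeff k i).lTensor (T k n)
      (primitiveMul q j t)) = FreeAlgebra.ι k j * TensorProduct.rid k (T k n)
        ((linearCoeff k i).lTensor (T k n) t) +
      (if i = j then torus (q j) (TensorProduct.rid k (T k n)
        ((counit k n).toLinearMap.lTensor (T k n) t)) else 0) := by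
    intro t
    induction t with
    | zero => simp
    | add s t hs ht =>
      simp only [map_add, hs, ht, mul_add]
      split_ifs <;> abel
    | tmul a b =>
      by_cases hij : i = j <;> simp [primitiveMul_tmul, hij]
  simp only [rightDer, LinearMap.coe_comp, LinearEquiv.coe_coe, Function.comp_apply,
    braidedCoproduct_ι_mul, h, braidedCoproduct_counit]

theorem leftDer_torus (s : Fin n → kˣ) (i : Fin n) (x : T k n) :
    leftDer q i (torus s x) = (s i : k) • torus s (leftDer q i x) := by
  have : leftDer q i ∘ₗ (torus s).toLinearMap =
      (s i : k) • ((torus s).toLinearMap ∘ₗ leftDer q i) := by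
    refine T_linearMap_ext (by simp) fun j x hx => ?_
    simp only [LinearMap.coe_comp, Function.comp_apply, AlgHom.toLinearMap_apply,
      LinearMap.smul_apply] at hx ⊢
    by_cases hij : i = j
    · subst hij
      simp [leftDer_ι_mul, hx, smul_smul, mul_left_comm]
    · simp [leftDer_ι_mul, hx, smul_smul, hij, mul_comm, mul_left_comm]
  exact DFunLike.congr_fun this x

theorem rightDer_torus (s : Fin n → kˣ) (i : Fin n) (x : T k n) :
    rightDer q i (torus s x) = (s i : k) • torus s (rightDer q i x) := by
  have : rightDer q i ∘ₗ (torus s).toLinearMap =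
      (s i : k) • ((torus s).toLinearMap ∘ₗ rightDer q i) := by
    refine T_linearMap_ext (by simp) fun j x hx => ?_
    simp only [LinearMap.coe_comp, Function.comp_apply, AlgHom.toLinearMap_apply,
      LinearMap.smul_apply] at hx ⊢
    by_cases hij : i = j
    · subst hij
      simp [rightDer_ι_mul, hx, smul_smul, torus_comm s (q i)]
    · simp [rightDer_ι_mul, hx, smul_smul, hij, mul_comm]
  exact DFunLike.congr_fun this x

/-- `(leftDer ⊗ id) Δ = Δ leftDer`. -/
theorem leftDer_braidedCoproduct (i : Fin n) (x : T k n) :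
    (leftDer q i).rTensor (T k n) (braidedCoproduct q x) =
      braidedCoproduct q (leftDer q i x) := by
  have h : ∀ j t, (leftDer q i).rTensor (T k n) (primitiveMul q j t) =
      (if i = j then t else 0) +
        (q j i : k) • primitiveMul q j ((leftDer q i).rTensor (T k n) t) := by
    intro j t
    induction t with
    | zero => simp
    | add s t hs ht =>
      simp only [map_add, hs, ht, smul_add]
      split_ifs <;> abel
    | tmul a b =>
      by_cases hij : i = j <;>
        simp [primitiveMul_tmul, leftDer_ι_mul, leftDer_torus, hij, TensorProduct.add_tmul,
          TensorProduct.smul_tmul', add_assoc]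
  have : (leftDer q i).rTensor (T k n) ∘ₗ braidedCoproduct q =
      braidedCoproduct q ∘ₗ leftDer q i := by
    refine T_linearMap_ext (by simp) fun j x hx => ?_
    simp only [LinearMap.coe_comp, Function.comp_apply] at hx ⊢
    rw [braidedCoproduct_ι_mul, h, hx, leftDer_ι_mul, map_add, map_smul, braidedCoproduct_ι_mul]
    split_ifs <;> simp
  exact DFunLike.congr_fun this x

/-- The derivation even lowers the degree by one. The cruder bound suffices, since corrections are
always compared with a product that is one letter longer. -/
theorem leftDer_mem_degreeLT (i : Fin n) {m : ℕ} {x : T k n} (hx : x ∈ degreeLT k n m) :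
    leftDer q i x ∈ degreeLT k n m := by
  have : degreeLT k n m ≤ (degreeLT k n m).comap (leftDer q i) := by
    refine Submodule.span_le.2 ?_
    rintro _ ⟨w, hw, rfl⟩
    clear hx
    induction w generalizing m with
    | nil => simp
    | cons j w ih =>
      obtain ⟨m, rfl⟩ : ∃ m', m = m' + 1 := ⟨m - 1, by simp at hw; omega⟩
      have hw' : w.length < m := by simpa using hw
      have h1 := ih hw'
      simp only [SetLike.mem_coe, Submodule.mem_comap, monomial_cons, leftDer_ι_mul] at h1 ⊢
      refine add_mem ?_ (Submodule.smul_mem _ _ (ι_mul_mem_degreeLT j h1))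
      split_ifs
      · exact monomial_mem_degreeLT (by omega)
      · exact zero_mem _
  exact this hx

end

/-! ### Stability of the biideal -/

namespace Datum

variable (D : Datum k n)

theorem q_symm (i j : Fin n) : D.q i j = D.q j i := D.χ_symm i j

theorem q_τ (i j : Fin n) : D.q (D.τ i) (D.τ j) = D.q i j := D.χ_τ i j

theorem q_τ_left (i j : Fin n) : D.q (D.τ i) j = D.q i (D.τ j) := by
  rw [← D.q_τ i (D.τ j), D.τ_invol]

/-- A linear map that sends the homogeneous elements of `I` to `S` sends `I` to `S`. -/
theorem ideal_le_comap {M : Type*} [AddCommGroup M] [Module k M] (f : T k n →ₗ[k] M)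
    (S : Submodule k M)
    (h : ∀ μ, ∀ x ∈ D.I, x ∈ weightSpace k μ → f x ∈ S) {x : T k n} (hx : x ∈ D.I) :
    f x ∈ S := by
  have : (⨆ μ : Fin n → ℤ, idealSubmodule D.I ⊓ weightSpace k μ) ≤ S.comap f :=
    iSup_le fun μ x hx => h μ x hx.1 hx.2
  exact this (D.I_graded hx)

theorem smul_mem_I (r : k) {x : T k n} (hx : x ∈ D.I) : r • x ∈ D.I :=
  (idealSubmodule D.I).smul_mem r hx

/-- Words of equal weight are permutations of each other, so the torus acts on each weight space by
a scalar. -/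
theorem torus_mem (s : Fin n → kˣ) {x : T k n} (hx : x ∈ D.I) : torus s x ∈ D.I := by
  refine D.ideal_le_comap (torus s).toLinearMap (idealSubmodule D.I) (fun μ x hx hμ => ?_) hx
  obtain ⟨r, hr⟩ : ∃ r : k, ∀ x ∈ weightSpace k μ, torus s x = r • x := by
    by_cases h : ∃ w : List (Fin n), (w.map α).sum = μ
    · obtain ⟨w₀, h₀⟩ := h
      refine ⟨(w₀.map fun i => (s i : k)).prod, fun x hx => ?_⟩
      have : weightSpace k μ ≤ LinearMap.eqLocus (torus s).toLinearMap
          ((w₀.map fun i => (s i : k)).prod • LinearMap.id) := by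
        refine Submodule.span_le.2 ?_
        rintro _ ⟨w, hw, rfl⟩
        have hp := perm_of_weight_eq (hw.trans h₀.symm)
        simp [exists_torus_monomial, (hp.map fun i => (s i : k)).prod_eq]
      exact this hx
    · refine ⟨0, fun x hx => ?_⟩
      have : weightSpace k μ ≤ ⊥ := by
        refine Submodule.span_le.2 ?_
        rintro _ ⟨w, hw, rfl⟩
        exact (h ⟨w, hw⟩).elim
      simp [(Submodule.mem_bot k).1 (this hx)]
  simp only [AlgHom.toLinearMap_apply, hr x hμ]
  exact D.smul_mem_I r hx

/-- The total degree is the coordinate sum of the weight, so the projection is the identity or zero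
on each weight space. -/
theorem degreeProj_mem (m : ℕ) {x : T k n} (hx : x ∈ D.I) : degreeProj k n m x ∈ D.I := by
  refine D.ideal_le_comap (degreeProj k n m) (idealSubmodule D.I) (fun μ x hx hμ => ?_) hx
  by_cases h : ∑ i, μ i = m
  · have : weightSpace k μ ≤ LinearMap.eqLocus (degreeProj k n m) LinearMap.id := by
      refine Submodule.span_le.2 ?_
      rintro _ ⟨w, rfl, rfl⟩
      rw [weight_sum] at h
      simp [degreeProj_monomial, Nat.cast_injective h]
    have h2 : degreeProj k n m x = x := this hμ
    rw [h2]
    exact hx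
  · have : weightSpace k μ ≤ LinearMap.ker (degreeProj k n m) := by
      refine Submodule.span_le.2 ?_
      rintro _ ⟨w, rfl, rfl⟩
      rw [weight_sum] at h
      simp only [SetLike.mem_coe, LinearMap.mem_ker, degreeProj_monomial]
      rw [if_neg fun h' => h (by rw [h'])]
    have h2 : degreeProj k n m x = 0 := this hμ
    rw [h2]
    exact zero_mem _

theorem counit_eq_zero {x : T k n} (hx : x ∈ D.I) : counit k n x = 0 := by
  have : degreeGETwo k n ≤ LinearMap.ker (counit k n).toLinearMap := by
    refine Submodule.span_le.2 ?_
    rintro _ ⟨w, hw, rfl⟩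
    match w, hw with
    | i :: w, _ => simp
  exact this (D.I_le hx)

theorem linearCoeff_eq_zero (i : Fin n) {x : T k n} (hx : x ∈ D.I) : linearCoeff k i x = 0 := by
  have : degreeGETwo k n ≤ LinearMap.ker (linearCoeff k i) := by
    refine Submodule.span_le.2 ?_
    rintro _ ⟨w, hw, rfl⟩
    match w, hw with
    | i :: j :: w, _ => simp
  exact this (D.I_le hx)

/-- Apply the E_i-coefficient to the left leg of Δ(x) ∈ I ⊗ T + T ⊗ I. It vanishes on I, which has
no part of degree one, so only T ⊗ I contributes. -/
theorem leftDer_mem (i : Fin n) {x : T k n} (hx : x ∈ D.I) : leftDer D.q i x ∈ D.I := by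
  have : coidealSum D.I ≤ (idealSubmodule D.I).comap
      ((TensorProduct.lid k (T k n)).toLinearMap ∘ₗ (linearCoeff k i).rTensor (T k n)) := by
    refine Submodule.span_le.2 ?_
    rintro _ ⟨a, b, h, rfl⟩
    rcases h with h | h
    · simp [D.linearCoeff_eq_zero i h]
    · simpa using! D.smul_mem_I _ h
  exact this (D.I_coideal x hx)

theorem rightDer_mem (i : Fin n) {x : T k n} (hx : x ∈ D.I) : rightDer D.q i x ∈ D.I := by
  have : coidealSum D.I ≤ (idealSubmodule D.I).comap
      ((TensorProduct.rid k (T k n)).toLinearMap ∘ₗ (linearCoeff k i).lTensor (T k n)) := by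
    refine Submodule.span_le.2 ?_
    rintro _ ⟨a, b, h, rfl⟩
    rcases h with h | h
    · simpa using! D.smul_mem_I _ h
    · simp [D.linearCoeff_eq_zero i h]
  exact this (D.I_coideal x hx)

end Datum

/-! ### Twisting by skew-commuting factors -/

section

variable {A : Type*} [Ring A] [Algebra k A]

/-- The scalar `∏_{a<b} s_{w_a w_b}`. -/
def twistScalar (s : Fin n → Fin n → k) : List (Fin n) → k
  | [] => 1
  | i :: w => (w.map (s i)).prod * twistScalar s w

/-- The scalar has one factor per pair of positions, and by symmetry of s the order within a pair is
irrelevant. -/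
theorem twistScalar_perm {s : Fin n → Fin n → k} (hs : ∀ i j, s i j = s j i)
    {w w' : List (Fin n)} (h : w.Perm w') : twistScalar s w = twistScalar s w' := by
  induction h with
  | nil => rfl
  | cons i h ih => simp [twistScalar, ih, (h.map (s i)).prod_eq]
  | swap i j w => simp [twistScalar, hs i j]; ring
  | trans _ _ h1 h2 => exact h1.trans h2

theorem mul_prod_skew {Z L : Fin n → A} {s : Fin n → Fin n → k}
    (hLZ : ∀ i j, L i * Z j = s i j • (Z j * L i)) (i : Fin n) (w : List (Fin n)) :
    L i * (w.map Z).prod = (w.map (s i)).prod • ((w.map Z).prod * L i) := by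
  induction w with
  | nil => simp
  | cons j w ih =>
    simp only [List.map_cons, List.prod_cons]
    rw [← mul_assoc, hLZ, smul_mul_assoc, mul_assoc, ih, mul_smul_comm, smul_smul, mul_assoc]

theorem prod_twist {Z L : Fin n → A} {s : Fin n → Fin n → k}
    (hLZ : ∀ i j, L i * Z j = s i j • (Z j * L i)) (w : List (Fin n)) :
    (w.map fun i => Z i * L i).prod =
      twistScalar s w • ((w.map Z).prod * (w.map L).prod) := by
  induction w with
  | nil => simp [twistScalar]
  | cons i w ih =>
    simp only [List.map_cons, List.prod_cons, ih, twistScalar]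
    rw [mul_smul_comm, mul_assoc, ← mul_assoc (L i), mul_prod_skew hLZ, smul_mul_assoc,
      mul_smul_comm, smul_smul, mul_comm (twistScalar s w)]
    simp only [mul_assoc]

/-- If the relations `I` hold for `Z_i`, then they hold for `Z_i L_i`, where the `L_i` commute
with each other and skew-commute with the `Z_j` up to a symmetric matrix of scalars. -/
theorem Datum.lift_twist_eq_zero (D : Datum k n) {Z L : Fin n → A} {s : Fin n → Fin n → k}
    (hs : ∀ i j, s i j = s j i) (hL : ∀ i j, Commute (L i) (L j))
    (hLZ : ∀ i j, L i * Z j = s i j • (Z j * L i))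
    (hZ : ∀ p ∈ D.I, FreeAlgebra.lift k Z p = 0) {p : T k n} (hp : p ∈ D.I) :
    FreeAlgebra.lift k (fun i => Z i * L i) p = 0 := by
  suffices h : (FreeAlgebra.lift k fun i => Z i * L i).toLinearMap p ∈ (⊥ : Submodule k A) from h
  refine D.ideal_le_comap _ _ (fun μ x hx hμ => ?_) hp
  by_cases h : ∃ w : List (Fin n), (w.map α).sum = μ
  · obtain ⟨w₀, h₀⟩ := h
    -- On one weight space the scalar and the product of the L_i are those of any fixed word w₀. So
    -- p(ZL) is a scalar multiple of p(Z) times a fixed factor.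
    have : weightSpace k μ ≤ LinearMap.eqLocus
        (FreeAlgebra.lift k fun i => Z i * L i).toLinearMap
        (twistScalar s w₀ • (LinearMap.mulRight k (w₀.map L).prod ∘ₗ
          (FreeAlgebra.lift k Z).toLinearMap)) := by
      refine Submodule.span_le.2 ?_
      rintro _ ⟨w, hw, rfl⟩
      have hp := perm_of_weight_eq (hw.trans h₀.symm)
      have hLp : (w.map L).prod = (w₀.map L).prod :=
        (hp.map L).prod_eq' (List.pairwise_map.2 (List.pairwise_of_forall fun _ _ => hL _ _))
      simp [lift_monomial, prod_twist hLZ, twistScalar_perm hs hp, hLp]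
    have h2 := this hμ
    simp only [LinearMap.mem_eqLocus, LinearMap.smul_apply, LinearMap.coe_comp,
      Function.comp_apply, AlgHom.toLinearMap_apply, hZ x hx] at h2
    simp [h2]
  · have : weightSpace k μ ≤ ⊥ := by
      refine Submodule.span_le.2 ?_
      rintro _ ⟨w, hw, rfl⟩
      exact (h ⟨w, hw⟩).elim
    simp [(Submodule.mem_bot k).1 (this hμ)]

end

end PreNichols

namespace PreNichols

namespace Datum

variable {k : Type*} [Field k] {n : ℕ} (D : Datum k n)

theorem χ_zero_right (a : Fin n → ℤ) : D.χ a 0 = 1 := by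
  have h := D.χ_add_right a 0 0
  rw [add_zero] at h
  exact (mul_eq_left.1 h.symm)

/-! ### A module over `U(χ)` -/

/-- The vector space `T / I` underlying the pre-Nichols algebra. -/
def PreNic : Type _ := T k n ⧸ idealSubmodule D.I

instance : AddCommGroup D.PreNic := inferInstanceAs (AddCommGroup (T k n ⧸ idealSubmodule D.I))

instance : Module k D.PreNic := inferInstanceAs (Module k (T k n ⧸ idealSubmodule D.I))

/-- The projection `T → T / I`. -/
def toPreNic : T k n →ₗ[k] D.PreNic := (idealSubmodule D.I).mkQ

theorem toPreNic_surjective : Function.Surjective D.toPreNic := Submodule.mkQ_surjective _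

theorem toPreNic_eq_zero {x : T k n} : D.toPreNic x = 0 ↔ x ∈ D.I :=
  Submodule.Quotient.mk_eq_zero (idealSubmodule D.I)

/-- The linear map on `T / I` induced by a linear map on `T`. -/
def preNicLift {M : Type*} [AddCommGroup M] [Module k M] (f : T k n →ₗ[k] M)
    (hf : ∀ x ∈ D.I, f x = 0) : D.PreNic →ₗ[k] M :=
  (idealSubmodule D.I).liftQ f hf

@[simp] theorem preNicLift_toPreNic {M : Type*} [AddCommGroup M] [Module k M]
    (f : T k n →ₗ[k] M) (hf : ∀ x ∈ D.I, f x = 0) (x : T k n) :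
    D.preNicLift f hf (D.toPreNic x) = f x := rfl

/-- The linear endomorphism of `T / I` induced by an `I`-preserving endomorphism of `T`. -/
def preNicMap (f : T k n →ₗ[k] T k n) (hf : ∀ x ∈ D.I, f x ∈ D.I) : Module.End k D.PreNic :=
  D.preNicLift (D.toPreNic ∘ₗ f) fun x hx => D.toPreNic_eq_zero.2 (hf x hx)

@[simp] theorem preNicMap_toPreNic (f : T k n →ₗ[k] T k n) (hf : ∀ x ∈ D.I, f x ∈ D.I)
    (x : T k n) : D.preNicMap f hf (D.toPreNic x) = D.toPreNic (f x) := rfl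

/-- The space `⨁_λ U⁺ ⊗ U⁻`, on which `U(χ)` acts as on its triangular decomposition into
`U⁺`, the group algebra of `ℤⁿ` and `U⁻`. -/
def Tri : Type _ := (Fin n → ℤ) →₀ (D.PreNic ⊗[k] D.PreNic)

instance : AddCommGroup D.Tri :=
  inferInstanceAs (AddCommGroup ((Fin n → ℤ) →₀ (D.PreNic ⊗[k] D.PreNic)))

instance : Module k D.Tri :=
  inferInstanceAs (Module k ((Fin n → ℤ) →₀ (D.PreNic ⊗[k] D.PreNic)))

/-- The inclusion of the summand with index `l`. -/
def triSingle (l : Fin n → ℤ) : D.PreNic ⊗[k] D.PreNic →ₗ[k] D.Tri := Finsupp.lsingle l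

/-- The projection onto the summand with index `l`. -/
def triCoeff (l : Fin n → ℤ) : D.Tri →ₗ[k] D.PreNic ⊗[k] D.PreNic := Finsupp.lapply l

/-- The linear map defined by its restrictions to the summands. -/
def triLift {M : Type*} [AddCommGroup M] [Module k M]
    (f : (Fin n → ℤ) → D.PreNic ⊗[k] D.PreNic →ₗ[k] M) : D.Tri →ₗ[k] M :=
  Finsupp.lsum k f

theorem triLift_single {M : Type*} [AddCommGroup M] [Module k M]
    (f : (Fin n → ℤ) → D.PreNic ⊗[k] D.PreNic →ₗ[k] M) (l : Fin n → ℤ)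
    (t : D.PreNic ⊗[k] D.PreNic) : D.triLift f (D.triSingle l t) = f l t :=
  Finsupp.sum_single_index (map_zero _)

theorem triCoeff_single (l l' : Fin n → ℤ) (t : D.PreNic ⊗[k] D.PreNic) :
    D.triCoeff l (D.triSingle l' t) = if l' = l then t else 0 :=
  Finsupp.single_apply

/-- The vector `a K^l u`. -/
def vec (l : Fin n → ℤ) : T k n →ₗ[k] T k n →ₗ[k] D.Tri :=
  ((TensorProduct.mk k D.PreNic D.PreNic).compr₂ (D.triSingle l)).compl₁₂
    D.toPreNic D.toPreNic

theorem vec_apply (l : Fin n → ℤ) (a u : T k n) :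
    D.vec l a u = D.triSingle l (D.toPreNic a ⊗ₜ D.toPreNic u) := rfl

theorem triLift_vec {M : Type*} [AddCommGroup M] [Module k M]
    (f : (Fin n → ℤ) → D.PreNic ⊗[k] D.PreNic →ₗ[k] M) (l : Fin n → ℤ) (a u : T k n) :
    D.triLift f (D.vec l a u) = f l (D.toPreNic a ⊗ₜ D.toPreNic u) :=
  D.triLift_single f l _

theorem vec_eq_zero_left (l : Fin n → ℤ) {a : T k n} (ha : a ∈ D.I) (u : T k n) :
    D.vec l a u = 0 := by
  simp [vec_apply, D.toPreNic_eq_zero.2 ha]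

theorem vec_eq_zero_right (l : Fin n → ℤ) (a : T k n) {u : T k n} (hu : u ∈ D.I) :
    D.vec l a u = 0 := by
  simp [vec_apply, D.toPreNic_eq_zero.2 hu]

theorem Tri_induction (S : Submodule k D.Tri) (h : ∀ l a u, D.vec l a u ∈ S) (v : D.Tri) :
    v ∈ S := by
  refine Finsupp.induction_linear (motive := fun v => (show D.Tri from v) ∈ S) v S.zero_mem
    (fun f g hf hg => S.add_mem hf hg) fun l t => ?_
  change D.triSingle l t ∈ S
  induction t with
  | zero => simp
  | add s t hs ht =>
    rw [map_add]
    exact add_mem hs ht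
  | tmul a u =>
    obtain ⟨a, rfl⟩ := D.toPreNic_surjective a
    obtain ⟨u, rfl⟩ := D.toPreNic_surjective u
    exact h l a u

theorem Tri_ext {M : Type*} [AddCommGroup M] [Module k M] {f g : D.Tri →ₗ[k] M}
    (h : ∀ l a u, f (D.vec l a u) = g (D.vec l a u)) : f = g :=
  LinearMap.ext fun v => D.Tri_induction (LinearMap.eqLocus f g) h v

/-- The operator `vec l a u ↦ r(l) vec s(l) f(a) g(u)`. -/
def op (s : (Fin n → ℤ) → Fin n → ℤ) (r : (Fin n → ℤ) → k) (f g : T k n →ₗ[k] T k n)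
    (hf : ∀ x ∈ D.I, f x ∈ D.I) (hg : ∀ x ∈ D.I, g x ∈ D.I) : Module.End k D.Tri :=
  D.triLift fun l => r l • (D.triSingle (s l) ∘ₗ
    TensorProduct.map (D.preNicMap f hf) (D.preNicMap g hg))

theorem op_vec (s : (Fin n → ℤ) → Fin n → ℤ) (r : (Fin n → ℤ) → k) (f g : T k n →ₗ[k] T k n)
    (hf : ∀ x ∈ D.I, f x ∈ D.I) (hg : ∀ x ∈ D.I, g x ∈ D.I) (l : Fin n → ℤ) (a u : T k n) :
    D.op s r f g hf hg (D.vec l a u) = r l • D.vec (s l) (f a) (g u) := by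
  rw [op, triLift_vec]
  simp [vec_apply]

/-- The action of `E_i K_i⁻¹`. -/
def opEt (i : Fin n) : Module.End k D.Tri :=
  D.op id 1 (LinearMap.mulLeft k (FreeAlgebra.ι k i)) LinearMap.id
    (by exact fun _ hx => D.I.mul_mem_left _ _ hx) (by exact fun _ hx => hx)

/-- The action of `K_i`. -/
def opK (i : Fin n) : Module.End k D.Tri :=
  D.op (· + α i) 1 (torus (D.q i)).toLinearMap LinearMap.id
    (by exact fun _ hx => D.torus_mem _ hx) (by exact fun _ hx => hx)

/-- The action of `K_i⁻¹`. -/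
def opKinv (i : Fin n) : Module.End k D.Tri :=
  D.op (· - α i) 1 (torus (D.q i)⁻¹).toLinearMap LinearMap.id
    (by exact fun _ hx => D.torus_mem _ hx) (by exact fun _ hx => hx)

/-- The action of `F_i`. -/
def opF (i : Fin n) : Module.End k D.Tri :=
  D.op id (fun l => (D.χ (α i) l : k)) (torus (D.q i)⁻¹).toLinearMap
      (LinearMap.mulLeft k (FreeAlgebra.ι k i))
      (by exact fun _ hx => D.torus_mem _ hx) (by exact fun _ hx => D.I.mul_mem_left _ _ hx) -
    D.op id 1 ((torus (D.q i)⁻¹).toLinearMap ∘ₗ rightDer D.q i) LinearMap.id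
      (by exact fun _ hx => D.torus_mem _ (D.rightDer_mem i hx)) (by exact fun _ hx => hx) +
    D.op (· - α i - α i) 1 ((torus (D.q i)⁻¹).toLinearMap ∘ₗ (torus (D.q i)⁻¹).toLinearMap ∘ₗ
        leftDer D.q i) LinearMap.id
      (by exact fun _ hx => D.torus_mem _ (D.torus_mem _ (D.leftDer_mem i hx))) (by exact fun _ hx => hx)

@[simp] theorem opEt_vec (i : Fin n) (l : Fin n → ℤ) (a u : T k n) :
    D.opEt i (D.vec l a u) = D.vec l (FreeAlgebra.ι k i * a) u :=
  (D.op_vec _ _ _ _ _ _ _ _ _).trans (by simp)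

@[simp] theorem opK_vec (i : Fin n) (l : Fin n → ℤ) (a u : T k n) :
    D.opK i (D.vec l a u) = D.vec (l + α i) (torus (D.q i) a) u :=
  (D.op_vec _ _ _ _ _ _ _ _ _).trans (by simp)

@[simp] theorem opKinv_vec (i : Fin n) (l : Fin n → ℤ) (a u : T k n) :
    D.opKinv i (D.vec l a u) = D.vec (l - α i) (torus (D.q i)⁻¹ a) u :=
  (D.op_vec _ _ _ _ _ _ _ _ _).trans (by simp)

-- This is the result of moving F_i to the right through a(Ẽ) K^l. The first term is F_i arriving at
-- u. The others come from F_i Ẽ_i = q_{ii}⁻¹ Ẽ_i F_i - (1 - K_i⁻²): the 1 produces the right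
-- derivation, and K_i⁻² the left derivation together with the shift by -2α_i.
@[simp] theorem opF_vec (i : Fin n) (l : Fin n → ℤ) (a u : T k n) :
    D.opF i (D.vec l a u) =
      (D.χ (α i) l : k) • D.vec l (torus (D.q i)⁻¹ a) (FreeAlgebra.ι k i * u) -
        D.vec l (torus (D.q i)⁻¹ (rightDer D.q i a)) u +
        D.vec (l - α i - α i) (torus (D.q i)⁻¹ (torus (D.q i)⁻¹ (leftDer D.q i a))) u := by
  rw [opF, LinearMap.add_apply, LinearMap.sub_apply]
  refine congrArg₂ _ (congrArg₂ _ (D.op_vec _ _ _ _ _ _ _ _ _) (D.op_vec _ _ _ _ _ _ _ _ _))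
    (D.op_vec _ _ _ _ _ _ _ _ _) |>.trans ?_
  simp

theorem opK_mul_opKinv (i : Fin n) : D.opK i * D.opKinv i = 1 :=
  D.Tri_ext fun l a u => by simp

theorem opKinv_mul_opK (i : Fin n) : D.opKinv i * D.opK i = 1 :=
  D.Tri_ext fun l a u => by simp

theorem opK_comm (i j : Fin n) : D.opK i * D.opK j = D.opK j * D.opK i :=
  D.Tri_ext fun l a u => by
    simp [torus_comm (D.q i) (D.q j), add_right_comm]

theorem opK_mul_opEt (i j : Fin n) :
    D.opK i * D.opEt j = (D.q i j : k) • (D.opEt j * D.opK i) :=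
  D.Tri_ext fun l a u => by simp

theorem opK_mul_opF (i j : Fin n) :
    D.opK i * D.opF j = ((D.q i j)⁻¹ : kˣ) • (D.opF j * D.opK i) :=
  D.Tri_ext fun l a u => by
    have h1 : (D.χ (α j) (l + α i) : k) = D.χ (α j) l * D.q i j := by
      rw [D.χ_add_right, Units.val_mul, D.q_symm]
      rfl
    have h2 : l - α j - α j + α i = l + α i - α j - α j := by abel
    simp only [Module.End.mul_apply, LinearMap.smul_apply, opF_vec, opK_vec, map_add, map_sub,
      map_smul, h1, h2, rightDer_torus, leftDer_torus, torus_comm (D.q j)⁻¹ (D.q i),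
      Units.smul_def, smul_add, smul_sub, smul_smul]
    simp [mul_comm]

/-- The action of `E_i`. -/
def opE (i : Fin n) : Module.End k D.Tri := D.opEt i * D.opK i

theorem opK_mul_opE (i j : Fin n) :
    D.opK i * D.opE j = (D.q i j : k) • (D.opE j * D.opK i) := by
  rw [opE, ← mul_assoc, opK_mul_opEt, smul_mul_assoc, mul_assoc, D.opK_comm, ← mul_assoc]

/-- Apart from the inhomogeneous terms of the two Leibniz rules everything cancels by torus weights.
The term from `rightDer_ι_mul` gives K_i, the term from `leftDer_ι_mul` gives K_i⁻¹. -/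
theorem opE_mul_opF (i j : Fin n) :
    D.opE i * D.opF j - D.opF j * D.opE i = if i = j then D.opK i - D.opKinv i else 0 :=
  D.Tri_ext fun l a u => by
    have h1 : (D.χ (α j) (l + α i) : k) = D.χ (α j) l * D.q i j := by
      rw [D.χ_add_right, Units.val_mul, D.q_symm]
      rfl
    have h2 : l - α j - α j + α i = l + α i - α j - α j := by abel
    have h3 : (D.q j i : k) = D.q i j := by rw [D.q_symm]
    have h4 : (D.q i j : k) ≠ 0 := (D.q i j).ne_zero
    by_cases hij : i = j
    · subst hij
      have h5 : l + α i - α i - α i = l - α i := by abel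
      simp only [opE, Module.End.mul_apply, LinearMap.sub_apply, opF_vec, opK_vec, opEt_vec,
        opKinv_vec, map_add, map_sub, map_smul, h1, h2, rightDer_torus, leftDer_torus,
        rightDer_ι_mul, leftDer_ι_mul, torus_comm (D.q i)⁻¹ (D.q i), map_mul, torus_ι, h5,
        smul_mul_assoc, mul_smul_comm, smul_smul, if_true, LinearMap.add_apply,
        LinearMap.smul_apply, Pi.inv_apply, Units.val_inv_eq_inv_val, torus_torus_inv]
      field_simp
      simp
      abel
    · simp only [opE, Module.End.mul_apply, LinearMap.sub_apply, opF_vec, opK_vec, opEt_vec,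
        map_add, map_sub, map_smul, h1, h2, h3, rightDer_torus, leftDer_torus,
        rightDer_ι_mul, leftDer_ι_mul, torus_comm (D.q j)⁻¹ (D.q i), map_mul, torus_ι,
        smul_mul_assoc, mul_smul_comm, smul_smul,
        LinearMap.smul_apply, Pi.inv_apply, Units.val_inv_eq_inv_val,
        if_neg hij, if_neg (Ne.symm hij), zero_add, add_zero, LinearMap.zero_apply]
      field_simp
      simp

/-- The action of the generators. -/
def opGen : Gen n → Module.End k D.Tri
  | .E i => D.opE i
  | .F i => D.opF i
  | .K i => D.opK i
  | .Kinv i => D.opKinv i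

/-- The action of `Ũ(χ)`. -/
def actUtil : D.Util →ₐ[k] Module.End k D.Tri :=
  RingQuot.liftAlgHom k ⟨FreeAlgebra.lift k D.opGen, by
    intro x y h
    induction h with
    | K_Kinv i => simpa [gen, opGen] using D.opK_mul_opKinv i
    | Kinv_K i => simpa [gen, opGen] using D.opKinv_mul_opK i
    | K_comm i j => simpa [gen, opGen] using D.opK_comm i j
    | K_E i j => simpa [gen, opGen] using D.opK_mul_opE i j
    | K_F i j => simpa [gen, opGen, Units.smul_def] using D.opK_mul_opF i j
    | E_F i j =>
      have h := D.opE_mul_opF i j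
      split_ifs at h ⊢ <;> simpa [gen, opGen] using h⟩

@[simp] theorem actUtil_genUtil (g : Gen n) : D.actUtil (D.genUtil g) = D.opGen g := by
  simp only [actUtil, genUtil, mkUtil]
  erw [RingQuot.liftAlgHom_mkAlgHom_apply]
  simp [gen]

/-! ### The relations of the biideal hold on `Tri` -/

theorem lift_opEt_vec (p : T k n) (l : Fin n → ℤ) (a u : T k n) :
    FreeAlgebra.lift k D.opEt p (D.vec l a u) = D.vec l (p * a) u := by
  have : (LinearMap.applyₗ (D.vec l a u)) ∘ₗ (FreeAlgebra.lift k D.opEt).toLinearMap =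
      (D.vec l).flip u ∘ₗ LinearMap.mulRight k a := by
    refine T_linearMap_ext (by simp) fun i x hx => ?_
    simp only [LinearMap.coe_comp, Function.comp_apply, AlgHom.toLinearMap_apply,
      LinearMap.applyₗ_apply_apply, LinearMap.flip_apply, LinearMap.mulRight_apply] at hx ⊢
    simp [hx, mul_assoc]
  exact DFunLike.congr_fun this p

/-- The operators Ẽ_i act by left multiplication on T / I, so p(Ẽ) = 0 is immediate; E_i = Ẽ_i K_i
is a twist of Ẽ_i by skew-commuting factors. -/
theorem lift_opE_eq_zero {p : T k n} (hp : p ∈ D.I) : FreeAlgebra.lift k D.opE p = 0 := by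
  refine D.lift_twist_eq_zero (A := Module.End k D.Tri) (Z := D.opEt) (L := D.opK) (s := fun i j => (D.q i j : k))
    (fun i j => by rw [D.q_symm]) (fun i j => D.opK_comm i j) D.opK_mul_opEt (fun p hp => ?_) hp
  refine D.Tri_ext fun l a u => ?_
  rw [lift_opEt_vec, D.vec_eq_zero_left l (D.I.mul_mem_right _ _ hp)]
  rfl

theorem skew_lift {A : Type*} [Ring A] [Algebra k A] {F : Fin n → A} {L : A} {s : Fin n → kˣ}
    (hLF : ∀ j, L * F j = (s j : k) • (F j * L)) (p : T k n) :
    L * FreeAlgebra.lift k F p = FreeAlgebra.lift k F (torus s p) * L := by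
  have : LinearMap.mulLeft k L ∘ₗ (FreeAlgebra.lift k F).toLinearMap =
      LinearMap.mulRight k L ∘ₗ (FreeAlgebra.lift k F).toLinearMap ∘ₗ
        (torus s).toLinearMap := by
    refine T_linearMap_ext (by simp) fun j x hx => ?_
    simp only [LinearMap.coe_comp, Function.comp_apply, AlgHom.toLinearMap_apply,
      LinearMap.mulLeft_apply, LinearMap.mulRight_apply] at hx ⊢
    simp only [map_mul, torus_ι, map_smul, FreeAlgebra.lift_ι_apply]
    rw [← mul_assoc, hLF, smul_mul_assoc, mul_assoc, hx, smul_mul_assoc, smul_mul_assoc,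
      mul_assoc]
  exact DFunLike.congr_fun this p

/-- The commutator of `E_j` with a polynomial in the `F_i`. -/
theorem comm_lift_F {A : Type*} [Ring A] [Algebra k A] {E F K K' : Fin n → A}
    (hEF : ∀ i j, E i * F j = F j * E i + if i = j then K i - K' i else 0)
    (hFK : ∀ i j, F j * K i = (D.q i j : k) • (K i * F j))
    (hKF : ∀ i j, K' i * F j = (D.q i j : k) • (F j * K' i)) (i : Fin n) (p : T k n) :
    E i * FreeAlgebra.lift k F p = FreeAlgebra.lift k F p * E i +
      K i * FreeAlgebra.lift k F (leftDer D.q i p) -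
      FreeAlgebra.lift k F (rightDer D.q i p) * K' i := by
  have : LinearMap.mulLeft k (E i) ∘ₗ (FreeAlgebra.lift k F).toLinearMap =
      LinearMap.mulRight k (E i) ∘ₗ (FreeAlgebra.lift k F).toLinearMap +
      LinearMap.mulLeft k (K i) ∘ₗ (FreeAlgebra.lift k F).toLinearMap ∘ₗ leftDer D.q i -
      LinearMap.mulRight k (K' i) ∘ₗ (FreeAlgebra.lift k F).toLinearMap ∘ₗ
        rightDer D.q i := by
    refine T_linearMap_ext (by simp) fun j x hx => ?_
    simp only [LinearMap.coe_comp, Function.comp_apply, AlgHom.toLinearMap_apply,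
      LinearMap.mulLeft_apply, LinearMap.mulRight_apply, LinearMap.sub_apply,
      LinearMap.add_apply] at hx ⊢
    simp only [map_mul, FreeAlgebra.lift_ι_apply, leftDer_ι_mul, rightDer_ι_mul, map_add,
      map_smul, mul_add, add_mul]
    have h2 : (D.q j i : k) • (K i * (F j * FreeAlgebra.lift k F (leftDer D.q i x))) =
        F j * (K i * FreeAlgebra.lift k F (leftDer D.q i x)) := by
      rw [← mul_assoc, ← mul_assoc, hFK, smul_mul_assoc, D.q_symm]
    rw [← mul_assoc, hEF, add_mul, mul_assoc, hx, mul_smul_comm, h2]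
    by_cases hij : i = j
    · subst hij
      simp only [if_true, sub_mul, skew_lift (hKF i), mul_add, mul_sub, mul_assoc]
      abel
    · simp only [if_neg hij, map_zero, mul_zero, zero_mul, mul_add, mul_sub, mul_assoc]
      abel
  exact DFunLike.congr_fun this p

/-- Both derivations kill a = 1, so on these vectors F_i is left multiplication on u up to a
character. -/
theorem lift_opF_vec_one (p : T k n) (l : Fin n → ℤ) (u : T k n) :
    FreeAlgebra.lift k D.opF p (D.vec l 1 u) =
      D.vec l 1 (torus (fun i => D.χ (α i) l) p * u) := by
  have : (LinearMap.applyₗ (D.vec l 1 u)) ∘ₗ (FreeAlgebra.lift k D.opF).toLinearMap =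
      D.vec l 1 ∘ₗ LinearMap.mulRight k u ∘ₗ (torus fun i => D.χ (α i) l).toLinearMap := by
    refine T_linearMap_ext (by simp) fun i x hx => ?_
    simp only [LinearMap.coe_comp, Function.comp_apply, AlgHom.toLinearMap_apply,
      LinearMap.applyₗ_apply_apply, LinearMap.mulRight_apply] at hx ⊢
    simp [hx, mul_assoc]
  exact DFunLike.congr_fun this p

theorem opF_mul_opK (i j : Fin n) :
    D.opF j * D.opK i = (D.q i j : k) • (D.opK i * D.opF j) := by
  simp [opK_mul_opF, Units.smul_def, smul_smul]

theorem opKinv_mul_opF (i j : Fin n) :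
    D.opKinv i * D.opF j = (D.q i j : k) • (D.opF j * D.opKinv i) := by
  have h := congrArg (fun x => D.opKinv i * x * D.opKinv i) (D.opF_mul_opK i j)
  simp only [mul_smul_comm, smul_mul_assoc] at h
  rw [mul_assoc, mul_assoc, D.opK_mul_opKinv, mul_one, ← mul_assoc (D.opKinv i) (D.opK i),
    D.opKinv_mul_opK, one_mul] at h
  exact h

/-- A direct computation on `vec l a u` would be unwieldy. Instead, the joint kernel S of all p(F)
with p ∈ I is stable under K_i⁻¹ because I is torus stable, and under E_i because the commutator of
E_i with p(F) involves only the two skew derivatives of p. It contains all vectors with a = 1, and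
these generate `Tri`. -/
theorem lift_opF_eq_zero {p : T k n} (hp : p ∈ D.I) : FreeAlgebra.lift k D.opF p = 0 := by
  let S : Submodule k D.Tri := ⨅ p : D.I, LinearMap.ker (FreeAlgebra.lift k D.opF (p : T k n))
  have hS : ∀ v, v ∈ S ↔ ∀ p ∈ D.I, FreeAlgebra.lift k D.opF p v = 0 := fun v => by
    simp [S]
  have hK : ∀ i, ∀ v ∈ S, D.opKinv i v ∈ S := by
    intro i v hv
    rw [hS] at hv ⊢
    intro p hp
    have h := DFunLike.congr_fun (skew_lift (A := Module.End k D.Tri) (D.opKinv_mul_opF i) (torus (D.q i)⁻¹ p)) v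
    simp only [Module.End.mul_apply, torus_torus_inv, hv _ (D.torus_mem _ hp), map_zero] at h
    exact h.symm
  have hE : ∀ i, ∀ v ∈ S, D.opE i v ∈ S := by
    intro i v hv
    have hv' := hK i v hv
    rw [hS] at hv hv' ⊢
    intro p hp
    have h := DFunLike.congr_fun (D.comm_lift_F (A := Module.End k D.Tri)
      (fun i j => eq_add_of_sub_eq' (D.opE_mul_opF i j)) D.opF_mul_opK D.opKinv_mul_opF i p) v
    simp only [Module.End.mul_apply, LinearMap.add_apply, LinearMap.sub_apply] at h
    rw [hv p hp, hv _ (D.leftDer_mem i hp), hv' _ (D.rightDer_mem i hp)] at h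
    simpa using h.symm
  have hvec : ∀ a : T k n, ∀ l u, D.vec l a u ∈ S := by
    intro a
    let S' : Submodule k (T k n) := ⨅ l, ⨅ u, S.comap ((D.vec l).flip u)
    have hS' : ∀ a, a ∈ S' ↔ ∀ l u, D.vec l a u ∈ S := fun a => by simp [S']
    rw [← hS']
    refine T_induction S' ((hS' _).2 fun l u => (hS _).2 fun p hp => ?_) (fun i a ha => ?_) a
    · rw [lift_opF_vec_one]
      exact D.vec_eq_zero_right l _ (D.I.mul_mem_right _ _ (D.torus_mem _ hp))
    · rw [hS'] at ha ⊢
      intro l u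
      -- As Ẽ_i = E_i K_i⁻¹, stability under K_i⁻¹ and E_i allows one more letter on a.
      have h := hE i _ (hK i _ (ha l u))
      rw [opE, Module.End.mul_apply, ← Module.End.mul_apply (D.opK i), opK_mul_opKinv] at h
      simpa using h
  refine D.Tri_ext fun l a u => ?_
  simpa using (hS _).1 (hvec a l u) p hp

end Datum

end PreNichols

namespace PreNichols

/-! ### Induction on the weight lattice, and the height of a weight -/

theorem lattice_induction {n : ℕ} {P : (Fin n → ℤ) → Prop} (h0 : P 0)
    (hadd : ∀ i l, P l → P (l + α i)) (hsub : ∀ i l, P l → P (l - α i)) (l : Fin n → ℤ) :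
    P l := by
  have h1 : ∀ (i : Fin n) (z : ℤ) l, P l → P (l + z • α i) := by
    intro i z
    induction z using Int.induction_on with
    | zero => simp
    | succ z ih =>
      intro l hl
      rw [add_smul, one_smul, ← add_assoc]
      exact hadd i _ (ih l hl)
    | pred z ih =>
      intro l hl
      rw [sub_smul, one_smul, ← add_sub_assoc]
      exact hsub i _ (ih l hl)
  have h2 : ∀ s : Finset (Fin n), P (∑ i ∈ s, l i • α i) := by
    intro s
    induction s using Finset.induction_on with
    | empty => simpa
    | insert i s hi ih =>
      rw [Finset.sum_insert hi, add_comm]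
      exact h1 i _ _ ih
  have h3 : ∑ i, l i • α i = l := by
    conv_rhs => rw [← Finset.univ_sum_single l]
    refine Finset.sum_congr rfl fun i _ => ?_
    rw [α, ← Pi.single_smul, smul_eq_mul, mul_one]
  exact h3 ▸ h2 Finset.univ

/-- The sum of the coordinates. -/
def height {n : ℕ} (l : Fin n → ℤ) : ℤ := ∑ i, l i

theorem height_add {n : ℕ} (l m : Fin n → ℤ) : height (l + m) = height l + height m := by
  simp [height, Finset.sum_add_distrib]

theorem height_sub {n : ℕ} (l m : Fin n → ℤ) : height (l - m) = height l - height m := by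
  simp [height]

@[simp] theorem height_zero {n : ℕ} : height (0 : Fin n → ℤ) = 0 := by
  simp [height]

@[simp] theorem height_α {n : ℕ} (i : Fin n) : height (α i) = 1 := by
  simp [height, α]

namespace Datum

variable {k : Type*} [Field k] {n : ℕ} (D : Datum k n)

/-! ### Relations in `U(χ)` -/

theorem mkUtil_rel {x y : FreeAlgebra k (Gen n)} (h : D.DoubleRel x y) :
    D.mkU (D.mkUtil x) = D.mkU (D.mkUtil y) :=
  congrArg D.mkU (RingQuot.mkAlgHom_rel k h)

theorem K_comm (i j : Fin n) : D.K i * D.K j = D.K j * D.K i := by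
  simpa using! D.mkUtil_rel (.K_comm i j)

theorem K_mul_E (i j : Fin n) : D.K i * D.E j = (D.q i j : k) • (D.E j * D.K i) := by
  simpa using! D.mkUtil_rel (.K_E i j)

theorem F_mul_K (i j : Fin n) : D.F j * D.K i = (D.q i j : k) • (D.K i * D.F j) := by
  have h : D.K i * D.F j = ((D.q i j)⁻¹ : kˣ) • (D.F j * D.K i) := by
    have h := D.mkUtil_rel (.K_F i j)
    rw [Units.smul_def] at h ⊢
    simpa using! h
  simp [h, Units.smul_def, smul_smul]

theorem E_mul_F (i j : Fin n) :
    D.E i * D.F j = D.F j * D.E i + if i = j then D.K i - D.Kinv i else 0 := by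
  rw [← sub_eq_iff_eq_add']
  have h := D.mkUtil_rel (.E_F i j)
  split_ifs at h ⊢ <;> simpa using! h

theorem Kinv_mul_F (i j : Fin n) : D.Kinv i * D.F j = (D.q i j : k) • (D.F j * D.Kinv i) := by
  have h := congrArg (fun x => D.Kinv i * x * D.Kinv i) (D.F_mul_K i j)
  simp only [mul_smul_comm, smul_mul_assoc] at h
  rw [mul_assoc, mul_assoc, D.K_mul_Kinv, mul_one, ← mul_assoc (D.Kinv i) (D.K i),
    D.Kinv_mul_K, one_mul] at h
  exact h

theorem E_mul_Kinv (i j : Fin n) : D.E j * D.Kinv i = (D.q i j : k) • (D.Kinv i * D.E j) := by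
  have h := congrArg (fun x => D.Kinv i * x * D.Kinv i) (D.K_mul_E i j)
  simp only [mul_smul_comm, smul_mul_assoc] at h
  rw [← mul_assoc, D.Kinv_mul_K, one_mul, mul_assoc, mul_assoc, D.K_mul_Kinv, mul_one] at h
  exact h

theorem lift_E_eq_zero {p : T k n} (hp : p ∈ D.I) : FreeAlgebra.lift k D.E p = 0 := by
  have h : D.mkU (FreeAlgebra.lift k (fun i => D.genUtil (.E i)) p) = D.mkU 0 :=
    RingQuot.mkAlgHom_rel k (IdealRel.E p hp)
  have h2 : D.mkU.comp (FreeAlgebra.lift k fun i => D.genUtil (.E i)) = FreeAlgebra.lift k D.E := by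
    ext i
    simp [E, genU]
  rw [← h2, AlgHom.comp_apply, h, map_zero]

theorem lift_F_eq_zero {p : T k n} (hp : p ∈ D.I) : FreeAlgebra.lift k D.F p = 0 := by
  have h : D.mkU (FreeAlgebra.lift k (fun i => D.genUtil (.F i)) p) = D.mkU 0 :=
    RingQuot.mkAlgHom_rel k (IdealRel.F p hp)
  have h2 : D.mkU.comp (FreeAlgebra.lift k fun i => D.genUtil (.F i)) = FreeAlgebra.lift k D.F := by
    ext i
    simp [F, genU]
  rw [← h2, AlgHom.comp_apply, h, map_zero]

/-- The action of `U(χ)`. -/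
def act : D.U →ₐ[k] Module.End k D.Tri :=
  RingQuot.liftAlgHom k ⟨D.actUtil, by
    intro x y h
    induction h with
    | E p hp =>
      have h2 : D.actUtil.comp (FreeAlgebra.lift k fun i => D.genUtil (.E i)) =
          FreeAlgebra.lift k D.opE := by
        ext i : 2
        simp [opGen]
      rw [map_zero, ← AlgHom.comp_apply, h2, D.lift_opE_eq_zero hp]
    | F p hp =>
      have h2 : D.actUtil.comp (FreeAlgebra.lift k fun i => D.genUtil (.F i)) =
          FreeAlgebra.lift k D.opF := by
        ext i : 2
        simp [opGen]
      rw [map_zero, ← AlgHom.comp_apply, h2, D.lift_opF_eq_zero hp]⟩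

theorem act_genU (g : Gen n) : D.act (D.genU g) = D.opGen g := by
  simp only [act, genU, mkU]
  erw [RingQuot.liftAlgHom_mkAlgHom_apply]
  simp

@[simp] theorem act_E (i : Fin n) : D.act (D.E i) = D.opE i := D.act_genU _

@[simp] theorem act_F (i : Fin n) : D.act (D.F i) = D.opF i := D.act_genU _

@[simp] theorem act_K (i : Fin n) : D.act (D.K i) = D.opK i := D.act_genU _

@[simp] theorem act_Kinv (i : Fin n) : D.act (D.Kinv i) = D.opKinv i := D.act_genU _

@[simp] theorem act_Et (i : Fin n) : D.act (D.E i * D.Kinv i) = D.opEt i := by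
  rw [map_mul, act_E, act_Kinv, opE, mul_assoc, opK_mul_opKinv, mul_one]

/-! ### The group-like elements -/

/-- `K_i` as a unit. -/
def Kunit (i : Fin n) : D.Uˣ := ⟨D.K i, D.Kinv i, D.K_mul_Kinv i, D.Kinv_mul_K i⟩

theorem Kunit_commute : Pairwise fun i j => ∀ x y : Multiplicative ℤ,
    Commute (zpowersHom D.Uˣ (D.Kunit i) x) (zpowersHom D.Uˣ (D.Kunit j) y) := by
  intro i j _ x y
  have h : Commute (D.Kunit i) (D.Kunit j) := Units.ext (D.K_comm i j)
  simpa using (h.zpow_left _).zpow_right _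

/-- The homomorphism from `ℤⁿ` with `α_i ↦ K_i`. -/
def KpowHom : (Fin n → Multiplicative ℤ) →* D.Uˣ :=
  MonoidHom.noncommPiCoprod (fun i => zpowersHom D.Uˣ (D.Kunit i)) D.Kunit_commute

/-- The element `K^l` for `l ∈ ℤⁿ`. -/
def Kpow (l : Fin n → ℤ) : D.U := (D.KpowHom fun i => Multiplicative.ofAdd (l i) : D.Uˣ)

@[simp] theorem Kpow_zero : D.Kpow 0 = 1 := by
  have : (fun i : Fin n => Multiplicative.ofAdd ((0 : Fin n → ℤ) i)) = 1 := rfl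
  rw [Kpow, this, map_one, Units.val_one]

theorem Kpow_add (l m : Fin n → ℤ) : D.Kpow (l + m) = D.Kpow l * D.Kpow m := by
  rw [Kpow, Kpow, Kpow, ← Units.val_mul, ← map_mul]
  rfl

theorem Kpow_α (i : Fin n) : D.Kpow (α i) = D.K i := by
  have : (fun j => Multiplicative.ofAdd (α i j)) = Pi.mulSingle i (Multiplicative.ofAdd (1 : ℤ)) := by
    ext j
    by_cases h : j = i
    · subst h
      simp [α]
    · simp [α, h]
  rw [Kpow, this, KpowHom, MonoidHom.noncommPiCoprod_mulSingle]
  simp [Kunit]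

theorem Kpow_neg_α (i : Fin n) : D.Kpow (-α i) = D.Kinv i := by
  have h : D.Kpow (-α i) * D.K i = 1 := by
    rw [← Kpow_α, ← Kpow_add, neg_add_cancel, Kpow_zero]
  exact left_inv_eq_right_inv h (D.K_mul_Kinv i)

theorem Kpow_comm (l m : Fin n → ℤ) : D.Kpow l * D.Kpow m = D.Kpow m * D.Kpow l := by
  rw [← Kpow_add, add_comm, Kpow_add]

theorem Kpow_sub_α (l : Fin n → ℤ) (i : Fin n) : D.Kpow (l - α i) = D.Kpow l * D.Kinv i := by
  rw [sub_eq_add_neg, Kpow_add, Kpow_neg_α]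

theorem Kpow_add_α (l : Fin n → ℤ) (i : Fin n) : D.Kpow (l + α i) = D.Kpow l * D.K i := by
  rw [Kpow_add, Kpow_α]

theorem Kinv_comm (i j : Fin n) : D.Kinv i * D.Kinv j = D.Kinv j * D.Kinv i := by
  rw [← Kpow_neg_α, ← Kpow_neg_α, Kpow_comm]

theorem χ_sub_α (a l : Fin n → ℤ) (i : Fin n) :
    (D.χ a (l - α i) : k) * D.χ a (α i) = D.χ a l := by
  rw [← Units.val_mul, ← D.χ_add_right, sub_add_cancel]

theorem F_mul_Kpow (j : Fin n) (l : Fin n → ℤ) :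
    D.F j * D.Kpow l = (D.χ (α j) l : k) • (D.Kpow l * D.F j) := by
  induction l using lattice_induction with
  | h0 => simp [χ_zero_right]
  | hadd i l ih =>
    rw [Kpow_add_α, ← mul_assoc, ih, smul_mul_assoc, mul_assoc, F_mul_K, mul_smul_comm, smul_smul,
      D.χ_add_right, mul_assoc, Units.val_mul, D.q_symm i j, q]
  | hsub i l ih =>
    rw [Kpow_sub_α, ← mul_assoc, ih, smul_mul_assoc, mul_assoc, mul_assoc, Kinv_mul_F,
      mul_smul_comm, smul_smul, ← D.χ_sub_α _ l i, D.q_symm i j, q]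

theorem Kpow_mul_E (j : Fin n) (l : Fin n → ℤ) :
    D.Kpow l * D.E j = (D.χ (α j) l : k) • (D.E j * D.Kpow l) := by
  induction l using lattice_induction with
  | h0 => simp [χ_zero_right]
  | hadd i l ih =>
    rw [Kpow_add_α, mul_assoc, K_mul_E, mul_smul_comm, ← mul_assoc, ih, smul_mul_assoc, smul_smul,
      D.χ_add_right, mul_assoc, Units.val_mul, D.q_symm i j, q, mul_comm (D.χ (α j) l : k)]
  | hsub i l ih =>
    have h : D.Kinv i * D.E j = (D.χ (α j) (α i) : k)⁻¹ • (D.E j * D.Kinv i) := by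
      rw [E_mul_Kinv, D.q_symm i j, q, smul_smul, inv_mul_cancel₀ (Units.ne_zero _), one_smul]
    rw [Kpow_sub_α, mul_assoc, h, mul_smul_comm, ← mul_assoc, ih, smul_mul_assoc, smul_smul,
      ← D.χ_sub_α _ l i, mul_assoc, mul_comm (D.χ (α j) (l - α i) : k), inv_mul_cancel_left₀ 
        (Units.ne_zero _)]

theorem act_Kpow_vec (l m : Fin n → ℤ) (a u : T k n) :
    D.act (D.Kpow l) (D.vec m a u) =
      D.vec (m + l) (torus (fun i => D.χ (α i) l) a) u := by
  induction l using lattice_induction generalizing m a with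
  | h0 =>
    have : (fun i : Fin n => D.χ (α i) 0) = 1 := by
      ext i
      simp [χ_zero_right]
    simp [this]
  | hadd i l ih =>
    have : (fun j => D.χ (α j) l) * D.q i = fun j => D.χ (α j) (l + α i) := by
      ext j
      simp [D.χ_add_right, q, D.χ_symm i j]
    rw [Kpow_add_α, map_mul, Module.End.mul_apply, act_K, opK_vec, ih, torus_torus, this,
      add_right_comm, add_assoc]
  | hsub i l ih =>
    have : (fun j => D.χ (α j) l) * (D.q i)⁻¹ = fun j => D.χ (α j) (l - α i) := by
      ext j
      refine congrArg Units.val ?_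
      rw [Pi.mul_apply, Pi.inv_apply, mul_inv_eq_iff_eq_mul, D.q_symm, q, ← D.χ_add_right,
        sub_add_cancel]
    rw [Kpow_sub_α, map_mul, Module.End.mul_apply, act_Kinv, opKinv_vec, ih, torus_torus, this,
      add_comm m (l - α i), sub_add_eq_add_sub, sub_add_eq_add_sub, add_comm l m]

/-! ### The lattice of `H_θ` -/

/-- The subgroup of `ℤⁿ` generated by the elements `α_i - α_{τ(i)}`. -/
def thetaLattice : AddSubgroup (Fin n → ℤ) :=
  AddSubgroup.closure (Set.range fun i => α i - α (D.τ i))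

/-- The height detects products with surplus factors K_i⁻¹. Since H_θ has height zero, it survives
when the K_i⁻¹ are set to zero. -/
theorem height_eq_zero {l : Fin n → ℤ} (hl : l ∈ D.thetaLattice) : height l = 0 := by
  induction hl using AddSubgroup.closure_induction with
  | mem l h =>
    obtain ⟨i, rfl⟩ := h
    simp [height_sub]
  | zero => simp
  | add l m _ _ hl hm => rw [height_add, hl, hm, add_zero]
  | neg l _ hl => rw [← zero_sub, height_sub, hl, height_zero, sub_zero]

/-- This makes F_i and E_{τ(i)} K_i⁻¹ commute with H_θ by the same character, so that B_i is an
eigenvector. On a generator it follows from q_{τ(i)τ(j)} = q_{ij} and q_{τ(i)j} = q_{iτ(j)}. -/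
theorem χ_τ_mul {l : Fin n → ℤ} (hl : l ∈ D.thetaLattice) (i : Fin n) :
    D.χ (α (D.τ i)) l * D.χ (α i) l = 1 := by
  have h0 : ∀ a l, D.χ a (-l) = (D.χ a l)⁻¹ := fun a l => by
    rw [eq_inv_iff_mul_eq_one, ← D.χ_add_right, neg_add_cancel, χ_zero_right]
  induction hl using AddSubgroup.closure_induction with
  | mem l h =>
    obtain ⟨j, rfl⟩ := h
    simp only [sub_eq_add_neg, D.χ_add_right, h0]
    have h1 : D.χ (α (D.τ i)) (α (D.τ j)) = D.χ (α i) (α j) := D.q_τ i j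
    have h2 : D.χ (α (D.τ i)) (α j) = D.χ (α i) (α (D.τ j)) := D.q_τ_left i j
    rw [h1, h2, mul_comm (D.χ (α i) (α j)), ← mul_assoc, mul_assoc (D.χ (α i) (α (D.τ j)))]
    simp
  | zero => simp [χ_zero_right]
  | add l m _ _ hl hm => rw [D.χ_add_right, D.χ_add_right, mul_mul_mul_comm, hl, hm, one_mul]
  | neg l _ hl => rw [h0, h0, ← mul_inv, hl, inv_one]

theorem Kpow_theta_gen (i j : Fin n) : D.Kpow (α i - α j) = D.K i * D.Kinv j := by
  rw [Kpow_sub_α, Kpow_α]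

theorem Kpow_mem_Htheta {l : Fin n → ℤ} (hl : l ∈ D.thetaLattice) : D.Kpow l ∈ D.Htheta := by
  -- The inverse is carried along because H_θ is only generated as an algebra; K_i K_{τ(i)}⁻¹ has as
  -- inverse the generator with index τ(i).
  suffices h : D.Kpow l ∈ D.Htheta ∧ D.Kpow (-l) ∈ D.Htheta from h.1
  induction hl using AddSubgroup.closure_induction with
  | mem l h =>
    obtain ⟨i, rfl⟩ := h
    rw [neg_sub, Kpow_theta_gen, Kpow_theta_gen]
    refine ⟨Algebra.subset_adjoin ⟨i, rfl⟩, Algebra.subset_adjoin ⟨D.τ i, ?_⟩⟩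
    simp only [D.τ_invol]
  | zero => simp
  | add l m _ _ hl hm =>
    rw [neg_add, Kpow_add, Kpow_add]
    exact ⟨mul_mem hl.1 hm.1, mul_mem hl.2 hm.2⟩
  | neg l _ hl => rwa [neg_neg, and_comm]

theorem Htheta_eq_span : Subalgebra.toSubmodule D.Htheta =
    Submodule.span k {x | ∃ l ∈ D.thetaLattice, D.Kpow l = x} := by
  refine le_antisymm (fun x hx => ?_) (Submodule.span_le.2 ?_)
  · rw [Subalgebra.mem_toSubmodule] at hx
    induction hx using Algebra.adjoin_induction with
    | mem x h =>
      obtain ⟨i, rfl⟩ := h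
      exact Submodule.subset_span ⟨_, AddSubgroup.subset_closure ⟨i, rfl⟩, D.Kpow_theta_gen _ _⟩
    | algebraMap r =>
      rw [Algebra.algebraMap_eq_smul_one]
      exact Submodule.smul_mem _ _ (Submodule.subset_span ⟨0, zero_mem _, D.Kpow_zero⟩)
    | add x y _ _ hx hy => exact add_mem hx hy
    | mul x y _ _ hx hy =>
      have h := Submodule.mul_mem_mul hx hy
      rw [Submodule.span_mul_span] at h
      refine Submodule.span_mono ?_ h
      rintro _ ⟨_, ⟨l, hl, rfl⟩, _, ⟨m, hm, rfl⟩, rfl⟩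
      exact ⟨l + m, add_mem hl hm, D.Kpow_add l m⟩
  · rintro _ ⟨l, hl, rfl⟩
    exact D.Kpow_mem_Htheta hl

theorem Htheta_induction (S : Submodule k D.U) (h : ∀ l ∈ D.thetaLattice, D.Kpow l ∈ S) {x : D.U}
    (hx : x ∈ D.Htheta) : x ∈ S := by
  have h1 : x ∈ Subalgebra.toSubmodule D.Htheta := hx
  rw [Htheta_eq_span] at h1
  have h2 : Submodule.span k {x | ∃ l ∈ D.thetaLattice, D.Kpow l = x} ≤ S :=
    Submodule.span_le.2 fun _ ⟨l, hl, hx⟩ => hx ▸ h l hl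
  exact h2 h1

/-! ### A representation of the Heisenberg double -/

/-- The span of the vectors `a K^l u` with `height l ≤ m`. -/
def heightLE (m : ℤ) : Submodule k D.Tri :=
  Submodule.span k {v | ∃ l a u, height l ≤ m ∧ D.vec l a u = v}

theorem vec_mem_heightLE {m : ℤ} {l : Fin n → ℤ} (h : height l ≤ m) (a u : T k n) :
    D.vec l a u ∈ D.heightLE m :=
  Submodule.subset_span ⟨l, a, u, h, rfl⟩

theorem heightLE_mono {m m' : ℤ} (h : m ≤ m') : D.heightLE m ≤ D.heightLE m' :=
  Submodule.span_mono fun _ ⟨l, a, u, hl, hv⟩ => ⟨l, a, u, hl.trans h, hv⟩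

theorem act_mem_heightLE {m m' : ℤ} {f : Module.End k D.Tri}
    (h : ∀ l a u, height l ≤ m → f (D.vec l a u) ∈ D.heightLE m') {v : D.Tri}
    (hv : v ∈ D.heightLE m) : f v ∈ D.heightLE m' := by
  have : D.heightLE m ≤ (D.heightLE m').comap f := by
    refine Submodule.span_le.2 ?_
    rintro _ ⟨l, a, u, hl, rfl⟩
    exact h l a u hl
  exact this hv

theorem opKinv_mem_heightLE (i : Fin n) {m : ℤ} {v : D.Tri} (hv : v ∈ D.heightLE m) :
    D.opKinv i v ∈ D.heightLE (m - 1) := by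
  refine D.act_mem_heightLE (fun l a u hl => ?_) hv
  rw [opKinv_vec]
  exact D.vec_mem_heightLE (by rw [height_sub, height_α]; omega) _ _

/-- F_i changes the height by 0 or -2, K_i⁻¹ by -1, and the remaining generators preserve it. The
only generators of U(χ) that raise it, E_i and K_i, enter `Upoly` through products with some K_j⁻¹.
-/
theorem Upoly_mem_heightLE {x : D.U} (hx : x ∈ D.Upoly) :
    ∀ m, ∀ v ∈ D.heightLE m, D.act x v ∈ D.heightLE m := by
  induction hx using Algebra.adjoin_induction with
  | mem x h =>
    intro m v hv
    rcases h with ((⟨i, rfl⟩ | ⟨i, rfl⟩) | ⟨i, rfl⟩) | ⟨i, rfl⟩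
    · rw [act_F]
      refine D.act_mem_heightLE (fun l a u hl => ?_) hv
      rw [opF_vec]
      exact add_mem (sub_mem (Submodule.smul_mem _ _ (D.vec_mem_heightLE hl _ _))
        (D.vec_mem_heightLE hl _ _))
        (D.vec_mem_heightLE (by simp only [height_sub, height_α]; omega) _ _)
    · simp only [act_Et]
      refine D.act_mem_heightLE (fun l a u hl => ?_) hv
      rw [opEt_vec]
      exact D.vec_mem_heightLE hl _ _
    · rw [act_Kinv]
      exact D.heightLE_mono (by omega) (D.opKinv_mem_heightLE i hv)
    · simp only [← Kpow_theta_gen]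
      refine D.act_mem_heightLE (fun l a u hl => ?_) hv
      rw [act_Kpow_vec]
      exact D.vec_mem_heightLE (by simp only [height_add, height_sub, height_α]; omega) _ _
  | algebraMap r =>
    intro m v hv
    rw [AlgHom.commutes]
    exact Submodule.smul_mem _ r hv
  | add x y _ _ hx hy =>
    intro m v hv
    rw [map_add]
    exact add_mem (hx m v hv) (hy m v hv)
  | mul x y _ _ hx hy =>
    intro m v hv
    rw [map_mul]
    exact hx m _ (hy m v hv)

/-- The elements of `U(χ)^poly` which act with degree at most `-1` for the filtration by height. -/
def heightIdeal : TwoSidedIdeal D.Upoly :=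
  TwoSidedIdeal.mk' {x | ∀ m, ∀ v ∈ D.heightLE m, D.act x v ∈ D.heightLE (m - 1)}
    (fun m v _ => by simp)
    (fun {x y} hx hy m v hv => by
      simpa using add_mem (hx m v hv) (hy m v hv))
    (fun {x} hx m v hv => by
      simpa using hx m v hv)
    (fun {x y} hy m v hv => by
      simpa using D.Upoly_mem_heightLE x.2 _ _ (hy m v hv))
    (fun {x y} hx m v hv => by
      simpa using hx m _ (D.Upoly_mem_heightLE y.2 _ _ hv))

/-- The elements that lower the height form a two-sided ideal containing every K_i⁻¹, hence
containing the kernel of κ. -/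
theorem act_mem_of_κ_eq_zero {x : D.Upoly} (hx : D.κ x = 0) {m : ℤ} {v : D.Tri}
    (hv : v ∈ D.heightLE m) : D.act x v ∈ D.heightLE (m - 1) := by
  have hmem : ∀ y : D.Upoly, y ∈ D.heightIdeal ↔
      ∀ m, ∀ v ∈ D.heightLE m, D.act y v ∈ D.heightLE (m - 1) := fun y =>
    TwoSidedIdeal.mem_mk' ..
  have hrel : ∀ ⦃x y⦄, D.HeisRel x y →
      D.heightIdeal.ringCon.mk' x = D.heightIdeal.ringCon.mk' y := by
    rintro _ _ ⟨i⟩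
    refine (RingCon.eq _).2 ((TwoSidedIdeal.mem_iff _ _).1 ((hmem _).2 fun m v hv => ?_))
    simpa using D.opKinv_mem_heightLE i hv
  have h1 : RingQuot.mkRingHom D.HeisRel x = 0 := by
    rw [← RingQuot.mkAlgHom_coe k D.HeisRel]
    exact hx
  -- The quotient by `heightIdeal` satisfies the relations of Heis(χ), so the projection to it
  -- factors through κ.
  have h2 := RingQuot.lift_mkRingHom_apply D.heightIdeal.ringCon.mk' hrel x
  rw [h1, map_zero] at h2
  exact (hmem x).1 ((TwoSidedIdeal.mem_iff _ _).2 ((RingCon.eq _).1 h2.symm)) m v hv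

/-- The projection onto the summands of height zero. -/
def res : Module.End k D.Tri :=
  D.triLift fun l => if height l = 0 then D.triSingle l else 0

theorem res_vec (l : Fin n → ℤ) (a u : T k n) :
    D.res (D.vec l a u) = if height l = 0 then D.vec l a u else 0 := by
  rw [res, triLift_vec]
  split_ifs <;> rfl

theorem κ_surjective : Function.Surjective D.κ := RingQuot.mkAlgHom_surjective k _

theorem res_act_eq_zero {x : D.Upoly} (hx : D.κ x = 0) :
    D.res (D.act x (D.vec 0 1 1)) = 0 := by
  have h1 : D.act x (D.vec 0 1 1) ∈ D.heightLE (-1) :=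
    D.act_mem_of_κ_eq_zero (m := 0) hx (D.vec_mem_heightLE (by simp) _ _)
  have h2 : D.heightLE (-1) ≤ LinearMap.ker D.res := by
    refine Submodule.span_le.2 ?_
    rintro _ ⟨l, a, u, hl, rfl⟩
    rw [SetLike.mem_coe, LinearMap.mem_ker, res_vec, if_neg (by omega)]
  exact h2 h1

/-- The linear map `Heis(χ) → Tri` with `κ(x) ↦ res(x · 1)`. -/
def heisVec : D.Heis →ₗ[k] D.Tri :=
  (LinearMap.ker D.κ.toLinearMap).liftQ
      (D.res ∘ₗ LinearMap.applyₗ (D.vec 0 1 1) ∘ₗ D.act.toLinearMap ∘ₗ D.Upoly.val.toLinearMap)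
      (fun _ hx => D.res_act_eq_zero hx) ∘ₗ
    (LinearMap.quotKerEquivOfSurjective D.κ.toLinearMap D.κ_surjective).symm.toLinearMap

theorem heisVec_κ (x : D.Upoly) : D.heisVec (D.κ x) = D.res (D.act x (D.vec 0 1 1)) := by
  have : (LinearMap.quotKerEquivOfSurjective D.κ.toLinearMap D.κ_surjective).symm (D.κ x) =
      Submodule.Quotient.mk x := by
    rw [LinearEquiv.symm_apply_eq]
    rfl
  simp only [heisVec, LinearMap.coe_comp, Function.comp_apply, LinearEquiv.coe_coe, this]
  rfl

/-- Equivariance is available only for operators that commute with the projection to height zero.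
This covers Ẽ_i and H_θ, but not F_i, whose last term lowers the height by two. -/
theorem heisVec_κ_mul {x : D.Upoly} (hx : D.act x * D.res = D.res * D.act x) (y : D.Heis) :
    D.heisVec (D.κ x * y) = D.act x (D.heisVec y) := by
  obtain ⟨y, rfl⟩ := D.κ_surjective y
  rw [← map_mul, heisVec_κ, heisVec_κ, MulMemClass.coe_mul, map_mul]
  exact (DFunLike.congr_fun hx _).symm

theorem opEt_mul_res (i : Fin n) : D.opEt i * D.res = D.res * D.opEt i :=
  D.Tri_ext fun l a u => by
    simp only [Module.End.mul_apply, opEt_vec, res_vec]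
    split_ifs <;> simp

theorem act_Kpow_mul_res {l : Fin n → ℤ} (hl : l ∈ D.thetaLattice) :
    D.act (D.Kpow l) * D.res = D.res * D.act (D.Kpow l) :=
  D.Tri_ext fun m a u => by
    simp only [Module.End.mul_apply, act_Kpow_vec, res_vec, height_add, D.height_eq_zero hl,
      add_zero]
    split_ifs <;> simp [act_Kpow_vec]

/-! ### Relations in the Heisenberg double -/

/-- `κ(F_i)`. -/
def heisF (i : Fin n) : D.Heis := D.κ ⟨D.F i, D.F_mem_Upoly i⟩

/-- `κ(E_i K_i⁻¹)`. -/
def heisE (i : Fin n) : D.Heis := D.κ ⟨D.E i * D.Kinv i, D.Etilde_mem_Upoly i⟩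

theorem EKinv_mem_Upoly (c : Fin n → k) (i : Fin n) :
    c i • (D.E (D.τ i) * D.Kinv i) ∈ D.Upoly := by
  have h := sub_mem (D.B_mem_Upoly c i) (D.F_mem_Upoly i)
  rwa [B, add_sub_cancel_left] at h

/-- `κ(c_i E_{τ(i)} K_i⁻¹)`. -/
def heisY (c : Fin n → k) (i : Fin n) : D.Heis := D.κ ⟨_, D.EKinv_mem_Upoly c i⟩

/-- The restriction of `κ` to `H_θ`. -/
def heisH : D.Htheta →ₐ[k] D.Heis := D.κ.comp (Subalgebra.inclusion D.Htheta_le_Upoly)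

/-- `κ(K^l)` for `l` in the lattice of `H_θ`. -/
def heisK (l : D.thetaLattice) : D.Heis := D.heisH ⟨D.Kpow l, D.Kpow_mem_Htheta l.2⟩

/-- `B̄_i`. -/
def heisB (c : Fin n → k) (i : Fin n) : D.Heis := D.κ ⟨D.B c i, D.B_mem_Upoly c i⟩

theorem heisB_eq (c : Fin n → k) (i : Fin n) : D.heisB c i = D.heisF i + D.heisY c i := by
  rw [heisB, heisF, heisY, ← map_add]
  rfl

theorem κ_Kinv (i : Fin n) : D.κ ⟨D.Kinv i, D.Kinv_mem_Upoly i⟩ = 0 := by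
  simpa using! RingQuot.mkAlgHom_rel k (HeisRel.Kinv (D := D) i)

theorem lift_κ_eq_zero {Z : Fin n → D.Upoly} {p : T k n}
    (h : FreeAlgebra.lift k (fun i => (Z i : D.U)) p = 0) :
    FreeAlgebra.lift k (fun i => D.κ (Z i)) p = 0 := by
  have h1 : D.Upoly.val.comp (FreeAlgebra.lift k Z) =
      FreeAlgebra.lift k fun i => (Z i : D.U) := by
    ext i
    simp
  have h2 : D.κ.comp (FreeAlgebra.lift k Z) = FreeAlgebra.lift k fun i => D.κ (Z i) := by
    ext i
    simp
  have h3 : FreeAlgebra.lift k Z p = 0 := by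
    refine Subtype.ext ?_
    rw [← h1] at h
    exact h
  rw [← h2, AlgHom.comp_apply, h3, map_zero]

theorem lift_heisF_eq_zero {p : T k n} (hp : p ∈ D.I) : FreeAlgebra.lift k D.heisF p = 0 :=
  D.lift_κ_eq_zero (D.lift_F_eq_zero hp)

theorem Kinv_mul_E (i j : Fin n) :
    D.Kinv i * D.E j = (((D.q i j)⁻¹ : kˣ) : k) • (D.E j * D.Kinv i) := by
  rw [E_mul_Kinv, smul_smul, Units.inv_mul, one_smul]

theorem lift_heisE_eq_zero {p : T k n} (hp : p ∈ D.I) : FreeAlgebra.lift k D.heisE p = 0 :=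
  D.lift_κ_eq_zero (D.lift_twist_eq_zero (Z := D.E) (L := D.Kinv)
    (s := fun i j => (((D.q i j)⁻¹ : kˣ) : k)) (fun i j => by rw [D.q_symm])
    (fun i j => D.Kinv_comm i j) D.Kinv_mul_E (fun _ hp => D.lift_E_eq_zero hp) hp)

/-- The condition τ(I) = I gives p(E_{τ(1)}, …, E_{τ(n)}) = 0, and the factors c_i K_i⁻¹ are a twist
by a symmetric matrix. -/
theorem lift_heisY_eq_zero (c : Fin n → k) {p : T k n} (hp : p ∈ D.I) :
    FreeAlgebra.lift k (D.heisY c) p = 0 := by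
  refine D.lift_κ_eq_zero ?_
  have h := D.lift_twist_eq_zero (Z := fun i => D.E (D.τ i)) (L := fun i => c i • D.Kinv i)
    -- Moving K_i⁻¹ past E_{τ(j)} costs q_{iτ(j)}⁻¹; this is symmetric because q_{iτ(j)} =
    -- q_{τ(i)j}.
    (s := fun i j => (((D.q i (D.τ j))⁻¹ : kˣ) : k))
    (fun i j => by rw [← D.q_τ_left, D.q_symm])
    (fun i j => (Commute.smul_left (D.Kinv_comm i j) _).smul_right _)
    (fun i j => by
      rw [smul_mul_assoc, Kinv_mul_E, mul_smul_comm, smul_comm]) (fun p hp => ?_) hp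
  · simpa only [mul_smul_comm] using h
  · have h1 : (FreeAlgebra.lift k D.E).comp
        (FreeAlgebra.lift k fun i => FreeAlgebra.ι k (D.τ i)) =
        FreeAlgebra.lift k fun i => D.E (D.τ i) := by
      ext i
      simp
    rw [← h1, AlgHom.comp_apply]
    exact D.lift_E_eq_zero ((D.I_τ p).2 hp)

theorem heisK_add (l m : D.thetaLattice) : D.heisK (l + m) = D.heisK l * D.heisK m := by
  rw [heisK, heisK, heisK, ← map_mul]
  congr 1
  exact Subtype.ext (D.Kpow_add _ _)

@[simp] theorem heisK_zero : D.heisK 0 = 1 := by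
  rw [heisK, ← map_one D.heisH]
  congr 1
  exact Subtype.ext D.Kpow_zero

theorem heisF_mul_heisK (j : Fin n) (l : D.thetaLattice) :
    D.heisF j * D.heisK l = (D.χ (α j) l : k) • (D.heisK l * D.heisF j) := by
  rw [heisF, heisK, heisH, AlgHom.comp_apply, ← map_mul, ← map_mul, ← map_smul]
  congr 1
  exact Subtype.ext (D.F_mul_Kpow j l)

/-- Moving K^l past E_{τ(j)} to the left costs χ(α_{τ(j)}, l)⁻¹, which equals χ(α_j, l) by
`χ_τ_mul`. -/
theorem heisY_mul_heisK (c : Fin n → k) (j : Fin n) (l : D.thetaLattice) :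
    D.heisY c j * D.heisK l = (D.χ (α j) l : k) • (D.heisK l * D.heisY c j) := by
  rw [heisY, heisK, heisH, AlgHom.comp_apply, ← map_mul, ← map_mul, ← map_smul]
  congr 1
  refine Subtype.ext ?_
  change c j • (D.E (D.τ j) * D.Kinv j) * D.Kpow l =
    (D.χ (α j) l : k) • (D.Kpow l * c j • (D.E (D.τ j) * D.Kinv j))
  have h1 : D.Kinv j * D.Kpow l = D.Kpow l * D.Kinv j := by
    rw [← Kpow_neg_α, Kpow_comm]
  have h2 : (D.χ (α j) l : k) * D.χ (α (D.τ j)) l = 1 := by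
    rw [mul_comm, ← Units.val_mul, D.χ_τ_mul l.2, Units.val_one]
  rw [smul_mul_assoc, mul_assoc, h1, mul_smul_comm, ← mul_assoc, ← mul_assoc, Kpow_mul_E,
    smul_mul_assoc, smul_comm (c j), smul_smul, h2, one_smul]

theorem heisB_mul_heisK (c : Fin n → k) (j : Fin n) (l : D.thetaLattice) :
    D.heisB c j * D.heisK l = (D.χ (α j) l : k) • (D.heisK l * D.heisB c j) := by
  rw [heisB_eq, add_mul, heisF_mul_heisK, heisY_mul_heisK, mul_add, smul_add]

/-- The element `α_{τ(i)} - α_i` of the lattice of `H_θ`. -/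
def thetaGen (i : Fin n) : D.thetaLattice :=
  ⟨α (D.τ i) - α i, AddSubgroup.subset_closure ⟨D.τ i, by simp only [D.τ_invol]⟩⟩

/-- This is where the Heisenberg double is simpler than U(χ). For j = τ(i) the commutator
contributes (K_j - K_j⁻¹) K_i⁻¹; the first part lies in H_θ, and κ kills the second. -/
theorem heisY_mul_heisF (c : Fin n → k) (i j : Fin n) :
    D.heisY c i * D.heisF j = (D.q i j : k) • (D.heisF j * D.heisY c i) +
      if D.τ i = j then (c i * D.q i (D.τ i)) • D.heisK (D.thetaGen i) else 0 := by
  have hU : c i • (D.E (D.τ i) * D.Kinv i) * D.F j =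
      (D.q i j : k) • (D.F j * c i • (D.E (D.τ i) * D.Kinv i)) +
      if D.τ i = j then (c i * D.q i (D.τ i)) • (D.Kpow (α (D.τ i) - α i) -
        D.Kinv j * D.Kinv i) else 0 := by
    rw [smul_mul_assoc, mul_assoc, Kinv_mul_F, mul_smul_comm, ← mul_assoc, E_mul_F, add_mul,
      mul_smul_comm, smul_comm (c i), smul_add, smul_add, mul_assoc]
    split_ifs with h
    · subst h
      rw [Kpow_theta_gen, sub_mul, mul_smul, smul_comm (c i)]
    · simp
  by_cases h : D.τ i = j
  · rw [if_pos h] at hU ⊢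
    have h2 : D.heisY c i * D.heisF j = (D.q i j : k) • (D.heisF j * D.heisY c i) +
        (c i * D.q i (D.τ i)) • (D.heisK (D.thetaGen i) -
          D.κ ⟨D.Kinv j, D.Kinv_mem_Upoly j⟩ * D.κ ⟨D.Kinv i, D.Kinv_mem_Upoly i⟩) := by
      simp only [heisY, heisF, heisK, heisH, AlgHom.comp_apply, ← map_mul, ← map_smul, ← map_add,
        ← map_sub]
      congr 1
      exact Subtype.ext hU
    rw [h2, κ_Kinv, zero_mul, sub_zero]
  · rw [if_neg h, add_zero] at hU ⊢
    simp only [heisY, heisF, ← map_mul, ← map_smul]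
    congr 1
    exact Subtype.ext hU

/-- The scalar in the commutator of `heisY c i` and `heisF (τ i)`. -/
def commScalar (c : Fin n → k) (i : Fin n) : k := c i * D.q i (D.τ i)

/-- With only the K_j half of the commutator left, only the left skew derivation appears. -/
theorem heisY_mul_lift_heisF (c : Fin n → k) (i : Fin n) (a : T k n) :
    D.heisY c i * FreeAlgebra.lift k D.heisF a =
      FreeAlgebra.lift k D.heisF (torus (D.q i) a) * D.heisY c i +
        D.commScalar c i • (D.heisK (D.thetaGen i) *
          FreeAlgebra.lift k D.heisF (leftDer D.q (D.τ i) a)) := by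
  -- The factor from moving F_j past K_{τ(i)} K_i⁻¹ turns q_{ij} into q_{jτ(i)}, the coefficient in
  -- the Leibniz rule of the derivation with index τ(i).
  have hX : ∀ j, (D.q i j : k) • (D.heisF j * D.heisK (D.thetaGen i)) =
      (D.q j (D.τ i) : k) • (D.heisK (D.thetaGen i) * D.heisF j) := by
    intro j
    rw [heisF_mul_heisK, smul_smul, D.q_symm i j, q, ← Units.val_mul, mul_comm,
      ← D.χ_add_right]
    simp only [thetaGen, sub_add_cancel, q]
  have : LinearMap.mulLeft k (D.heisY c i) ∘ₗ (FreeAlgebra.lift k D.heisF).toLinearMap =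
      LinearMap.mulRight k (D.heisY c i) ∘ₗ (FreeAlgebra.lift k D.heisF).toLinearMap ∘ₗ
        (torus (D.q i)).toLinearMap +
      D.commScalar c i • (LinearMap.mulLeft k (D.heisK (D.thetaGen i)) ∘ₗ
        (FreeAlgebra.lift k D.heisF).toLinearMap ∘ₗ leftDer D.q (D.τ i)) := by
    refine T_linearMap_ext (by simp) fun j x hx => ?_
    simp only [LinearMap.coe_comp, Function.comp_apply, AlgHom.toLinearMap_apply,
      LinearMap.mulLeft_apply, LinearMap.mulRight_apply, LinearMap.add_apply,
      LinearMap.smul_apply] at hx ⊢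
    simp only [map_mul, FreeAlgebra.lift_ι_apply, leftDer_ι_mul, map_add, map_smul, torus_ι,
      mul_add, smul_mul_assoc]
    rw [← mul_assoc, heisY_mul_heisF, add_mul, smul_mul_assoc, mul_assoc, hx, mul_add, smul_add,
      mul_smul_comm (D.commScalar c i), smul_comm (D.q i j : k) (D.commScalar c i),
      ← mul_assoc (D.heisF j) (D.heisK _), ← smul_mul_assoc (D.q i j : k) (D.heisF j * _), hX,
      mul_smul_comm, smul_add]
    by_cases h : D.τ i = j
    · simp only [if_pos h, smul_mul_assoc, mul_assoc, commScalar]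
      abel
    · simp only [if_neg h, zero_mul, map_zero, mul_zero, smul_zero, zero_add, add_zero,
        smul_mul_assoc, mul_assoc]
  exact DFunLike.congr_fun this a

/-! ### Quantization of polynomials in the `F_i` -/

/-- The normal ordering `a ⊗ b ↦ a(F) b(Y)`. -/
def normalOrder (c : Fin n → k) : T k n ⊗[k] T k n →ₗ[k] D.Heis :=
  LinearMap.mul' k D.Heis ∘ₗ TensorProduct.map (FreeAlgebra.lift k D.heisF).toLinearMap
    (FreeAlgebra.lift k (D.heisY c)).toLinearMap

theorem normalOrder_tmul (c : Fin n → k) (a b : T k n) :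
    D.normalOrder c (a ⊗ₜ b) =
      FreeAlgebra.lift k D.heisF a * FreeAlgebra.lift k (D.heisY c) b := by
  simp [normalOrder]

/-- Up to the derivation term, F_i a(F) b(Y) and (K_i · a)(F) Y_i b(Y) are the two summands of
`primitiveMul`: the commutation of Y_i past the F_j is exactly the braiding of T ⊗ T. -/
theorem heisB_mul_normalOrder (c : Fin n → k) (i : Fin n) (t : T k n ⊗[k] T k n) :
    D.heisB c i * D.normalOrder c t = D.normalOrder c (primitiveMul D.q i t) +
      D.commScalar c i • (D.heisK (D.thetaGen i) *
        D.normalOrder c ((leftDer D.q (D.τ i)).rTensor (T k n) t)) := by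
  induction t with
  | zero => simp
  | add s t hs ht =>
    simp only [map_add, mul_add, hs, ht, smul_add]
    abel
  | tmul a b =>
    rw [primitiveMul_tmul, LinearMap.rTensor_tmul, map_add]
    simp only [normalOrder_tmul, map_mul, FreeAlgebra.lift_ι_apply, heisB_eq, add_mul]
    rw [← mul_assoc (D.heisY c i), heisY_mul_lift_heisF, add_mul]
    simp only [mul_assoc, smul_mul_assoc]
    abel

/-- The map `T → B̄_c` which sends `x` to the normal ordering of `Δ(x)`; its value differs from
`x(B̄_1, …, B̄_n)` by terms of lower degree. -/
def quantize (c : Fin n → k) : T k n →ₗ[k] D.Heis := D.normalOrder c ∘ₗ braidedCoproduct D.q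

@[simp] theorem quantize_one (c : Fin n → k) : D.quantize c 1 = 1 := by
  simp [quantize, normalOrder_tmul]

/-- The correction differentiates only the left leg of Δ(x), and leftDer ⊗ id commutes with Δ, so
the correction is again a value of `quantize`. -/
theorem heisB_mul_quantize (c : Fin n → k) (i : Fin n) (x : T k n) :
    D.heisB c i * D.quantize c x = D.quantize c (FreeAlgebra.ι k i * x) +
      D.commScalar c i • (D.heisK (D.thetaGen i) *
        D.quantize c (leftDer D.q (D.τ i) x)) := by
  simp only [quantize, LinearMap.coe_comp, Function.comp_apply, braidedCoproduct_ι_mul,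
    heisB_mul_normalOrder, leftDer_braidedCoproduct]

/-- In each summand of Δ(x) one leg lies in I. A left leg vanishes on the F_i, a right leg on the
Y_i. -/
theorem quantize_eq_zero (c : Fin n → k) {x : T k n} (hx : x ∈ D.I) : D.quantize c x = 0 := by
  have : coidealSum D.I ≤ LinearMap.ker (D.normalOrder c) := by
    refine Submodule.span_le.2 ?_
    rintro _ ⟨a, b, h, rfl⟩
    rw [SetLike.mem_coe, LinearMap.mem_ker, normalOrder_tmul]
    rcases h with h | h
    · rw [D.lift_heisF_eq_zero h, zero_mul]
    · rw [D.lift_heisY_eq_zero c h, mul_zero]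
  exact this (D.I_coideal x hx)

/-! ### The filtration by degree in the Heisenberg double -/

/-- The product of the generators `B̄_i` and `κ(h)` along a word. -/
def heisWord (c : Fin n → k) (w : List (Fin n ⊕ D.Htheta)) : D.Heis :=
  (w.map fun g => (D.BbarGen c g : D.Heis)).prod

/-- The degree of a word. -/
def wordDegree (w : List (Fin n ⊕ D.Htheta)) : ℕ := (w.map D.genDegree).sum

@[simp] theorem wordDegree_nil : D.wordDegree [] = 0 := rfl

@[simp] theorem wordDegree_inl (i : Fin n) (w : List (Fin n ⊕ D.Htheta)) :
    D.wordDegree (.inl i :: w) = D.wordDegree w + 1 := by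
  simp [wordDegree, genDegree, add_comm]

@[simp] theorem wordDegree_inr (h : D.Htheta) (w : List (Fin n ⊕ D.Htheta)) :
    D.wordDegree (.inr h :: w) = D.wordDegree w := by
  simp [wordDegree, genDegree]

@[simp] theorem heisWord_nil (c : Fin n → k) : D.heisWord c [] = 1 := rfl

@[simp] theorem heisWord_inl (c : Fin n → k) (i : Fin n) (w : List (Fin n ⊕ D.Htheta)) :
    D.heisWord c (.inl i :: w) = D.heisB c i * D.heisWord c w := by
  simp only [heisWord, List.map_cons, List.prod_cons]
  rfl

@[simp] theorem heisWord_inr (c : Fin n → k) (h : D.Htheta) (w : List (Fin n ⊕ D.Htheta)) :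
    D.heisWord c (.inr h :: w) = D.heisH h * D.heisWord c w := by
  simp only [heisWord, List.map_cons, List.prod_cons]
  rfl

/-- The span of the words of degree less than `m`. -/
def filtLT (c : Fin n → k) (m : ℕ) : Submodule k D.Heis :=
  Submodule.span k {x | ∃ w, D.wordDegree w < m ∧ D.heisWord c w = x}

variable (c : Fin n → k)

theorem heisWord_mem_filtLT {w : List (Fin n ⊕ D.Htheta)} {m : ℕ} (h : D.wordDegree w < m) :
    D.heisWord c w ∈ D.filtLT c m :=
  Submodule.subset_span ⟨w, h, rfl⟩

theorem filtLT_mono {m m' : ℕ} (h : m ≤ m') : D.filtLT c m ≤ D.filtLT c m' :=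
  Submodule.span_mono fun _ ⟨w, hw, hx⟩ => ⟨w, by omega, hx⟩

theorem heisB_mul_mem_filtLT (i : Fin n) {m : ℕ} {x : D.Heis} (hx : x ∈ D.filtLT c m) :
    D.heisB c i * x ∈ D.filtLT c (m + 1) := by
  have : D.filtLT c m ≤ (D.filtLT c (m + 1)).comap (LinearMap.mulLeft k (D.heisB c i)) := by
    refine Submodule.span_le.2 ?_
    rintro _ ⟨w, hw, rfl⟩
    exact Submodule.subset_span ⟨.inl i :: w, by simpa using hw, by simp⟩
  exact this hx

theorem heisH_mul_mem_filtLT (h : D.Htheta) {m : ℕ} {x : D.Heis} (hx : x ∈ D.filtLT c m) :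
    D.heisH h * x ∈ D.filtLT c m := by
  have : D.filtLT c m ≤ (D.filtLT c m).comap (LinearMap.mulLeft k (D.heisH h)) := by
    refine Submodule.span_le.2 ?_
    rintro _ ⟨w, hw, rfl⟩
    exact Submodule.subset_span ⟨.inr h :: w, by simpa using hw, by simp⟩
  exact this hx

theorem quantize_ι_mul (i : Fin n) (x : T k n) :
    D.quantize c (FreeAlgebra.ι k i * x) = D.heisB c i * D.quantize c x -
      D.commScalar c i • (D.heisK (D.thetaGen i) *
        D.quantize c (leftDer D.q (D.τ i) x)) :=
  eq_sub_of_add_eq (D.heisB_mul_quantize c i x).symm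

theorem quantize_mem_filtLT {m : ℕ} {x : T k n} (hx : x ∈ degreeLT k n m) :
    D.quantize c x ∈ D.filtLT c m := by
  induction m generalizing x with
  | zero =>
    rw [degreeLT_zero, Submodule.mem_bot] at hx
    simp [hx]
  | succ m ih =>
    have : degreeLT k n (m + 1) ≤ (D.filtLT c (m + 1)).comap (D.quantize c) := by
      refine Submodule.span_le.2 ?_
      rintro _ ⟨w, hw, rfl⟩
      match w with
      | [] =>
        rw [SetLike.mem_coe, Submodule.mem_comap, monomial_nil, quantize_one]
        exact D.heisWord_mem_filtLT c (w := []) (by simp)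
      | i :: w =>
        have hw' : (monomial w : T k n) ∈ degreeLT k n m :=
          monomial_mem_degreeLT (by simpa using hw)
        rw [SetLike.mem_coe, Submodule.mem_comap, monomial_cons, quantize_ι_mul]
        exact sub_mem (D.heisB_mul_mem_filtLT c i (ih hw')) (D.filtLT_mono c (by omega)
          (Submodule.smul_mem _ _ (D.heisH_mul_mem_filtLT c _ (ih (leftDer_mem_degreeLT _ _ hw')))))
    exact this hx

theorem quantize_sub_lift_mem {m : ℕ} {x : T k n} (hx : x ∈ degreeLT k n (m + 1)) :
    D.quantize c x - FreeAlgebra.lift k (D.heisB c) x ∈ D.filtLT c m := by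
  have h : ∀ w : List (Fin n), D.quantize c (monomial w) -
      FreeAlgebra.lift k (D.heisB c) (monomial w) ∈ D.filtLT c w.length := by
    intro w
    induction w with
    | nil => simp
    | cons i w ih =>
      rw [monomial_cons, quantize_ι_mul, map_mul, FreeAlgebra.lift_ι_apply, sub_right_comm,
        ← mul_sub]
      refine sub_mem (D.heisB_mul_mem_filtLT c i ih) (Submodule.smul_mem _ _
        (D.heisH_mul_mem_filtLT c _ (D.quantize_mem_filtLT c ?_)))
      -- The word is one letter longer than w, so the correction only needs degree at most the
      -- length of w.
      exact leftDer_mem_degreeLT _ _ (monomial_mem_degreeLT (by simp))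
  have : degreeLT k n (m + 1) ≤ (D.filtLT c m).comap
      (D.quantize c - (FreeAlgebra.lift k (D.heisB c)).toLinearMap) := by
    refine Submodule.span_le.2 ?_
    rintro _ ⟨w, hw, rfl⟩
    exact D.filtLT_mono c (by omega) (h w)
  exact this hx

/-- The span of the elements `κ(K^l) quantize(u)` with `u` of degree less than `m`. -/
def quantLT (m : ℕ) : Submodule k D.Heis :=
  Submodule.span k {x | ∃ l, ∃ u ∈ degreeLT k n m, D.heisK l * D.quantize c u = x}

theorem quantLT_mono {m m' : ℕ} (h : m ≤ m') : D.quantLT c m ≤ D.quantLT c m' :=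
  Submodule.span_mono fun _ ⟨l, u, hu, hx⟩ => ⟨l, u, degreeLT_mono h hu, hx⟩

theorem heisH_mul_mem_quantLT (h : D.Htheta) {m : ℕ} {x : D.Heis} (hx : x ∈ D.quantLT c m) :
    D.heisH h * x ∈ D.quantLT c m := by
  have hK : ∀ l, D.heisK l * x ∈ D.quantLT c m := by
    intro l
    have : D.quantLT c m ≤ (D.quantLT c m).comap (LinearMap.mulLeft k (D.heisK l)) := by
      refine Submodule.span_le.2 ?_
      rintro _ ⟨l', u, hu, rfl⟩
      exact Submodule.subset_span ⟨l + l', u, hu, by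
        rw [heisK_add, LinearMap.mulLeft_apply, mul_assoc]⟩
    exact this hx
  let f : D.Htheta →ₗ[k] D.Heis := LinearMap.mulRight k x ∘ₗ D.heisH.toLinearMap
  -- The induction speaks of subspaces of U(χ), so the condition on elements of H_θ is pushed
  -- forward along the inclusion.
  have h1 := D.Htheta_induction (((D.quantLT c m).comap f).map D.Htheta.val.toLinearMap)
    (fun l hl => ⟨⟨D.Kpow l, D.Kpow_mem_Htheta hl⟩, hK ⟨l, hl⟩, rfl⟩) h.2
  obtain ⟨h', h1, h2⟩ := h1
  rw [← Subtype.ext h2]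
  exact h1

theorem heisB_mul_mem_quantLT (i : Fin n) {m : ℕ} {x : D.Heis} (hx : x ∈ D.quantLT c m) :
    D.heisB c i * x ∈ D.quantLT c (m + 1) := by
  have : D.quantLT c m ≤ (D.quantLT c (m + 1)).comap (LinearMap.mulLeft k (D.heisB c i)) := by
    refine Submodule.span_le.2 ?_
    rintro _ ⟨l, u, hu, rfl⟩
    rw [SetLike.mem_coe, Submodule.mem_comap, LinearMap.mulLeft_apply, ← mul_assoc,
      heisB_mul_heisK, smul_mul_assoc, mul_assoc, heisB_mul_quantize]
    refine Submodule.smul_mem _ _ (D.heisH_mul_mem_quantLT c _ (add_mem ?_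
      (Submodule.smul_mem _ _ (D.heisH_mul_mem_quantLT c _ ?_))))
    · exact Submodule.subset_span ⟨0, _, ι_mul_mem_degreeLT i hu, by simp⟩
    · exact Submodule.subset_span ⟨0, _, degreeLT_mono (by omega)
        (leftDer_mem_degreeLT D.q (D.τ i) hu), by simp⟩
  exact this hx

/-- The spaces on the right contain 1 and behave under left multiplication by B̄_i and H_θ as the
filtration does, by the recursion for `quantize`. This puts the elements of H_θ on the left and
reduces words to values of `quantize`. -/
theorem filtLT_le_quantLT (m : ℕ) : D.filtLT c m ≤ D.quantLT c m := by
  have h : ∀ w, D.heisWord c w ∈ D.quantLT c (D.wordDegree w + 1) := by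
    intro w
    induction w with
    | nil =>
      exact Submodule.subset_span ⟨0, 1, monomial_mem_degreeLT (w := []) (by simp), by simp⟩
    | cons g w ih =>
      cases g with
      | inl i =>
        rw [heisWord_inl, wordDegree_inl]
        exact D.heisB_mul_mem_quantLT c i ih
      | inr h =>
        rw [heisWord_inr, wordDegree_inr]
        exact D.heisH_mul_mem_quantLT c h ih
  refine Submodule.span_le.2 ?_
  rintro _ ⟨w, hw, rfl⟩
  exact D.quantLT_mono c (by omega) (h w)

/-! ### Leading terms -/

/-- The span of the elements `K^l F_{j_1} ⋯ F_{j_m}` with `l` in the lattice of `H_θ`. -/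
def leadSpan (m : ℕ) : Submodule k D.U :=
  Submodule.span k {x | ∃ l ∈ D.thetaLattice, ∃ J : List (Fin n), J.length = m ∧
    D.Kpow l * FreeAlgebra.lift k D.F (monomial J) = x}

theorem F_mul_mem_leadSpan (i : Fin n) {m : ℕ} {x : D.U} (hx : x ∈ D.leadSpan m) :
    D.F i * x ∈ D.leadSpan (m + 1) := by
  have : D.leadSpan m ≤ (D.leadSpan (m + 1)).comap (LinearMap.mulLeft k (D.F i)) := by
    refine Submodule.span_le.2 ?_
    rintro _ ⟨l, hl, J, hJ, rfl⟩
    rw [SetLike.mem_coe, Submodule.mem_comap, LinearMap.mulLeft_apply, ← mul_assoc, F_mul_Kpow,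
      smul_mul_assoc]
    refine Submodule.smul_mem _ _ (Submodule.subset_span ⟨l, hl, i :: J, by simp [hJ], ?_⟩)
    simp [mul_assoc]
  exact this hx

theorem Htheta_mul_mem_leadSpan {h : D.U} (hh : h ∈ D.Htheta) {m : ℕ} {x : D.U}
    (hx : x ∈ D.leadSpan m) : h * x ∈ D.leadSpan m := by
  refine D.Htheta_induction ((D.leadSpan m).comap (LinearMap.mulRight k x)) (fun l hl => ?_) hh
  have : D.leadSpan m ≤ (D.leadSpan m).comap (LinearMap.mulLeft k (D.Kpow l)) := by
    refine Submodule.span_le.2 ?_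
    rintro _ ⟨l', hl', J, hJ, rfl⟩
    exact Submodule.subset_span ⟨l + l', add_mem hl hl', J, hJ, by
      rw [Kpow_add, LinearMap.mulLeft_apply, mul_assoc]⟩
  exact this hx

/-- The leading terms `F_i` and `h` of the generators `B̄_i` and `κ(h)`. -/
def leadGen : Fin n ⊕ D.Htheta → D.partialBosonization
  | .inl i => ⟨D.F i, D.F_mem i⟩
  | .inr h => ⟨h, D.Htheta_le h.2⟩

/-- The product of the leading terms of a word. -/
def leadWord (w : List (Fin n ⊕ D.Htheta)) : D.partialBosonization := (w.map D.leadGen).prod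

@[simp] theorem leadWord_nil : D.leadWord [] = 1 := rfl

@[simp] theorem leadWord_inl (i : Fin n) (w : List (Fin n ⊕ D.Htheta)) :
    (D.leadWord (.inl i :: w) : D.U) = D.F i * D.leadWord w := by
  simp [leadWord, leadGen]

@[simp] theorem leadWord_inr (h : D.Htheta) (w : List (Fin n ⊕ D.Htheta)) :
    (D.leadWord (.inr h :: w) : D.U) = h * D.leadWord w := by
  simp [leadWord, leadGen]

theorem leadWord_append (w w' : List (Fin n ⊕ D.Htheta)) :
    D.leadWord (w ++ w') = D.leadWord w * D.leadWord w' := by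
  simp [leadWord]

theorem leadWord_mem_leadSpan (w : List (Fin n ⊕ D.Htheta)) :
    (D.leadWord w : D.U) ∈ D.leadSpan (D.wordDegree w) := by
  induction w with
  | nil => exact Submodule.subset_span ⟨0, zero_mem _, [], rfl, by simp⟩
  | cons g w ih =>
    cases g with
    | inl i =>
      rw [leadWord_inl, wordDegree_inl]
      exact D.F_mul_mem_leadSpan i ih
    | inr h =>
      rw [leadWord_inr, wordDegree_inr]
      exact D.Htheta_mul_mem_leadSpan h.2 ih

/-! ### Reading off leading terms from the action on the vector `vec 0 1 1` -/

theorem act_lift_F_vec (p : T k n) :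
    D.act (FreeAlgebra.lift k D.F p) (D.vec 0 1 1) = D.vec 0 1 p := by
  have h : D.act.comp (FreeAlgebra.lift k D.F) = FreeAlgebra.lift k D.opF := by
    ext i : 2
    simp
  have h1 : (fun i : Fin n => D.χ (α i) 0) = 1 := by
    ext i
    simp [χ_zero_right]
  rw [← AlgHom.comp_apply, h, lift_opF_vec_one, h1]
  simp

/-- Acting on one vector separates the elements K^l p(F) modulo I. This replaces the triangular
decomposition of U(χ). -/
theorem act_Kpow_mul_lift_F_vec (l : Fin n → ℤ) (p : T k n) :
    D.act (D.Kpow l * FreeAlgebra.lift k D.F p) (D.vec 0 1 1) = D.vec l 1 p := by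
  rw [map_mul, Module.End.mul_apply, act_lift_F_vec, act_Kpow_vec, zero_add, map_one]

/-- The counit of the pre-Nichols algebra. -/
def preNicCounit : D.PreNic →ₗ[k] k :=
  D.preNicLift (counit k n).toLinearMap fun _ hx => D.counit_eq_zero hx

@[simp] theorem preNicCounit_toPreNic (a : T k n) :
    D.preNicCounit (D.toPreNic a) = counit k n a := rfl

/-- The linear map `u ↦ K^l u_m(F)`, where `u_m` is the component of degree `m`. -/
def componentF (m : ℕ) (l : Fin n → ℤ) : D.PreNic →ₗ[k] D.U :=
  D.preNicLift (LinearMap.mulLeft k (D.Kpow l) ∘ₗ (FreeAlgebra.lift k D.F).toLinearMap ∘ₗ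
    degreeProj k n m) fun x hx => by simp [D.lift_F_eq_zero (D.degreeProj_mem m hx)]

@[simp] theorem componentF_toPreNic (m : ℕ) (l : Fin n → ℤ) (u : T k n) :
    D.componentF m l (D.toPreNic u) =
      D.Kpow l * FreeAlgebra.lift k D.F (degreeProj k n m u) := rfl

/-- The linear map `vec l a u ↦ ε(a) K^l u_m(F)`, where `u_m` is the component of degree `m`. -/
def topPart (m : ℕ) : D.Tri →ₗ[k] D.U :=
  D.triLift fun l => (TensorProduct.lid k D.U).toLinearMap ∘ₗ
    TensorProduct.map D.preNicCounit (D.componentF m l)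

theorem topPart_vec (m : ℕ) (l : Fin n → ℤ) (a u : T k n) :
    D.topPart m (D.vec l a u) =
      counit k n a • (D.Kpow l * FreeAlgebra.lift k D.F (degreeProj k n m u)) := by
  rw [topPart, triLift_vec]
  simp

/-- The span of the vectors `a K^l u` where `u` has degree less than `m`. -/
def lowPart (m : ℕ) : Submodule k D.Tri :=
  Submodule.span k {v | ∃ l a, ∃ u ∈ degreeLT k n m, D.vec l a u = v}

theorem vec_mem_lowPart (l : Fin n → ℤ) (a : T k n) {m : ℕ} {u : T k n}
    (hu : u ∈ degreeLT k n m) : D.vec l a u ∈ D.lowPart m :=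
  Submodule.subset_span ⟨l, a, u, hu, rfl⟩

theorem lowPart_mono {m m' : ℕ} (h : m ≤ m') : D.lowPart m ≤ D.lowPart m' :=
  Submodule.span_mono fun _ ⟨l, a, u, hu, hv⟩ => ⟨l, a, u, degreeLT_mono h hu, hv⟩

theorem map_mem_lowPart {m m' : ℕ} {f : Module.End k D.Tri}
    (h : ∀ l a, ∀ u ∈ degreeLT k n m, f (D.vec l a u) ∈ D.lowPart m') {v : D.Tri}
    (hv : v ∈ D.lowPart m) : f v ∈ D.lowPart m' := by
  have : D.lowPart m ≤ (D.lowPart m').comap f := by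
    refine Submodule.span_le.2 ?_
    rintro _ ⟨l, a, u, hu, rfl⟩
    exact h l a u hu
  exact this hv

theorem opF_mem_lowPart (i : Fin n) {m : ℕ} {v : D.Tri} (hv : v ∈ D.lowPart m) :
    D.opF i v ∈ D.lowPart (m + 1) := by
  refine D.map_mem_lowPart (fun l a u hu => ?_) hv
  have hu' := degreeLT_mono (Nat.le_succ m) hu
  rw [opF_vec]
  exact add_mem (sub_mem (Submodule.smul_mem _ _ (D.vec_mem_lowPart _ _ (ι_mul_mem_degreeLT i hu)))
    (D.vec_mem_lowPart _ _ hu')) (D.vec_mem_lowPart _ _ hu')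

theorem opEt_mem_lowPart (i : Fin n) {m : ℕ} {v : D.Tri} (hv : v ∈ D.lowPart m) :
    D.opEt i v ∈ D.lowPart m := by
  refine D.map_mem_lowPart (fun l a u hu => ?_) hv
  rw [opEt_vec]
  exact D.vec_mem_lowPart _ _ hu

theorem act_Kpow_mem_lowPart (l : Fin n → ℤ) {m : ℕ} {v : D.Tri} (hv : v ∈ D.lowPart m) :
    D.act (D.Kpow l) v ∈ D.lowPart m := by
  refine D.map_mem_lowPart (fun l a u hu => ?_) hv
  rw [act_Kpow_vec]
  exact D.vec_mem_lowPart _ _ hu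

theorem act_Htheta_mem_lowPart {h : D.U} (hh : h ∈ D.Htheta) {m : ℕ} {v : D.Tri}
    (hv : v ∈ D.lowPart m) : D.act h v ∈ D.lowPart m :=
  D.Htheta_induction ((D.lowPart m).comap (LinearMap.applyₗ v ∘ₗ D.act.toLinearMap))
    (fun l _ => D.act_Kpow_mem_lowPart l hv) hh

theorem res_mem_lowPart {m : ℕ} {v : D.Tri} (hv : v ∈ D.lowPart m) :
    D.res v ∈ D.lowPart m := by
  refine D.map_mem_lowPart (fun l a u hu => ?_) hv
  rw [res_vec]
  split_ifs
  · exact D.vec_mem_lowPart _ _ hu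
  · exact zero_mem _

theorem topPart_eq_zero {m : ℕ} {v : D.Tri} (hv : v ∈ D.lowPart m) : D.topPart m v = 0 := by
  have : D.lowPart m ≤ LinearMap.ker (D.topPart m) := by
    refine Submodule.span_le.2 ?_
    rintro _ ⟨l, a, u, hu, rfl⟩
    rw [SetLike.mem_coe, LinearMap.mem_ker, topPart_vec, degreeProj_eq_zero hu]
    simp
  exact this hv

theorem leadSpan_induction {m : ℕ} {M : Type*} [AddCommGroup M] [Module k M]
    (f : D.U →ₗ[k] M) (S : Submodule k M)
    (h : ∀ l ∈ D.thetaLattice, ∀ J : List (Fin n), J.length = m →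
      f (D.Kpow l * FreeAlgebra.lift k D.F (monomial J)) ∈ S) {x : D.U}
    (hx : x ∈ D.leadSpan m) : f x ∈ S := by
  have : D.leadSpan m ≤ S.comap f := by
    refine Submodule.span_le.2 ?_
    rintro _ ⟨l, hl, J, hJ, rfl⟩
    exact h l hl J hJ
  exact this hx

/-- The linear map `x ↦ x · 1`. -/
def actOne : D.U →ₗ[k] D.Tri := LinearMap.applyₗ (D.vec 0 1 1) ∘ₗ D.act.toLinearMap

theorem actOne_apply (x : D.U) : D.actOne x = D.act x (D.vec 0 1 1) := rfl

theorem actOne_mem_lowPart {m : ℕ} {x : D.U} (hx : x ∈ D.leadSpan m) :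
    D.actOne x ∈ D.lowPart (m + 1) :=
  D.leadSpan_induction D.actOne _ (fun l hl J hJ => by
    rw [actOne_apply, act_Kpow_mul_lift_F_vec]
    exact D.vec_mem_lowPart _ _ (monomial_mem_degreeLT (by omega))) hx

theorem res_actOne {m : ℕ} {x : D.U} (hx : x ∈ D.leadSpan m) :
    D.res (D.actOne x) = D.actOne x := by
  have h := D.leadSpan_induction ((D.res - 1) ∘ₗ D.actOne) ⊥ (fun l hl J hJ => by
    rw [LinearMap.comp_apply, actOne_apply, act_Kpow_mul_lift_F_vec, LinearMap.sub_apply, res_vec,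
      if_pos (D.height_eq_zero hl)]
    simp) hx
  exact sub_eq_zero.1 ((Submodule.mem_bot k).1 h)

theorem topPart_actOne {m : ℕ} {x : D.U} (hx : x ∈ D.leadSpan m) :
    D.topPart m (D.actOne x) = x := by
  have h := D.leadSpan_induction (D.topPart m ∘ₗ D.actOne - LinearMap.id) ⊥ (fun l hl J hJ => by
    rw [LinearMap.sub_apply, LinearMap.comp_apply, actOne_apply, act_Kpow_mul_lift_F_vec,
      topPart_vec, degreeProj_monomial, if_pos hJ]
    simp) hx
  exact sub_eq_zero.1 ((Submodule.mem_bot k).1 h)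

theorem topPart_actOne_of_ne {m m' : ℕ} (hm : m' ≠ m) {x : D.U} (hx : x ∈ D.leadSpan m) :
    D.topPart m' (D.actOne x) = 0 := by
  have h := D.leadSpan_induction (D.topPart m' ∘ₗ D.actOne) ⊥ (fun l hl J hJ => by
    rw [LinearMap.comp_apply, actOne_apply, act_Kpow_mul_lift_F_vec,
      topPart_vec, degreeProj_monomial, if_neg (fun h => hm (by omega))]
    simp) hx
  exact (Submodule.mem_bot k).1 h

/-- The generators `B_i` and `h` as elements of `U(χ)^poly`. -/
def polyGen : Fin n ⊕ D.Htheta → D.Upoly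
  | .inl i => ⟨D.B c i, D.B_mem_Upoly c i⟩
  | .inr h => ⟨h, D.Htheta_le_Upoly h.2⟩

theorem coe_polyGen_inl (i : Fin n) : (D.polyGen c (.inl i) : D.U) = D.B c i := by
  rw [polyGen]

theorem coe_polyGen_inr (h : D.Htheta) : (D.polyGen c (.inr h) : D.U) = h := by
  rw [polyGen]

/-- The product of the generators `B_i` and `h` along a word. -/
def polyWord (w : List (Fin n ⊕ D.Htheta)) : D.Upoly := (w.map (D.polyGen c)).prod

theorem κ_polyWord (w : List (Fin n ⊕ D.Htheta)) :
    D.κ (D.polyWord c w) = D.heisWord c w := by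
  rw [polyWord, heisWord, map_list_prod, List.map_map]
  congr 2
  ext g
  cases g <;> rfl

theorem coe_polyWord_inl (i : Fin n) (w : List (Fin n ⊕ D.Htheta)) :
    (D.polyWord c (.inl i :: w) : D.U) = D.B c i * D.polyWord c w := by
  rw [polyWord, List.map_cons, List.prod_cons, MulMemClass.coe_mul, coe_polyGen_inl,
    ← polyWord]

theorem coe_polyWord_inr (h : D.Htheta) (w : List (Fin n ⊕ D.Htheta)) :
    (D.polyWord c (.inr h :: w) : D.U) = h * D.polyWord c w := by
  rw [polyWord, List.map_cons, List.prod_cons, MulMemClass.coe_mul, coe_polyGen_inr,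
    ← polyWord]

theorem actOne_mul (x y : D.U) : D.actOne (x * y) = D.act x (D.actOne y) := by
  rw [actOne_apply, actOne_apply, map_mul, Module.End.mul_apply]

/-- Since E_{τ(i)} K_i⁻¹ = Ẽ_{τ(i)} K^l with l = α_{τ(i)} - α_i, the second summand of B_i leaves u
unchanged; only F_i can raise the degree of u. -/
theorem act_B (i : Fin n) : D.act (D.B c i) =
    D.opF i + c i • (D.opEt (D.τ i) * D.act (D.Kpow (α (D.τ i) - α i))) := by
  rw [Kpow_theta_gen, map_mul D.act (D.K _), act_K, act_Kinv, ← mul_assoc, ← opE, B, map_add,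
    map_smul, map_mul, act_F, act_E, act_Kinv]

theorem act_B_sub_mem (i : Fin n) {m : ℕ} {v v' : D.Tri} (hv : v ∈ D.lowPart (m + 1))
    (h : v - v' ∈ D.lowPart m) :
    D.act (D.B c i) v - D.act (D.F i) v' ∈ D.lowPart (m + 1) := by
  have h1 : D.act (D.B c i) v - D.act (D.F i) v' = D.opF i (v - v') +
      c i • D.opEt (D.τ i) (D.act (D.Kpow (α (D.τ i) - α i)) v) := by
    rw [act_B, act_F, LinearMap.add_apply, LinearMap.smul_apply, Module.End.mul_apply, map_sub]
    abel
  rw [h1]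
  exact add_mem (D.opF_mem_lowPart i h) (Submodule.smul_mem _ _
    (D.opEt_mem_lowPart _ (D.act_Kpow_mem_lowPart _ hv)))

theorem act_polyWord_sub_mem (w : List (Fin n ⊕ D.Htheta)) :
    D.actOne (D.polyWord c w) - D.actOne (D.leadWord w) ∈ D.lowPart (D.wordDegree w) := by
  induction w with
  | nil =>
    rw [polyWord, List.map_nil, List.prod_nil, leadWord_nil, OneMemClass.coe_one,
      OneMemClass.coe_one, sub_self]
    exact zero_mem _
  | cons g w ih =>
    cases g with
    | inl i =>
      -- Besides the induction hypothesis, `act_B_sub_mem` needs a degree bound for the vector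
      -- itself; it is the sum of the error and the leading vector.
      have h := add_mem (D.lowPart_mono (Nat.le_succ _) ih)
        (D.actOne_mem_lowPart (D.leadWord_mem_leadSpan w))
      rw [sub_add_cancel] at h
      rw [coe_polyWord_inl, leadWord_inl, wordDegree_inl, actOne_mul, actOne_mul]
      exact D.act_B_sub_mem c i h ih
    | inr h =>
      rw [coe_polyWord_inr, leadWord_inr, wordDegree_inr, actOne_mul, actOne_mul, ← map_sub]
      exact D.act_Htheta_mem_lowPart h.2 ih

theorem heisVec_heisWord_sub_mem (w : List (Fin n ⊕ D.Htheta)) :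
    D.heisVec (D.heisWord c w) - D.actOne (D.leadWord w) ∈ D.lowPart (D.wordDegree w) := by
  rw [← κ_polyWord, heisVec_κ, ← actOne_apply, ← D.res_actOne (D.leadWord_mem_leadSpan w),
    ← map_sub]
  exact D.res_mem_lowPart (D.act_polyWord_sub_mem c w)

theorem heisVec_mem_lowPart {m : ℕ} {x : D.Heis} (hx : x ∈ D.filtLT c m) :
    D.heisVec x ∈ D.lowPart m := by
  have : D.filtLT c m ≤ (D.lowPart m).comap D.heisVec := by
    refine Submodule.span_le.2 ?_
    rintro _ ⟨w, hw, rfl⟩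
    have h := add_mem (D.lowPart_mono (Nat.le_succ _) (D.heisVec_heisWord_sub_mem c w))
      (D.actOne_mem_lowPart (D.leadWord_mem_leadSpan w))
    rw [sub_add_cancel] at h
    exact D.lowPart_mono hw h
  exact this hx

/-- The leading term of degree `m` of an element of `B̄_c`. -/
def leadTerm (m : ℕ) : D.Heis →ₗ[k] D.U := D.topPart m ∘ₗ D.heisVec

theorem leadTerm_heisWord (w : List (Fin n ⊕ D.Htheta)) :
    D.leadTerm (D.wordDegree w) (D.heisWord c w) = D.leadWord w := by
  have h := D.topPart_eq_zero (D.heisVec_heisWord_sub_mem c w)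
  rw [map_sub, D.topPart_actOne (D.leadWord_mem_leadSpan w)] at h
  exact sub_eq_zero.1 h

theorem leadTerm_eq_zero {m : ℕ} {x : D.Heis} (hx : x ∈ D.filtLT c m) : D.leadTerm m x = 0 :=
  D.topPart_eq_zero (D.heisVec_mem_lowPart c hx)

theorem heisWord_append (w w' : List (Fin n ⊕ D.Htheta)) :
    D.heisWord c (w ++ w') = D.heisWord c w * D.heisWord c w' := by
  simp [heisWord]

theorem wordDegree_append (w w' : List (Fin n ⊕ D.Htheta)) :
    D.wordDegree (w ++ w') = D.wordDegree w + D.wordDegree w' := by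
  simp [wordDegree]

theorem leadTerm_heisWord_of_le {m : ℕ} {w : List (Fin n ⊕ D.Htheta)} (hw : D.wordDegree w ≤ m) :
    D.leadTerm m (D.heisWord c w) = if D.wordDegree w = m then (D.leadWord w : D.U) else 0 := by
  split_ifs with h
  · rw [← h, leadTerm_heisWord]
  · exact D.leadTerm_eq_zero c (D.heisWord_mem_filtLT c (by omega))

/-- By bilinearity this concerns two words, and leading terms are compatible with concatenation. If
one of the words has smaller degree than its bound, both sides vanish. -/
theorem leadTerm_mul {i j : ℕ} {x y : D.Heis} (hx : x ∈ D.filtLT c (i + 1))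
    (hy : y ∈ D.filtLT c (j + 1)) :
    D.leadTerm (i + j) (x * y) = D.leadTerm i x * D.leadTerm j y := by
  induction hx, hy using Submodule.span_induction₂ with
  | mem_mem x y hx hy =>
    obtain ⟨w, hw, rfl⟩ := hx
    obtain ⟨w', hw', rfl⟩ := hy
    rw [← heisWord_append, leadTerm_heisWord_of_le, leadTerm_heisWord_of_le,
      leadTerm_heisWord_of_le, wordDegree_append]
    · by_cases h1 : D.wordDegree w = i
      · by_cases h2 : D.wordDegree w' = j
        · simp [h1, h2, leadWord_append]
        · rw [if_neg (by omega), if_neg h2, mul_zero]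
      · rw [if_neg (by omega), if_neg h1, zero_mul]
    · omega
    · omega
    · rw [wordDegree_append]
      omega
  | zero_left => simp
  | zero_right => simp
  | add_left x y z _ _ _ hx hy => simp only [add_mul, map_add, hx, hy]
  | add_right x y z _ _ _ hx hy => simp only [mul_add, map_add, hx, hy]
  | smul_left r x y _ _ h => simp only [smul_mul_assoc, map_smul, h]
  | smul_right r x y _ _ h => simp only [mul_smul_comm, map_smul, h]

theorem leadTerm_mem_leadSpan {m : ℕ} {x : D.Heis} (hx : x ∈ D.filtLT c (m + 1)) :
    D.leadTerm m x ∈ D.leadSpan m := by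
  have : D.filtLT c (m + 1) ≤ (D.leadSpan m).comap (D.leadTerm m) := by
    refine Submodule.span_le.2 ?_
    rintro _ ⟨w, hw, rfl⟩
    rw [SetLike.mem_coe, Submodule.mem_comap, leadTerm_heisWord_of_le _ _ (by omega)]
    split_ifs with h
    · exact h ▸ D.leadWord_mem_leadSpan w
    · exact zero_mem _
  exact this hx

theorem lift_heisB_monomial (J : List (Fin n)) :
    FreeAlgebra.lift k (D.heisB c) (monomial J) = D.heisWord c (J.map .inl) := by
  induction J with
  | nil => simp
  | cons i J ih => simp [ih]

@[simp] theorem wordDegree_map_inl (J : List (Fin n)) :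
    D.wordDegree (J.map .inl) = J.length := by
  induction J with
  | nil => simp
  | cons i J ih => simp [ih]

@[simp] theorem coe_leadWord_map_inl (J : List (Fin n)) :
    (D.leadWord (J.map .inl) : D.U) = FreeAlgebra.lift k D.F (monomial J) := by
  induction J with
  | nil => simp
  | cons i J ih => simp [ih]

/-- Modulo lower degree `quantize` may be replaced by substitution of the B̄_i, whose leading term
is known on words. -/
theorem leadTerm_heisK_mul_quantize (l : D.thetaLattice) {m : ℕ} {u : T k n}
    (hu : u ∈ degreeLT k n (m + 1)) :
    D.leadTerm m (D.heisK l * D.quantize c u) =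
      D.Kpow l * FreeAlgebra.lift k D.F (degreeProj k n m u) := by
  have h1 := D.leadTerm_eq_zero c (D.heisH_mul_mem_filtLT c ⟨D.Kpow l, D.Kpow_mem_Htheta l.2⟩
    (D.quantize_sub_lift_mem c hu))
  rw [mul_sub, map_sub, sub_eq_zero] at h1
  refine h1.trans ?_
  have : degreeLT k n (m + 1) ≤ LinearMap.eqLocus
      (D.leadTerm m ∘ₗ LinearMap.mulLeft k (D.heisK l) ∘ₗ
        (FreeAlgebra.lift k (D.heisB c)).toLinearMap)
      (LinearMap.mulLeft k (D.Kpow l) ∘ₗ (FreeAlgebra.lift k D.F).toLinearMap ∘ₗ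
        degreeProj k n m) := by
    refine Submodule.span_le.2 ?_
    rintro _ ⟨w, hw, rfl⟩
    have h6 : D.heisK l * D.heisWord c (w.map .inl) =
        D.heisWord c (.inr ⟨D.Kpow l, D.Kpow_mem_Htheta l.2⟩ :: w.map .inl) := by
      simp [heisK]
    simp only [SetLike.mem_coe, LinearMap.mem_eqLocus, LinearMap.comp_apply,
      AlgHom.toLinearMap_apply, LinearMap.mulLeft_apply, degreeProj_monomial]
    rw [lift_heisB_monomial, h6, leadTerm_heisWord_of_le, wordDegree_inr, wordDegree_map_inl]
    · split_ifs with h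
      · simp
      · simp
    · rw [wordDegree_inr, wordDegree_map_inl]
      omega
  exact this hu

theorem mem_I_of_one_tmul_eq_zero {u : T k n}
    (h : D.toPreNic 1 ⊗ₜ[k] D.toPreNic u = 0) : u ∈ D.I := by
  have h1 := congrArg ((TensorProduct.lid k D.PreNic).toLinearMap ∘ₗ
    TensorProduct.map D.preNicCounit (LinearMap.id (M := D.PreNic))) h
  simpa [toPreNic_eq_zero] using h1

/-- The heart of injectivity. Write x as a sum of K^l quantize(u_l). If the leading term vanishes,
the degree m parts of the u_l lie in I; `quantize` kills them, so each u_l may be replaced by a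
polynomial of smaller degree. -/
theorem mem_filtLT_of_leadTerm_eq_zero {m : ℕ} {x : D.Heis} (hx : x ∈ D.filtLT c (m + 1))
    (h : D.leadTerm m x = 0) : x ∈ D.filtLT c m := by
  let Ω : (D.thetaLattice →₀ T k n) →ₗ[k] D.Heis :=
    Finsupp.lsum k fun l => LinearMap.mulLeft k (D.heisK l) ∘ₗ D.quantize c
  let S : Submodule k (D.thetaLattice →₀ T k n) :=
    ⨅ l, (degreeLT k n (m + 1)).comap (Finsupp.lapply l)
  have hS : ∀ u, u ∈ S ↔ ∀ l, u l ∈ degreeLT k n (m + 1) := fun u => by simp [S]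
  have hle : D.quantLT c (m + 1) ≤ S.map Ω := by
    refine Submodule.span_le.2 ?_
    rintro _ ⟨l, u, hu, rfl⟩
    refine ⟨Finsupp.single l u, (hS _).2 fun l' => ?_, by simp [Ω]⟩
    by_cases hl : l = l'
    · subst hl
      simpa using hu
    · rw [Finsupp.single_eq_of_ne' hl]
      exact zero_mem _
  obtain ⟨u, hu, rfl⟩ := hle (D.filtLT_le_quantLT c _ hx)
  have hu' := (hS u).1 hu
  have hΩ : Ω u = ∑ l ∈ u.support, D.heisK l * D.quantize c (u l) := rfl
  have hI : ∀ l, degreeProj k n m (u l) ∈ D.I := by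
    intro l
    by_cases hl : l ∈ u.support
    -- Acting on `vec 0 1 1` places the summands for distinct l in distinct summands of `Tri`, so
    -- each of them vanishes separately.
    · have h1 : ∑ l ∈ u.support, D.vec l 1 (degreeProj k n m (u l)) = 0 := by
        rw [hΩ, map_sum] at h
        have h2 := congrArg D.actOne h
        rw [map_sum, map_zero] at h2
        rw [← h2]
        refine Finset.sum_congr rfl fun l _ => ?_
        rw [D.leadTerm_heisK_mul_quantize c l (hu' l), actOne_apply, act_Kpow_mul_lift_F_vec]
      have h2 := congrArg (D.triCoeff l) h1
      rw [map_sum, map_zero, Finset.sum_eq_single l] at h2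
      · rw [vec_apply, triCoeff_single, if_pos rfl] at h2
        exact D.mem_I_of_one_tmul_eq_zero h2
      · intro l' _ hl'
        rw [vec_apply, triCoeff_single, if_neg (fun h => hl' (Subtype.ext h))]
      · exact fun h => (h hl).elim
    · rw [Finsupp.notMem_support_iff.1 hl, map_zero]
      exact zero_mem _
  rw [hΩ]
  refine sum_mem fun l _ => D.heisH_mul_mem_filtLT c _ ?_
  have h1 : D.quantize c (u l) = D.quantize c (u l - degreeProj k n m (u l)) := by
    rw [map_sub, D.quantize_eq_zero c (hI l), sub_zero]
  rw [h1]
  exact D.quantize_mem_filtLT c (sub_degreeProj_mem (hu' l))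

/-! ### The canonical map -/

theorem coe_prod_BbarGen (w : List (Fin n ⊕ D.Htheta)) :
    (((w.map (D.BbarGen c)).prod : D.Bbar c) : D.Heis) = D.heisWord c w := by
  rw [heisWord, ← Subalgebra.coe_val, map_list_prod, List.map_map]
  rfl

theorem coe_mem_filtLT {m : ℕ} {x : D.Bbar c} (hx : x ∈ D.filtration c m) :
    (x : D.Heis) ∈ D.filtLT c (m + 1) := by
  have : D.filtration c m ≤ (D.filtLT c (m + 1)).comap (D.Bbar c).val.toLinearMap := by
    refine Submodule.span_le.2 ?_
    rintro _ ⟨w, hw, rfl⟩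
    exact Submodule.subset_span ⟨w, Nat.lt_succ_of_le hw, (D.coe_prod_BbarGen c w).symm⟩
  exact this hx

/-- The strict bound in `filtLT` is chosen to match `lower`, including m = 0 where both are zero. -/
theorem coe_mem_filtLT_of_mem_lower {m : ℕ} {x : D.Bbar c}
    (hx : x ∈ AssocGraded.lower (D.filtration c) m) : (x : D.Heis) ∈ D.filtLT c m := by
  have : AssocGraded.lower (D.filtration c) m ≤
      (D.filtLT c m).comap (D.Bbar c).val.toLinearMap :=
    iSup₂_le fun i hi y hy => D.filtLT_mono c hi (D.coe_mem_filtLT c hy)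
  exact this hx

theorem prod_BbarGen_mem_filtration (w : List (Fin n ⊕ D.Htheta)) :
    (w.map (D.BbarGen c)).prod ∈ D.filtration c (D.wordDegree w) :=
  Submodule.subset_span ⟨w, le_rfl, rfl⟩

theorem mem_lower_of_coe_mem_filtLT {m : ℕ} {x : D.Bbar c} (hx : (x : D.Heis) ∈ D.filtLT c m) :
    x ∈ AssocGraded.lower (D.filtration c) m := by
  have : D.filtLT c m ≤
      (AssocGraded.lower (D.filtration c) m).map (D.Bbar c).val.toLinearMap := by
    refine Submodule.span_le.2 ?_
    rintro _ ⟨w, hw, rfl⟩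
    exact ⟨_, Submodule.mem_iSup_of_mem _ (Submodule.mem_iSup_of_mem hw
      (D.prod_BbarGen_mem_filtration c w)), D.coe_prod_BbarGen c w⟩
  obtain ⟨y, hy, h⟩ := this hx
  rwa [← Subtype.ext h]

theorem Kpow_mul_lift_F_mem {l : Fin n → ℤ} (hl : l ∈ D.thetaLattice) (J : List (Fin n)) :
    D.Kpow l * FreeAlgebra.lift k D.F (monomial J) ∈ D.partialBosonization := by
  rw [lift_monomial]
  refine mul_mem (D.Htheta_le (D.Kpow_mem_Htheta hl)) (list_prod_mem fun x hx => ?_)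
  obtain ⟨i, -, rfl⟩ := List.mem_map.1 hx
  exact D.F_mem i

theorem leadSpan_le (m : ℕ) :
    D.leadSpan m ≤ (D.bosonizationComponent m).map D.partialBosonization.val.toLinearMap := by
  refine Submodule.span_le.2 ?_
  rintro _ ⟨l, hl, J, hJ, rfl⟩
  exact ⟨⟨_, D.Kpow_mul_lift_F_mem hl J⟩, Submodule.subset_span
    ⟨_, D.Kpow_mem_Htheta hl, J, hJ, congrArg (D.Kpow l * ·) (lift_monomial _ _)⟩, rfl⟩

theorem leadTerm_mem {m : ℕ} {x : D.Bbar c} (hx : x ∈ D.filtration c m) :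
    D.leadTerm m x ∈ D.partialBosonization := by
  obtain ⟨y, -, h⟩ := D.leadSpan_le m (D.leadTerm_mem_leadSpan c (D.coe_mem_filtLT c hx))
  rw [← h]
  exact y.2

/-- The leading term on the `m`-th filtration piece of `B̄_c`. -/
def leadTermRestrict (m : ℕ) : D.filtration c m →ₗ[k] D.partialBosonization :=
  LinearMap.codRestrict (Subalgebra.toSubmodule D.partialBosonization)
    (D.leadTerm m ∘ₗ (D.Bbar c).val.toLinearMap ∘ₗ (D.filtration c m).subtype)
    fun x => D.leadTerm_mem c x.2

theorem coe_leadTermRestrict (m : ℕ) (x : D.filtration c m) :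
    (D.leadTermRestrict c m x : D.U) = D.leadTerm m (x : D.Bbar c) := rfl

/-- The canonical map on the component of degree `m`. -/
def canonicalComponent (m : ℕ) :
    AssocGraded.Component (D.filtration c) m →ₗ[k] D.partialBosonization :=
  Submodule.liftQ _ (D.leadTermRestrict c m) fun _ hx =>
    Subtype.ext (D.leadTerm_eq_zero c (D.coe_mem_filtLT_of_mem_lower c hx))

theorem canonicalComponent_mk (m : ℕ) (x : D.filtration c m) :
    D.canonicalComponent c m (AssocGraded.mk _ m x) = D.leadTermRestrict c m x := rfl

theorem mk_surjective (m : ℕ) : Function.Surjective (AssocGraded.mk (D.filtration c) m) :=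
  Submodule.mkQ_surjective _

theorem coe_canonicalComponent_mem (m : ℕ) (x : AssocGraded.Component (D.filtration c) m) :
    (D.canonicalComponent c m x : D.U) ∈ D.leadSpan m := by
  obtain ⟨x, rfl⟩ := D.mk_surjective c m x
  exact D.leadTerm_mem_leadSpan c (D.coe_mem_filtLT c x.2)

theorem canonicalComponent_injective (m : ℕ) : Function.Injective (D.canonicalComponent c m) := by
  refine (injective_iff_map_eq_zero _).2 fun x hx => ?_
  obtain ⟨x, rfl⟩ := D.mk_surjective c m x
  rw [canonicalComponent_mk] at hx
  refine AssocGraded.mk_eq_zero _ _ _ (D.mem_lower_of_coe_mem_filtLT c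
    (D.mem_filtLT_of_leadTerm_eq_zero c (D.coe_mem_filtLT c x.2) ?_))
  rw [← coe_leadTermRestrict, hx, ZeroMemClass.coe_zero]

theorem canonicalComponent_one :
    D.canonicalComponent c 0 (GradedMonoid.GOne.one : AssocGraded.Component (D.filtration c) 0) =
      1 :=
  Subtype.ext (D.leadTerm_heisWord c [])

theorem canonicalComponent_mul {i j : ℕ} (x : AssocGraded.Component (D.filtration c) i)
    (y : AssocGraded.Component (D.filtration c) j) :
    D.canonicalComponent c (i + j) (GradedMonoid.GMul.mul x y) =
      D.canonicalComponent c i x * D.canonicalComponent c j y := by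
  obtain ⟨x, rfl⟩ := D.mk_surjective c i x
  obtain ⟨y, rfl⟩ := D.mk_surjective c j y
  exact Subtype.ext (D.leadTerm_mul c (D.coe_mem_filtLT c x.2) (D.coe_mem_filtLT c y.2))

/-- The canonical map `φ̄ : gr(B̄_c) → H_θ ⋉ U⁻`. -/
def canonicalMap : AssocGraded (D.filtration c) →ₐ[k] D.partialBosonization :=
  DirectSum.toAlgebra k (AssocGraded.Component (D.filtration c)) (D.canonicalComponent c)
    (D.canonicalComponent_one c) (D.canonicalComponent_mul c)

theorem canonicalMap_of (m : ℕ) (x : AssocGraded.Component (D.filtration c) m) :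
    D.canonicalMap c (DirectSum.of _ m x) = D.canonicalComponent c m x :=
  DirectSum.toAddMonoid_of (fun m => (D.canonicalComponent c m).toAddMonoidHom) m x

/-- The class of a word in the associated graded algebra. -/
def grWord (w : List (Fin n ⊕ D.Htheta)) : AssocGraded (D.filtration c) :=
  AssocGraded.symbol (D.filtration c) (D.wordDegree w) _ (D.prod_BbarGen_mem_filtration c w)

theorem canonicalMap_grWord (w : List (Fin n ⊕ D.Htheta)) :
    D.canonicalMap c (D.grWord c w) = D.leadWord w := by
  refine (D.canonicalMap_of c _ _).trans (Subtype.ext ?_)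
  rw [canonicalComponent_mk, coe_leadTermRestrict, coe_prod_BbarGen, leadTerm_heisWord]

theorem symbol_eq {i j : ℕ} (h : i = j) {x y : D.Bbar c} (hxy : x = y)
    (hx : x ∈ D.filtration c i) (hy : y ∈ D.filtration c j) :
    AssocGraded.symbol (D.filtration c) i x hx = AssocGraded.symbol (D.filtration c) j y hy := by
  subst h hxy
  rfl

theorem symbol_mul_symbol {i j : ℕ} {x y : D.Bbar c} (hx : x ∈ D.filtration c i)
    (hy : y ∈ D.filtration c j) :
    AssocGraded.symbol (D.filtration c) i x hx * AssocGraded.symbol (D.filtration c) j y hy =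
      AssocGraded.symbol (D.filtration c) (i + j) (x * y) (SetLike.mul_mem_graded hx hy) :=
  DirectSum.of_mul_of _ _

theorem grWord_nil : D.grWord c [] = 1 := rfl

theorem grB_eq (i : Fin n) : D.grB c i = D.grWord c [.inl i] :=
  D.symbol_eq c rfl (by simp) _ _

theorem grH_eq (h : D.Htheta) : D.grH c h = D.grWord c [.inr h] :=
  D.symbol_eq c rfl (by simp) _ _

theorem grWord_inl (i : Fin n) (w : List (Fin n ⊕ D.Htheta)) :
    D.grWord c (.inl i :: w) = D.grB c i * D.grWord c w := by
  refine (D.symbol_eq c ?_ (by simp) _ _).trans (D.symbol_mul_symbol c _ _).symm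
  rw [wordDegree_inl, add_comm]

theorem grWord_inr (h : D.Htheta) (w : List (Fin n ⊕ D.Htheta)) :
    D.grWord c (.inr h :: w) = D.grH c h * D.grWord c w := by
  refine (D.symbol_eq c ?_ (by simp) _ _).trans (D.symbol_mul_symbol c _ _).symm
  rw [wordDegree_inr, zero_add]

theorem canonicalMap_isCanonicalMap : D.IsCanonicalMap c (D.canonicalMap c) := by
  refine ⟨fun i => ?_, fun h => ?_⟩
  · rw [grB_eq, canonicalMap_grWord, leadWord, List.map_singleton, List.prod_singleton]
    rfl
  · rw [grH_eq, canonicalMap_grWord, leadWord, List.map_singleton, List.prod_singleton]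
    rfl

variable {c} in
theorem IsCanonicalMap.map_grWord {ψ : AssocGraded (D.filtration c) →ₐ[k] D.partialBosonization}
    (hψ : D.IsCanonicalMap c ψ) (w : List (Fin n ⊕ D.Htheta)) :
    ψ (D.grWord c w) = D.leadWord w := by
  induction w with
  | nil => rw [grWord_nil, map_one, leadWord_nil]
  | cons g w ih =>
    cases g with
    | inl i =>
      rw [grWord_inl, map_mul, ih, hψ.1, leadWord, leadWord, List.map_cons, List.prod_cons]
      rfl
    | inr h =>
      rw [grWord_inr, map_mul, ih, hψ.2, leadWord, leadWord, List.map_cons, List.prod_cons]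
      rfl

/-- Each component of the associated graded algebra is spanned by classes of words of degree exactly
m, since shorter words have class zero. This underlies uniqueness of the canonical map. -/
theorem filtration_induction {m : ℕ} {M : Type*} [AddCommGroup M] [Module k M]
    (f : AssocGraded.Component (D.filtration c) m →ₗ[k] M)
    (S : Submodule k M)
    (h : ∀ w, ∀ hw : D.wordDegree w = m, f (AssocGraded.mk _ m
      ⟨(w.map (D.BbarGen c)).prod, hw ▸ D.prod_BbarGen_mem_filtration c w⟩) ∈ S)
    (x : AssocGraded.Component (D.filtration c) m) : f x ∈ S := by
  obtain ⟨⟨x, hx⟩, rfl⟩ := D.mk_surjective c m x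
  have : D.filtration c m ≤
      (S.comap (f ∘ₗ AssocGraded.mk _ m)).map (D.filtration c m).subtype := by
    refine Submodule.span_le.2 ?_
    rintro _ ⟨w, hw, rfl⟩
    have hw' : (w.map (D.BbarGen c)).prod ∈ D.filtration c m := Submodule.subset_span ⟨w, hw, rfl⟩
    refine ⟨⟨_, hw'⟩, ?_, rfl⟩
    rcases (show D.wordDegree w ≤ m from hw).eq_or_lt with h1 | h1
    · exact h w h1
    · rw [SetLike.mem_coe, Submodule.mem_comap, LinearMap.comp_apply, AssocGraded.mk_eq_zero,
        map_zero]
      · exact zero_mem _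
      · exact Submodule.mem_iSup_of_mem _ (Submodule.mem_iSup_of_mem h1
          (D.prod_BbarGen_mem_filtration c w))
  obtain ⟨y, hy, h1⟩ := this hx
  have h2 : y = ⟨x, hx⟩ := Subtype.ext h1
  rw [← h2]
  exact hy

theorem of_mk_prod {m : ℕ} (w : List (Fin n ⊕ D.Htheta)) (hw : D.wordDegree w = m)
    (hx : (w.map (D.BbarGen c)).prod ∈ D.filtration c m) :
    DirectSum.of (AssocGraded.Component (D.filtration c)) m (AssocGraded.mk _ m ⟨_, hx⟩) =
      D.grWord c w :=
  D.symbol_eq c hw.symm rfl _ _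

variable {c} in
theorem IsCanonicalMap.eq {ψ : AssocGraded (D.filtration c) →ₐ[k] D.partialBosonization}
    (hψ : D.IsCanonicalMap c ψ) : ψ = D.canonicalMap c := by
  have h : ψ.toLinearMap = (D.canonicalMap c).toLinearMap := by
    refine DirectSum.linearMap_ext k fun m => LinearMap.ext fun x => ?_
    have h1 := D.filtration_induction c ((ψ.toLinearMap - (D.canonicalMap c).toLinearMap) ∘ₗ
      DirectSum.lof k ℕ (AssocGraded.Component (D.filtration c)) m) ⊥ (fun w hw => by
        rw [LinearMap.comp_apply, DirectSum.lof_eq_of, of_mk_prod _ _ _ hw, LinearMap.sub_apply,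
          AlgHom.toLinearMap_apply, AlgHom.toLinearMap_apply, hψ.map_grWord, canonicalMap_grWord,
          sub_self]
        exact zero_mem _) x
    exact sub_eq_zero.1 ((Submodule.mem_bot k).1 h1)
  exact AlgHom.ext fun x => DFunLike.congr_fun h x

/-- The degree m part of the image can be recovered inside U(χ), so images of different components
are independent and injectivity may be checked on each component. -/
theorem topPart_actOne_canonicalMap (m : ℕ) (x : AssocGraded (D.filtration c)) :
    D.topPart m (D.actOne (D.canonicalMap c x)) = D.canonicalComponent c m (x m) := by
  have h : D.topPart m ∘ₗ D.actOne ∘ₗ D.partialBosonization.val.toLinearMap ∘ₗ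
      (D.canonicalMap c).toLinearMap = D.partialBosonization.val.toLinearMap ∘ₗ
        D.canonicalComponent c m ∘ₗ DirectSum.component k ℕ _ m := by
    refine DirectSum.linearMap_ext k fun j => LinearMap.ext fun y => ?_
    simp only [LinearMap.comp_apply, AlgHom.toLinearMap_apply, DirectSum.lof_eq_of,
      canonicalMap_of, Subalgebra.coe_val]
    rw [← DirectSum.lof_eq_of k]
    by_cases hj : j = m
    · subst hj
      rw [DirectSum.component.lof_self, D.topPart_actOne (D.coe_canonicalComponent_mem c _ y)]
    · rw [DirectSum.component.of, dif_neg hj, map_zero, ZeroMemClass.coe_zero,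
        D.topPart_actOne_of_ne (Ne.symm hj) (D.coe_canonicalComponent_mem c _ y)]
  exact DFunLike.congr_fun h x

theorem canonicalMap_injective : Function.Injective (D.canonicalMap c) := by
  refine (injective_iff_map_eq_zero _).2 fun x hx => ?_
  refine DFunLike.ext _ _ fun m => D.canonicalComponent_injective c m (Subtype.ext ?_)
  rw [← topPart_actOne_canonicalMap, hx, ZeroMemClass.coe_zero, map_zero, map_zero]
  exact (congrArg Subtype.val (map_zero (D.canonicalComponent c m))).symm

theorem canonicalMap_surjective : Function.Surjective (D.canonicalMap c) := by
  have h : D.partialBosonization ≤ (D.canonicalMap c).range.map D.partialBosonization.val := by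
    refine sup_le (fun h hh => ?_) (Algebra.adjoin_le ?_)
    · exact ⟨_, ⟨D.grH c ⟨h, hh⟩, (D.canonicalMap_isCanonicalMap c).2 _⟩, rfl⟩
    · rintro _ ⟨i, rfl⟩
      exact ⟨_, ⟨D.grB c i, (D.canonicalMap_isCanonicalMap c).1 _⟩, rfl⟩
  intro x
  obtain ⟨y, ⟨z, rfl⟩, hz⟩ := h x.2
  exact ⟨z, Subtype.ext hz⟩

theorem map_homogeneous (m : ℕ) :
    (AssocGraded.homogeneous (D.filtration c) m).map (D.canonicalMap c).toLinearMap =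
      D.bosonizationComponent m := by
  refine le_antisymm ?_ (Submodule.span_le.2 ?_)
  · rintro _ ⟨_, ⟨x, rfl⟩, rfl⟩
    obtain ⟨y, hy, h⟩ := D.leadSpan_le m (D.coe_canonicalComponent_mem c m x)
    rw [DirectSum.lof_eq_of, AlgHom.toLinearMap_apply, canonicalMap_of, ← Subtype.ext h]
    exact hy
  · rintro x ⟨h, hh, J, rfl, hx⟩
    refine ⟨D.grWord c (.inr ⟨h, hh⟩ :: J.map .inl), ?_, Subtype.ext ?_⟩
    · have h2 : D.wordDegree (.inr ⟨h, hh⟩ :: J.map .inl) = J.length := by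
        rw [wordDegree_inr, wordDegree_map_inl]
      rw [← D.of_mk_prod c _ h2 (h2 ▸ D.prod_BbarGen_mem_filtration c _)]
      exact ⟨_, rfl⟩
    · rw [AlgHom.toLinearMap_apply, canonicalMap_grWord, leadWord_inr, coe_leadWord_map_inl, lift_monomial, hx]

/-! ### The Iwasawa decomposition -/

theorem Gplus_eq_range : D.Gplus = (FreeAlgebra.lift k D.heisE).range := by
  rw [Gplus, ← Algebra.map_top, ← FreeAlgebra.adjoin_range_ι, AlgHom.map_adjoin, ← Set.range_comp]
  congr 2
  ext i
  simp [heisE]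

theorem lift_heisE_mem (a : T k n) : FreeAlgebra.lift k D.heisE a ∈ D.Gplus := by
  rw [Gplus_eq_range]
  exact ⟨a, rfl⟩

theorem heisE_mem (i : Fin n) : D.heisE i ∈ D.Gplus := Algebra.subset_adjoin ⟨i, rfl⟩

theorem heisE_mul_heisF (i j : Fin n) :
    D.heisE i * D.heisF j = (D.q i j : k) • (D.heisF j * D.heisE i) +
      if i = j then algebraMap k D.Heis (D.q i i) else 0 := by
  have hU : D.E i * D.Kinv i * D.F j = (D.q i j : k) • (D.F j * (D.E i * D.Kinv i)) +
      if i = j then (D.q i i : k) • (1 - D.Kinv i * D.Kinv i) else 0 := by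
    rw [mul_assoc, Kinv_mul_F, mul_smul_comm, ← mul_assoc, E_mul_F, add_mul, smul_add, mul_assoc]
    split_ifs with h
    · subst h
      rw [sub_mul, K_mul_Kinv]
    · simp
  by_cases h : i = j
  · rw [if_pos h] at hU ⊢
    have h2 : D.heisE i * D.heisF j = (D.q i j : k) • (D.heisF j * D.heisE i) +
        (D.q i i : k) • (1 - D.κ ⟨D.Kinv i, D.Kinv_mem_Upoly i⟩ *
          D.κ ⟨D.Kinv i, D.Kinv_mem_Upoly i⟩) := by
      simp only [heisE, heisF, ← map_one D.κ, ← map_mul, ← map_smul, ← map_add, ← map_sub]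
      congr 1
      exact Subtype.ext hU
    rw [h2, κ_Kinv, zero_mul, sub_zero, Algebra.algebraMap_eq_smul_one]
  · rw [if_neg h, add_zero] at hU ⊢
    simp only [heisE, heisF, ← map_mul, ← map_smul]
    congr 1
    exact Subtype.ext hU

theorem heisF_mul_heisE (i j : Fin n) :
    D.heisF j * D.heisE i = (D.q i j : k)⁻¹ • (D.heisE i * D.heisF j -
      if i = j then algebraMap k D.Heis (D.q i i) else 0) := by
  rw [heisE_mul_heisF, add_sub_cancel_right, smul_smul, inv_mul_cancel₀ (Units.ne_zero _),
    one_smul]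

theorem heisK_mul_heisE (l : D.thetaLattice) (i : Fin n) :
    D.heisK l * D.heisE i = (D.χ (α i) l : k) • (D.heisE i * D.heisK l) := by
  rw [heisE, heisK, heisH, AlgHom.comp_apply, ← map_mul, ← map_mul, ← map_smul]
  congr 1
  refine Subtype.ext ?_
  change D.Kpow l * (D.E i * D.Kinv i) = (D.χ (α i) l : k) • (D.E i * D.Kinv i * D.Kpow l)
  rw [← mul_assoc, Kpow_mul_E, smul_mul_assoc, mul_assoc, mul_assoc, ← Kpow_neg_α, Kpow_comm]

/-- This form places Y_i in Ḡ⁺ B̄_c, and with it F_i = B̄_i - Y_i. -/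
theorem heisY_eq (i : Fin n) :
    D.heisY c i = c i • (D.heisE (D.τ i) * D.heisK (D.thetaGen i)) := by
  rw [heisY, heisE, heisK, heisH, AlgHom.comp_apply, ← map_mul, ← map_smul]
  congr 1
  refine Subtype.ext ?_
  change c i • (D.E (D.τ i) * D.Kinv i) =
    c i • (D.E (D.τ i) * D.Kinv (D.τ i) * D.Kpow (α (D.τ i) - α i))
  rw [Kpow_theta_gen, mul_assoc (D.E _), ← mul_assoc (D.Kinv _) (D.K _), Kinv_mul_K, one_mul]

theorem heisB_mem_Bbar (i : Fin n) : D.heisB c i ∈ D.Bbar c := (D.BbarGen c (.inl i)).2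

theorem heisH_mem_Bbar (h : D.Htheta) : D.heisH h ∈ D.Bbar c := (D.BbarGen c (.inr h)).2

theorem filtLT_le_Bbar (m : ℕ) : D.filtLT c m ≤ Subalgebra.toSubmodule (D.Bbar c) := by
  refine Submodule.span_le.2 ?_
  rintro _ ⟨w, -, rfl⟩
  rw [← coe_prod_BbarGen]
  exact Subtype.prop _

theorem heisK_mul_quantize_mem_Bbar (l : D.thetaLattice) (u : T k n) :
    D.heisK l * D.quantize c u ∈ D.Bbar c := by
  obtain ⟨m, hm⟩ := exists_mem_degreeLT u
  exact mul_mem (D.heisH_mem_Bbar c _) (D.filtLT_le_Bbar c m (D.quantize_mem_filtLT c hm))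

/-- Words in the B̄_i and in H_θ span B̄_c, and `filtLT_le_quantLT` rewrites them. -/
theorem Bbar_le_span : Subalgebra.toSubmodule (D.Bbar c) ≤
    Submodule.span k {x | ∃ l u, D.heisK l * D.quantize c u = x} := by
  let g : Fin n ⊕ D.Htheta → D.Heis := fun x => D.BbarGen c x
  have h1 : D.Bbar c ≤ Algebra.adjoin k (Set.range g) := by
    have h : D.Bc c ≤ ((Algebra.adjoin k (Set.range g)).comap D.κ).map D.Upoly.val := by
      refine sup_le (fun h hh => ?_) (Algebra.adjoin_le ?_)
      · exact ⟨⟨h, D.Htheta_le_Upoly hh⟩, Algebra.subset_adjoin ⟨.inr ⟨h, hh⟩, rfl⟩, rfl⟩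
      · rintro _ ⟨i, rfl⟩
        exact ⟨⟨D.B c i, D.B_mem_Upoly c i⟩, Algebra.subset_adjoin ⟨.inl i, rfl⟩, rfl⟩
    rintro _ ⟨x, hx, rfl⟩
    obtain ⟨y, hy, hxy⟩ := h hx
    rw [← Subtype.ext hxy]
    exact hy
  refine (Subalgebra.toSubmodule.monotone h1).trans ?_
  rw [Algebra.adjoin_eq_span]
  refine Submodule.span_le.2 fun x hx => ?_
  obtain ⟨L, hL, rfl⟩ := Submonoid.exists_list_of_mem_closure hx
  obtain ⟨w, rfl⟩ : L ∈ Set.range (List.map g) := by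
    rw [Set.range_list_map]
    exact hL
  have h2 := D.filtLT_le_quantLT c _ (D.heisWord_mem_filtLT c (Nat.lt_succ_self (D.wordDegree w)))
  refine Submodule.span_mono ?_ h2
  rintro _ ⟨l, u, -, h⟩
  exact ⟨l, u, h⟩

/-! ### Injectivity of multiplication by triangularity -/

theorem heisVec_lift_heisE_mul (a : T k n) (y : D.Heis) :
    D.heisVec (FreeAlgebra.lift k D.heisE a * y) =
      FreeAlgebra.lift k D.opEt a (D.heisVec y) := by
  have : D.heisVec ∘ₗ LinearMap.mulRight k y ∘ₗ (FreeAlgebra.lift k D.heisE).toLinearMap =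
      LinearMap.applyₗ (D.heisVec y) ∘ₗ (FreeAlgebra.lift k D.opEt).toLinearMap := by
    refine T_linearMap_ext (by simp) fun i x hx => ?_
    simp only [LinearMap.comp_apply, AlgHom.toLinearMap_apply, LinearMap.mulRight_apply,
      LinearMap.applyₗ_apply_apply] at hx ⊢
    rw [map_mul (FreeAlgebra.lift k D.heisE), map_mul (FreeAlgebra.lift k D.opEt),
      FreeAlgebra.lift_ι_apply, FreeAlgebra.lift_ι_apply, mul_assoc,
      Module.End.mul_apply, ← hx, heisE, heisVec_κ_mul, act_Et]
    rw [act_Et]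
    exact D.opEt_mul_res i
  exact DFunLike.congr_fun this a

theorem heisVec_heisK_mul (l : D.thetaLattice) (y : D.Heis) :
    D.heisVec (D.heisK l * y) = D.act (D.Kpow l) (D.heisVec y) :=
  D.heisVec_κ_mul (x := ⟨D.Kpow l, D.Htheta_le_Upoly (D.Kpow_mem_Htheta l.2)⟩)
    (D.act_Kpow_mul_res l.2) y

theorem lift_opEt_mem_lowPart (a : T k n) {m : ℕ} {v : D.Tri} (hv : v ∈ D.lowPart m) :
    FreeAlgebra.lift k D.opEt a v ∈ D.lowPart m := by
  refine D.map_mem_lowPart (fun l b u hu => ?_) hv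
  rw [lift_opEt_vec]
  exact D.vec_mem_lowPart _ _ hu

theorem heisVec_quantize_sub_mem {m : ℕ} {u : T k n} (hu : u ∈ degreeLT k n (m + 1)) :
    D.heisVec (D.quantize c u) - D.vec 0 1 u ∈ D.lowPart m := by
  have : degreeLT k n (m + 1) ≤ (D.lowPart m).comap
      (D.heisVec ∘ₗ (FreeAlgebra.lift k (D.heisB c)).toLinearMap - D.vec 0 1) := by
    refine Submodule.span_le.2 ?_
    rintro _ ⟨w, hw, rfl⟩
    have h := D.heisVec_heisWord_sub_mem c (w.map .inl)
    rw [wordDegree_map_inl, coe_leadWord_map_inl, ← lift_heisB_monomial, actOne_apply,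
      act_lift_F_vec] at h
    exact D.lowPart_mono (Nat.le_of_lt_succ hw) h
  have h1 := add_mem (D.heisVec_mem_lowPart c (D.quantize_sub_lift_mem c hu)) (this hu)
  rwa [LinearMap.sub_apply, LinearMap.comp_apply, AlgHom.toLinearMap_apply, map_sub,
    sub_add_sub_cancel] at h1

/-- Multiplying by Ẽ_i and by K^l commutes with `heisVec` and does not raise the degree of u, so the
estimate for `quantize` carries over. -/
theorem heisVec_product_sub_mem (l : D.thetaLattice) (a : T k n) {m : ℕ} {u : T k n}
    (hu : u ∈ degreeLT k n (m + 1)) :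
    D.heisVec (FreeAlgebra.lift k D.heisE a * (D.heisK l * D.quantize c u)) - D.vec l a u ∈
      D.lowPart m := by
  have h := D.lift_opEt_mem_lowPart a
    (D.act_Kpow_mem_lowPart l (D.heisVec_quantize_sub_mem c hu))
  rwa [map_sub, map_sub, act_Kpow_vec, lift_opEt_vec, zero_add, map_one, mul_one,
    ← heisVec_heisK_mul, ← heisVec_lift_heisE_mul] at h

/-- The linear map `T / I → Ḡ⁺`, `a ↦ a(Ẽ_1, …, Ẽ_n)` with `Ẽ_i = κ(E_i K_i⁻¹)`. -/
def toGplus : D.PreNic →ₗ[k] Subalgebra.toSubmodule D.Gplus :=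
  D.preNicLift (LinearMap.codRestrict (Subalgebra.toSubmodule D.Gplus)
    (FreeAlgebra.lift k D.heisE).toLinearMap D.lift_heisE_mem)
    fun _ hx => Subtype.ext (D.lift_heisE_eq_zero hx)

/-- The linear map `T / I → B̄_c`, `u ↦ κ(K^l) quantize(u)`. -/
def toBbar (l : D.thetaLattice) : D.PreNic →ₗ[k] Subalgebra.toSubmodule (D.Bbar c) :=
  D.preNicLift (LinearMap.codRestrict (Subalgebra.toSubmodule (D.Bbar c))
    (LinearMap.mulLeft k (D.heisK l) ∘ₗ D.quantize c) (D.heisK_mul_quantize_mem_Bbar c l))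
    fun x hx => Subtype.ext (by
      change D.heisK l * D.quantize c x = 0
      rw [D.quantize_eq_zero c hx, mul_zero])

open Classical in
/-- The projection onto the summands with index in the lattice of `H_θ`. -/
def thetaProj : Module.End k D.Tri :=
  D.triLift fun l => if l ∈ D.thetaLattice then D.triSingle l else 0

theorem thetaProj_vec {l : Fin n → ℤ} (hl : l ∈ D.thetaLattice) (a u : T k n) :
    D.thetaProj (D.vec l a u) = D.vec l a u := by
  rw [thetaProj, triLift_vec, if_pos hl, vec_apply]

theorem thetaProj_vec_of_notMem {l : Fin n → ℤ} (hl : l ∉ D.thetaLattice) (a u : T k n) :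
    D.thetaProj (D.vec l a u) = 0 := by
  rw [thetaProj, triLift_vec, if_neg hl, LinearMap.zero_apply]

open Classical in
/-- The linear map onto `Ḡ⁺ ⊗ B̄_c` with `vec l a u ↦ a(Ẽ) ⊗ κ(K^l) quantize(u)` for `l` in the
lattice of `H_θ`. -/
def iwasawaParam : D.Tri →ₗ[k]
    Subalgebra.toSubmodule D.Gplus ⊗[k] Subalgebra.toSubmodule (D.Bbar c) :=
  D.triLift (M := Subalgebra.toSubmodule D.Gplus ⊗[k] Subalgebra.toSubmodule (D.Bbar c))
    fun l => if hl : l ∈ D.thetaLattice then TensorProduct.map D.toGplus (D.toBbar c ⟨l, hl⟩) else 0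

theorem iwasawaParam_vec {l : Fin n → ℤ} (hl : l ∈ D.thetaLattice) (a u : T k n) :
    D.iwasawaParam c (D.vec l a u) =
      D.toGplus (D.toPreNic a) ⊗ₜ D.toBbar c ⟨l, hl⟩ (D.toPreNic u) := by
  rw [iwasawaParam, triLift_vec, dif_pos hl, TensorProduct.map_tmul]

theorem iwasawaParam_vec_of_notMem {l : Fin n → ℤ} (hl : l ∉ D.thetaLattice) (a u : T k n) :
    D.iwasawaParam c (D.vec l a u) = 0 := by
  rw [iwasawaParam, triLift_vec, dif_neg hl, LinearMap.zero_apply]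

theorem iwasawaParam_thetaProj (v : D.Tri) :
    D.iwasawaParam c (D.thetaProj v) = D.iwasawaParam c v := by
  refine D.Tri_induction (LinearMap.eqLocus (D.iwasawaParam c ∘ₗ D.thetaProj) (D.iwasawaParam c))
    (fun l a u => ?_) v
  rw [LinearMap.mem_eqLocus, LinearMap.comp_apply]
  by_cases hl : l ∈ D.thetaLattice
  · rw [thetaProj_vec _ hl]
  · rw [thetaProj_vec_of_notMem _ hl, iwasawaParam_vec_of_notMem _ _ hl, map_zero]

theorem iwasawaParam_surjective : Function.Surjective (D.iwasawaParam c) := by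
  rw [← LinearMap.range_eq_top, eq_top_iff, ← TensorProduct.span_tmul_eq_top]
  refine Submodule.span_le.2 ?_
  rintro _ ⟨⟨x, hx⟩, ⟨y, hy⟩, rfl⟩
  have hx' := hx
  rw [Subalgebra.mem_toSubmodule, Gplus_eq_range] at hx'
  obtain ⟨a, ha⟩ := hx'
  have hxa : (⟨x, hx⟩ : Subalgebra.toSubmodule D.Gplus) = D.toGplus (D.toPreNic a) :=
    Subtype.ext ha.symm
  rw [hxa]
  have : Subalgebra.toSubmodule (D.Bbar c) ≤ ((LinearMap.range (D.iwasawaParam c)).comap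
      (TensorProduct.mk k _ _ (D.toGplus (D.toPreNic a)))).map
        (Subalgebra.toSubmodule (D.Bbar c)).subtype := by
    refine (D.Bbar_le_span c).trans (Submodule.span_le.2 ?_)
    rintro _ ⟨l, u, rfl⟩
    exact ⟨D.toBbar c l (D.toPreNic u), ⟨D.vec l a u, D.iwasawaParam_vec c l.2 a u⟩, rfl⟩
  obtain ⟨z, hz, h⟩ := this hy
  have hzy : z = ⟨y, hy⟩ := Subtype.ext h
  rw [← hzy]
  exact hz

/-- The multiplication map `Ḡ⁺ ⊗ B̄_c → Heis(χ)`. -/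
def iwasawaMul :
    Subalgebra.toSubmodule D.Gplus ⊗[k] Subalgebra.toSubmodule (D.Bbar c) →ₗ[k] D.Heis :=
  Submodule.mulMap (Subalgebra.toSubmodule D.Gplus) (Subalgebra.toSubmodule (D.Bbar c))

theorem heisVec_iwasawaMul_sub_mem {m : ℕ} {v : D.Tri} (hv : v ∈ D.lowPart (m + 1)) :
    D.heisVec (D.iwasawaMul c (D.iwasawaParam c v)) - D.thetaProj v ∈ D.lowPart m := by
  have : D.lowPart (m + 1) ≤ (D.lowPart m).comap
      (D.heisVec ∘ₗ D.iwasawaMul c ∘ₗ D.iwasawaParam c - D.thetaProj) := by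
    refine Submodule.span_le.2 ?_
    rintro _ ⟨l, a, u, hu, rfl⟩
    rw [SetLike.mem_coe, Submodule.mem_comap, LinearMap.sub_apply, LinearMap.comp_apply,
      LinearMap.comp_apply]
    by_cases hl : l ∈ D.thetaLattice
    · rw [thetaProj_vec _ hl, iwasawaParam_vec _ _ hl]
      exact D.heisVec_product_sub_mem c ⟨l, hl⟩ a hu
    · rw [thetaProj_vec_of_notMem _ hl, iwasawaParam_vec_of_notMem _ _ hl, map_zero, map_zero,
        sub_zero]
      exact zero_mem _
  exact this hv

theorem exists_mem_lowPart (v : D.Tri) : ∃ m, v ∈ D.lowPart m := by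
  have h : v ∈ ⨆ m, D.lowPart m := by
    refine D.Tri_induction _ (fun l a u => ?_) v
    obtain ⟨m, hm⟩ := exists_mem_degreeLT u
    exact Submodule.mem_iSup_of_mem m (D.vec_mem_lowPart l a hm)
  exact (Submodule.mem_iSup_of_directed _
    (show Monotone D.lowPart from fun _ _ h => D.lowPart_mono h).directed_le).1 h

theorem lowPart_zero : D.lowPart 0 = ⊥ := by
  refine eq_bot_iff.2 (Submodule.span_le.2 ?_)
  rintro _ ⟨l, a, u, hu, rfl⟩
  rw [degreeLT_zero, Submodule.mem_bot] at hu
  rw [hu, map_zero]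
  exact zero_mem _

/-- Descent on the degree of u: if z comes from v and has product zero, then triangularity forces
the relevant part of v to have smaller degree. -/
theorem iwasawaMul_injective : Function.Injective (D.iwasawaMul c) := by
  refine (injective_iff_map_eq_zero _).2 fun z hz => ?_
  obtain ⟨v, rfl⟩ := D.iwasawaParam_surjective c z
  obtain ⟨m, hm⟩ := D.exists_mem_lowPart v
  induction m generalizing v with
  | zero =>
    rw [lowPart_zero, Submodule.mem_bot] at hm
    rw [hm, map_zero]
  | succ m ih =>
    have h := D.heisVec_iwasawaMul_sub_mem c hm
    rw [hz, map_zero, zero_sub, neg_mem_iff] at h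
    -- The part of v over the lattice of H_θ has the same image z and lies one degree lower, so the
    -- induction hypothesis applies to it.
    rw [← iwasawaParam_thetaProj] at hz ⊢
    exact ih _ hz h

/-- The product `Ḡ⁺ B̄_c` as a subspace of `Heis(χ)`. -/
def iwasawaSpan : Submodule k D.Heis :=
  Subalgebra.toSubmodule D.Gplus * Subalgebra.toSubmodule (D.Bbar c)

theorem heisE_mul_mem_iwasawaSpan (i : Fin n) {y : D.Heis} (hy : y ∈ D.iwasawaSpan c) :
    D.heisE i * y ∈ D.iwasawaSpan c := by
  have : D.iwasawaSpan c ≤ (D.iwasawaSpan c).comap (LinearMap.mulLeft k (D.heisE i)) := by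
    refine Submodule.mul_le.2 fun g hg b hb => ?_
    rw [Submodule.mem_comap, LinearMap.mulLeft_apply, ← mul_assoc]
    exact Submodule.mul_mem_mul
      (show D.heisE i * g ∈ D.Gplus from mul_mem (D.heisE_mem i) hg) hb
  exact this hy

theorem mem_iwasawaSpan {b : D.Heis} (hb : b ∈ D.Bbar c) : b ∈ D.iwasawaSpan c := by
  have h1 : (1 : D.Heis) ∈ Subalgebra.toSubmodule D.Gplus := D.Gplus.one_mem
  have h : 1 * b ∈ D.iwasawaSpan c := Submodule.mul_mem_mul h1 hb
  rwa [one_mul] at h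

/-- To move x past an element of Ḡ⁺ one letter at a time, both y and x y must stay in the span:
commuting F_j past Ẽ_i leaves a scalar multiple of y. -/
theorem mul_mem_iwasawaSpan {x : D.Heis} (hB : ∀ b ∈ D.Bbar c, x * b ∈ D.iwasawaSpan c)
    (hE : ∀ i, ∀ y ∈ D.iwasawaSpan c, x * y ∈ D.iwasawaSpan c →
      x * (D.heisE i * y) ∈ D.iwasawaSpan c) {y : D.Heis} (hy : y ∈ D.iwasawaSpan c) :
    x * y ∈ D.iwasawaSpan c := by
  have : D.iwasawaSpan c ≤ (D.iwasawaSpan c).comap (LinearMap.mulLeft k x) := by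
    refine Submodule.mul_le.2 fun g hg b hb => ?_
    rw [Subalgebra.mem_toSubmodule, Gplus_eq_range] at hg
    obtain ⟨a, rfl⟩ := hg
    let f : T k n →ₗ[k] D.Heis := LinearMap.mulRight k b ∘ₗ (FreeAlgebra.lift k D.heisE).toLinearMap
    have h := T_induction (((D.iwasawaSpan c).comap f) ⊓
      ((D.iwasawaSpan c).comap (LinearMap.mulLeft k x ∘ₗ f)))
      ⟨by simpa [f] using D.mem_iwasawaSpan c hb, by simpa [f] using hB b hb⟩
      (fun i a ha => ?_) a
    · exact h.2
    · have h1 : f (FreeAlgebra.ι k i * a) = D.heisE i * f a := by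
        simp [f, mul_assoc]
      refine ⟨?_, ?_⟩
      · rw [SetLike.mem_coe, Submodule.mem_comap, h1]
        exact D.heisE_mul_mem_iwasawaSpan c i ha.1
      · rw [SetLike.mem_coe, Submodule.mem_comap, LinearMap.comp_apply, h1]
        exact hE i _ ha.1 ha.2
  exact this hy

theorem heisK_mul_mem_iwasawaSpan (l : D.thetaLattice) {y : D.Heis} (hy : y ∈ D.iwasawaSpan c) :
    D.heisK l * y ∈ D.iwasawaSpan c := by
  refine D.mul_mem_iwasawaSpan c (fun b hb => ?_) (fun i y _ h => ?_) hy
  · exact D.mem_iwasawaSpan c (mul_mem (D.heisH_mem_Bbar c _) hb)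
  · rw [← mul_assoc, heisK_mul_heisE, smul_mul_assoc, mul_assoc]
    exact Submodule.smul_mem _ _ (D.heisE_mul_mem_iwasawaSpan c i h)

theorem heisF_mul_mem_iwasawaSpan (j : Fin n) {y : D.Heis} (hy : y ∈ D.iwasawaSpan c) :
    D.heisF j * y ∈ D.iwasawaSpan c := by
  refine D.mul_mem_iwasawaSpan c (fun b hb => ?_) (fun i y hy h => ?_) hy
  · rw [← add_sub_cancel_right (D.heisF j) (D.heisY c j), ← heisB_eq, sub_mul, heisY_eq,
      smul_mul_assoc, mul_assoc]
    exact sub_mem (D.mem_iwasawaSpan c (mul_mem (D.heisB_mem_Bbar c j) hb))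
      (Submodule.smul_mem _ _ (D.heisE_mul_mem_iwasawaSpan c _
        (D.heisK_mul_mem_iwasawaSpan c _ (D.mem_iwasawaSpan c hb))))
  · rw [← mul_assoc, heisF_mul_heisE, smul_mul_assoc, sub_mul, mul_assoc]
    refine Submodule.smul_mem _ _ (sub_mem (D.heisE_mul_mem_iwasawaSpan c i h) ?_)
    split_ifs
    · rw [← Algebra.smul_def]
      exact Submodule.smul_mem _ _ hy
    · rw [zero_mul]
      exact zero_mem _

/-- Thus Ḡ⁺ B̄_c is a left ideal of Heis(χ); it contains 1, so it is everything. -/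
theorem κ_mul_mem_iwasawaSpan (x : D.Upoly) {y : D.Heis} (hy : y ∈ D.iwasawaSpan c) :
    D.κ x * y ∈ D.iwasawaSpan c := by
  obtain ⟨x, hx⟩ := x
  induction hx using Algebra.adjoin_induction generalizing y with
  | mem x hx =>
    rcases hx with ((⟨i, rfl⟩ | ⟨i, rfl⟩) | ⟨i, rfl⟩) | ⟨i, rfl⟩
    · exact D.heisF_mul_mem_iwasawaSpan c i hy
    · exact D.heisE_mul_mem_iwasawaSpan c i hy
    · have h : D.κ ⟨D.Kinv i, D.Kinv_mem_Upoly i⟩ * y ∈ D.iwasawaSpan c := by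
        rw [κ_Kinv, zero_mul]
        exact zero_mem _
      exact h
    · have h := D.heisK_mul_mem_iwasawaSpan c (D.thetaGen (D.τ i)) hy
      have h1 : D.heisK (D.thetaGen (D.τ i)) =
          D.κ ⟨D.K i * D.Kinv (D.τ i), D.Htheta_le_Upoly (Algebra.subset_adjoin ⟨i, rfl⟩)⟩ := by
        rw [heisK, heisH, AlgHom.comp_apply]
        congr 1
        refine Subtype.ext ?_
        change D.Kpow (α (D.τ (D.τ i)) - α (D.τ i)) = _
        rw [Kpow_theta_gen, D.τ_invol]
      rw [h1] at h
      exact h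
  | algebraMap r =>
    have h : D.κ (algebraMap k D.Upoly r) * y ∈ D.iwasawaSpan c := by
      rw [AlgHom.commutes, ← Algebra.smul_def]
      exact Submodule.smul_mem _ _ hy
    exact h
  | add x x' hx hx' h h' =>
    have h1 : D.κ (⟨x, hx⟩ + ⟨x', hx'⟩) * y ∈ D.iwasawaSpan c := by
      rw [map_add, add_mul]
      exact add_mem (h hy) (h' hy)
    exact h1
  | mul x x' hx hx' h h' =>
    have h1 : D.κ (⟨x, hx⟩ * ⟨x', hx'⟩) * y ∈ D.iwasawaSpan c := by
      rw [map_mul, mul_assoc]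
      exact h (h' hy)
    exact h1

theorem iwasawaMul_surjective : Function.Surjective (D.iwasawaMul c) := by
  rw [← LinearMap.range_eq_top, iwasawaMul, Submodule.mulMap_range, eq_top_iff]
  rintro x -
  obtain ⟨x, rfl⟩ := D.κ_surjective x
  have h := D.κ_mul_mem_iwasawaSpan c x (D.mem_iwasawaSpan c (one_mem _))
  rwa [mul_one] at h

theorem hasIwasawaDecomposition : D.HasIwasawaDecomposition c :=
  ⟨D.iwasawaMul_injective c, D.iwasawaMul_surjective c⟩

end Datum

end PreNichols

theorem theorem2p6 {k : Type*} [Field k] {n : ℕ} (D : PreNichols.Datum k n) (c : Fin n → k) :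
    (∃ φ : AssocGraded (D.filtration c) →ₐ[k] D.partialBosonization,
      D.IsCanonicalMap c φ ∧
      (∀ ψ, D.IsCanonicalMap c ψ → ψ = φ) ∧
      Function.Bijective φ ∧
      ∀ m : ℕ, (AssocGraded.homogeneous (D.filtration c) m).map φ.toLinearMap =
        D.bosonizationComponent m) ∧
    D.HasIwasawaDecomposition c :=
  ⟨⟨D.canonicalMap c, D.canonicalMap_isCanonicalMap c, fun _ hψ => hψ.eq,
    ⟨D.canonicalMap_injective c, D.canonicalMap_surjective c⟩, D.map_homogeneous c⟩,
    D.hasIwasawaDecomposition c⟩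

end
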